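/- Let $\phi\in \mathrm{SL}(2,\mathbb Z)$ be Anosov, i.e. with two distinct real eigenvalues, and let $M=T\times[0,1]/(x,0)\sim(\phi x,1)$ be the corresponding bundle over the circle, with fibre the punctured torus $T=(\mathbb R^2\setminus\mathbb Z^2)/\mathbb Z^2$. Then $\phi$ is conjugate in $\mathrm{SL}(2,\mathbb Z)$ to $\pm W$, where $W$ is a word of some length $N$ in $R=\begin{pmatrix}1&1\\0&1\end{pmatrix}$ and $L=\begin{pmatrix}1&0\\1&1\end{pmatrix}$ that begins with $R$ and ends with $L$. For every such word $W$ the following holds. The monodromy (Floyd–Hatcher) triangulation $\mathcal T$ of $M$ has tetrahedra $\mathcal T_1,\dots,\mathcal T_N$. With $W_{k}$ the product of the first $k$ letters of $W$, the tetrahedron $\mathcal T_{k+1}$ is layered over the parallelogram $W_{k}([0,1]^2)$ modulo $\mathbb Z^2$, with bottom edge over the diagonal of direction $W_{k}(-1,1)$ and top edge over the diagonal of direction $W_k(1,1)$; the top faces of each tetrahedron are glued to the bottom faces of the next one, and those of $\mathcal T_N$ to the bottom faces of $\mathcal T_1$ by the monodromy $\pm W$. Give $\mathcal T_j$ a real shape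 parameter $z_j\in\mathbb R\setminus\{0,1\}$, placed at its top and bottom edges, and the parameters $\frac{1}{1-z_j}$, $\frac{z_j-1}{z_j}$ at the other two pairs of opposite edges according to the orientation. An edge of $\mathcal T_j$ has dihedral angle $\pi$ if its parameter is negative and $0$ if it is positive. The real deformation variety $\mathscr D_{\mathbb R}\subset\mathbb R^N$ is the set of all $(z_j)$ such that, around each edge $e$ of $\mathcal T$, the product $g_e$ of the parameters is $1$ and the total dihedral angle is $2\pi$. Its tangent space at a point is the common kernel of the differentials $dg_e$. Let $H(\epsilon)$ be the exponential length of the puncture curve $\epsilon$ (the simple closed curve around the puncture in a fibre), i.e. the derivative of its holonomy, which is a product of shape parameters and their inverses along $\epsilon$; its signed length is $\log H(\epsilon)$. Let $r_+$ and $r_-$ be non-zero linear forms on $\mathbb R^2$ with $r_\pm\circ W=\lambda_\pm r_\pm$, where $\lambda_+>1>\lambda_->0$ are the eigenvalues of $W$, and let $z^{\pm}=(z^\pm_j)$ be the shape parameters (cross ratios) obtained by projecting the vertices of the parallelograms under the tetrahedra to $\mathbb R$ by $r_\pm$. Then: 1. $z^+$ and $z^-$ lie in $\mathscr D_{\mathbb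 R}$. Let $\mathcal V^{+}$, $\mathcal V^-$ be the connected components of $\mathscr D_{\mathbb R}$ that contain them. Then $\mathcal V^+\cap\mathcal V^-=\emptyset$ and $\mathcal V^+\cup\mathcal V^-=\{(z_j)\in\mathscr D_{\mathbb R} : z_j>0 \text{ for all } j\}$. 2. For $\mathcal V=\mathcal V^+$ and for $\mathcal V=\mathcal V^-$: $\mathcal V$ is smooth of dimension one and parameterized by the signed length of the puncture curve, that is, $H(\epsilon)>0$ on $\mathcal V$ and there is a smooth embedding $\gamma:\mathbb R\to\mathbb R^N$ with image $\mathcal V$ and nowhere vanishing derivative such that $\log H(\epsilon)=t$ at $\gamma(t)$ for all $t\in\mathbb R$, and the tangent space of $\mathscr D_{\mathbb R}$ at $\gamma(t)$ is the line spanned by $\gamma'(t)$. At every point of $\mathcal V$ this tangent space contains a vector all of whose entries are positive. -/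

import Mathlib

open scoped ContDiff

noncomputable section

namespace PuncturedTorus

/-! ### Oriented ideal triangulations, Thurston's equations over the reals -/

/-- An oriented (topological) ideal triangulation with tetrahedra indexed by `T`. The ideal vertices
of every tetrahedron are labelled by `Fin 4` compatibly with the orientation. The face of `t`
opposite to its vertex `f` is glued to the face of `nbr t f` opposite to the vertex `perm t f f`, and
a vertex `i ≠ f` of the first face is identified with the vertex `perm t f i` of the second. The face
pairings reverse the orientations of the faces. -/
structure IdealTriangulation (T : Type) where
  nbr : T → Fin 4 → T
  perm : T → Fin 4 → Equiv.Perm (Fin 4)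
  nbr_nbr : ∀ t f, nbr (nbr t f) (perm t f f) = t
  perm_perm : ∀ t f, perm (nbr t f) (perm t f f) = (perm t f)⁻¹
  odd : ∀ t f, Equiv.Perm.sign (perm t f) = -1
  not_self : ∀ t f, (nbr t f, perm t f f) ≠ (t, f)

/-- The shape parameter of the edge `e` of the ideal tetrahedron with vertices `∞, 0, 1, z`
(labelled `0, 1, 2, 3` in this order). -/
def edgeParam (z : ℝ) (e : Finset (Fin 4)) : ℝ :=
  if e = {0, 1} ∨ e = {2, 3} then z
  else if e = {0, 2} ∨ e = {1, 3} then 1 / (1 - z)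
  else (z - 1) / z

/-- The dihedral angle of a collapsed tetrahedron at an edge with real shape parameter `p`. -/
def dihedralAngle (p : ℝ) : ℝ := if p < 0 then Real.pi else 0

/-- The edges of the single tetrahedra, before gluing. -/
abbrev EdgeSlot (T : Type) : Type := T × {e : Finset (Fin 4) // e.card = 2}

namespace IdealTriangulation

variable {T : Type} (𝒯 : IdealTriangulation T)

/-- Two edges of tetrahedra are identified by one of the face pairings. -/
def EdgeAdj (a b : EdgeSlot T) : Prop :=
  ∃ f, f ∉ a.2.1 ∧ b.1 = 𝒯.nbr a.1 f ∧ b.2.1 = a.2.1.map (𝒯.perm a.1 f).toEmbedding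

/-- The edges of the triangulation: classes for the equivalence relation generated by `EdgeAdj`. -/
def Edge : Type := Quot 𝒯.EdgeAdj

open Classical in
/-- The edge holonomy: the product of the shape parameters around the edge `E`. -/
def edgeHolonomy [Fintype T] (z : T → ℝ) (E : 𝒯.Edge) : ℝ :=
  ∏ a : EdgeSlot T with Quot.mk 𝒯.EdgeAdj a = E, edgeParam (z a.1) a.2.1

open Classical in
/-- The total dihedral angle around the edge `E`. -/
def totalAngle [Fintype T] (z : T → ℝ) (E : 𝒯.Edge) : ℝ :=
  ∑ a : EdgeSlot T with Quot.mk 𝒯.EdgeAdj a = E, dihedralAngle (edgeParam (z a.1) a.2.1)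

/-- The real deformation variety: real shape parameters, different from `0` and `1`, for which the
edge holonomy is `1` and the total dihedral angle is `2π` at every edge. -/
def realDeformationVariety [Fintype T] : Set (T → ℝ) :=
  {z | (∀ t, z t ≠ 0 ∧ z t ≠ 1) ∧
    ∀ E : 𝒯.Edge, 𝒯.edgeHolonomy z E = 1 ∧ 𝒯.totalAngle z E = 2 * Real.pi}

/-- The (Zariski) tangent space of the deformation variety at `z`: the common kernel of the
differentials of the edge holonomies. -/
def tangentSpace [Fintype T] (z : T → ℝ) : Submodule ℝ (T → ℝ) :=
  ⨅ E : 𝒯.Edge, LinearMap.ker (fderiv ℝ (fun z' => 𝒯.edgeHolonomy z' E) z).toLinearMap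

end IdealTriangulation

/-! ### Curves on the boundary and their exponential length -/

/-- A segment `(t, π)` of a curve in the triangulated link of the ideal vertices: in the link of the
vertex `π 0` of the tetrahedron `t`, which is a triangle, it turns around the corner cut out by the
edge `π 0, π 1`, entering through the face `π 0, π 1, π 2` and leaving through the face
`π 0, π 1, π 3`. -/
abbrev Segment (T : Type) : Type := T × Equiv.Perm (Fin 4)

/-- How a curve continues after a segment: around the same edge of the triangulation, or around the
edge at the other end of the side (of a link triangle) that it has just crossed. -/
inductive Turn where
  | same
  | switch

/-- The contribution of a segment to the exponential length: the shape parameter of the edge, or its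
inverse, according to the direction in which the segment turns around it. This is the cross ratio of
the vertices in the order `π 0, π 1, π 2, π 3`. -/
def segmentLength {T : Type} (z : T → ℝ) (a : Segment T) : ℝ :=
  edgeParam (z a.1) {a.2 0, a.2 1} ^ ((Equiv.Perm.sign a.2 : ℤˣ) : ℤ)

/-- The permutations of the roles of the four vertices from one segment to the next. -/
def Turn.shift : Turn → Equiv.Perm (Fin 4)
  | .same => Equiv.swap 2 3
  | .switch => Equiv.swap 1 2 * Equiv.swap 1 3

namespace IdealTriangulation

variable {T : Type} (𝒯 : IdealTriangulation T)

/-- The segment that follows `(t, π)`: the face `π 0, π 1, π 3` of `t`, opposite to `π 2`, is crossed.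
With `σ` the gluing permutation, the next segment is around the edge `σ (π 0), σ (π 1)` for
`Turn.same`, and around the edge `σ (π 0), σ (π 3)` for `Turn.switch`. -/
def next (a : Segment T) (m : Turn) : Segment T :=
  (𝒯.nbr a.1 (a.2 2), 𝒯.perm a.1 (a.2 2) * a.2 * m.shift)

/-- The exponential length of the curve with first segment `a` and turns `ms` (one turn after each
segment; for a closed curve the last turn leads back to `a`): the derivative of its holonomy. -/
def curveLength (z : T → ℝ) : Segment T → List Turn → ℝ
  | _, [] => 1
  | a, m :: ms => segmentLength z a * curveLength z (𝒯.next a m) ms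

end IdealTriangulation

/-! ### The monodromy triangulation of a punctured torus bundle -/

/-- Distinct real eigenvalues. -/
def IsAnosov (φ : Matrix.SpecialLinearGroup (Fin 2) ℤ) : Prop :=
  ∃ a b : ℝ, a ≠ b ∧
    Module.End.HasEigenvalue (Matrix.toLin' (φ.1.map (Int.cast : ℤ → ℝ))) a ∧
    Module.End.HasEigenvalue (Matrix.toLin' (φ.1.map (Int.cast : ℤ → ℝ))) b

inductive Letter where
  | R
  | L

/-- The standard transvection matrices. -/
def Letter.mat : Letter → Matrix (Fin 2) (Fin 2) ℤ
  | .R => !![1, 1; 0, 1]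
  | .L => !![1, 0; 1, 1]

/-- The product of the first (left-most) `k` letters of the word. -/
def prefixMat {n : ℕ} (w : Fin (n + 1) → Letter) (k : ℕ) : Matrix (Fin 2) (Fin 2) ℤ :=
  ((List.ofFn fun i => (w i).mat).take k).prod

/-- The word as a matrix. -/
def wordMat {n : ℕ} (w : Fin (n + 1) → Letter) : Matrix (Fin 2) (Fin 2) ℤ :=
  prefixMat w (n + 1)

/-- The word `w`, of the form `R ⋯ R L ⋯ L R ⋯ R ⋯ L ⋯ L` (it begins with `R` and ends with `L`),
and the sign `s` describe the monodromy `φ` up to conjugation: `A φ A⁻¹ = s W`. -/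
def IsMonodromyWord (φ : Matrix.SpecialLinearGroup (Fin 2) ℤ) {n : ℕ} (w : Fin (n + 1) → Letter)
    (s : ℤˣ) : Prop :=
  w 0 = .R ∧ w (Fin.last n) = .L ∧
    ∃ A : Matrix.SpecialLinearGroup (Fin 2) ℤ, (A * φ * A⁻¹).1 = (s : ℤ) • wordMat w

/-- The vertices of the unit square. The `k`-th tetrahedron of the monodromy triangulation
(`k = 0, …, n`) is layered over the parallelogram with vertices `prefixMat w k *ᵥ corner i`, up to
integer translations. Its top edge is the diagonal from `corner 0` to `corner 1`, its bottom edge the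
diagonal from `corner 2` to `corner 3` (which are the two edges with shape parameter `z`), and the
labels `0, 1, 2, 3` agree with the orientation. The faces opposite to `2` and `3` are the top faces,
those opposite to `0` and `1` the bottom faces. -/
def corner : Fin 4 → Fin 2 → ℤ := ![![0, 0], ![1, 1], ![0, 1], ![1, 0]]

def Letter.partner : Letter → Fin 4 → Fin 4
  | .R => ![3, 2, 1, 0]
  | .L => ![2, 3, 0, 1]

/-- The gluing of the face opposite to `f` for two consecutive tetrahedra, in either direction, if the
frame of the upper one is obtained from that of the lower one by the matrix `X`. -/
def Letter.layerPerm (X : Letter) (f : Fin 4) : Equiv.Perm (Fin 4) := Equiv.swap f (X.partner f)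

/-- On each top face (opposite to `2` or `3`) of the lower tetrahedron, the vertex identification is
the one given by the matrix of the letter and an integer translation. -/
theorem layerPerm_affine (X : Letter) (f : Fin 4) (hf : 2 ≤ f) : ∃ v : Fin 2 → ℤ, ∀ i, i ≠ f →
    corner i = X.mat.mulVec (corner (X.layerPerm f i)) + v := by
  have hf' : f = 2 ∨ f = 3 := by fin_cases f <;> simp_all
  rcases hf' with rfl | rfl <;> cases X
  · exact ⟨![0, 0], by decide⟩
  · exact ⟨![0, -1], by decide⟩
  · exact ⟨![-1, 0], by decide⟩
  · exact ⟨![0, 0], by decide⟩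

/-- The rotation of the unit square by `π`, on the labels of its vertices. -/
def halfTurn : Equiv.Perm (Fin 4) := Equiv.swap 0 1 * Equiv.swap 2 3

/-- The tetrahedron glued to the `k`-th one along the face opposite to `f`: the next one (cyclically)
for the top faces, the previous one for the bottom faces. -/
def monoNbr {n : ℕ} (k : Fin (n + 1)) (f : Fin 4) : Fin (n + 1) :=
  if 2 ≤ f then k + 1 else k - 1

/-- The letter of the layer that contains the face opposite to `f` of the `k`-th tetrahedron. -/
def monoLetter {n : ℕ} (w : Fin (n + 1) → Letter) (k : Fin (n + 1)) (f : Fin 4) : Letter :=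
  if 2 ≤ f then w k else w (k - 1)

/-- The face opposite to `f` of the `k`-th tetrahedron is a top face of the last tetrahedron or a
bottom face of the first one. -/
def IsSeam {n : ℕ} (k : Fin (n + 1)) (f : Fin 4) : Prop :=
  if 2 ≤ f then k = Fin.last n else k = 0

instance {n : ℕ} (k : Fin (n + 1)) (f : Fin 4) : Decidable (IsSeam k f) := by
  unfold IsSeam
  infer_instance

/-- The gluing permutations. The top of the stack of tetrahedra is glued to its bottom by the
monodromy `s W`; if `s = -1`, this differs from the gluing by `W` by a half turn. -/
def monoPerm {n : ℕ} (w : Fin (n + 1) → Letter) (s : ℤˣ) (k : Fin (n + 1)) (f : Fin 4) :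
    Equiv.Perm (Fin 4) :=
  (if s = -1 ∧ IsSeam k f then halfTurn else 1) * (monoLetter w k f).layerPerm f

theorem monoPerm_apply_self_le {n : ℕ} (w : Fin (n + 1) → Letter) (s : ℤˣ) (k : Fin (n + 1))
    (f : Fin 4) : 2 ≤ monoPerm w s k f f ↔ ¬ 2 ≤ f := by
  have h : ∀ f : Fin 4, ∀ X : Letter, (2 ≤ X.layerPerm f f ↔ ¬ 2 ≤ f) ∧
      (2 ≤ (halfTurn * X.layerPerm f) f ↔ ¬ 2 ≤ f) := by
    intro f X
    cases X <;> revert f <;> decide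
  unfold monoPerm
  split_ifs
  · exact (h _ _).2
  · simpa using (h _ _).1

theorem monoNbr_monoNbr {n : ℕ} (w : Fin (n + 1) → Letter) (s : ℤˣ) (k : Fin (n + 1))
    (f : Fin 4) : monoNbr (monoNbr k f) (monoPerm w s k f f) = k := by
  unfold monoNbr
  simp only [monoPerm_apply_self_le]
  split_ifs <;> simp

/-- The monodromy (Floyd–Hatcher) triangulation of the mapping torus of `s W`. -/
def monodromyTriangulation {n : ℕ} (w : Fin (n + 1) → Letter) (s : ℤˣ) :
    IdealTriangulation (Fin (n + 1)) where
  nbr := monoNbr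
  perm := monoPerm w s
  nbr_nbr := monoNbr_monoNbr w s
  perm_perm := by
    intro k f
    have hL : monoLetter w (monoNbr k f) (monoPerm w s k f f) = monoLetter w k f := by
      unfold monoLetter monoNbr
      simp only [monoPerm_apply_self_le]
      split_ifs <;> simp
    have hS : IsSeam (monoNbr k f) (monoPerm w s k f f) ↔ IsSeam k f := by
      unfold IsSeam monoNbr
      simp only [monoPerm_apply_self_le]
      split_ifs
      · rw [← Fin.last_add_one n, add_left_inj]
      · rw [← Fin.last_add_one n, sub_eq_iff_eq_add]
    have key : ∀ f : Fin 4, ∀ X : Letter,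
        X.layerPerm (X.layerPerm f f) = (X.layerPerm f)⁻¹ ∧
        halfTurn * X.layerPerm ((halfTurn * X.layerPerm f) f) =
          (halfTurn * X.layerPerm f)⁻¹ := by
      intro f X
      cases X <;> revert f <;> decide
    conv_lhs => rw [monoPerm]
    rw [hL, if_congr (and_congr_right fun _ => hS) rfl rfl]
    unfold monoPerm
    split_ifs
    · exact (key _ _).2
    · simpa using (key _ _).1
  odd := by
    intro k f
    have key : ∀ f : Fin 4, ∀ X : Letter, Equiv.Perm.sign (X.layerPerm f) = -1 ∧
        Equiv.Perm.sign (halfTurn * X.layerPerm f) = -1 := by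
      intro f X
      cases X <;> revert f <;> decide
    unfold monoPerm
    split_ifs
    · exact (key _ _).2
    · simpa using (key _ _).1
  not_self := by
    intro k f h
    have h1 := monoPerm_apply_self_le w s k f
    have h2 : monoPerm w s k f f = f := (Prod.ext_iff.1 h).2
    rw [h2] at h1
    tauto

/-- The first segment of the puncture curve, in the last tetrahedron: in the link of its vertex `0`
it turns around the top edge. -/
def punctureStart (n : ℕ) : Segment (Fin (n + 1)) := (Fin.last n, 1)

/-- The turns of the puncture curve. In the link of the puncture, which is layered over a small circle
around a lattice point of the plane, the curve goes once around this circle: twice, it passes in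
succession under an edge (in the last tetrahedron), up through tetrahedron `0`, over an edge (in
tetrahedron `1`), and down through tetrahedron `0`. -/
def punctureTurns : List Turn :=
  [.same, .switch, .same, .switch, .same, .switch, .same, .switch]

/-- The puncture curve closes up. -/
theorem puncture_closed {n : ℕ} (w : Fin (n + 1) → Letter) (s : ℤˣ) (h0 : w 0 = .R)
    (h1 : w (Fin.last n) = .L) :
    punctureTurns.foldl (monodromyTriangulation w s).next (punctureStart n) = punctureStart n := by
  cases n with
  | zero =>
    have h2 : w 0 = .L := h1
    rw [h0] at h2
    cases h2
  | succ n =>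
    have h01 : (0 : Fin (n + 2)) ≠ Fin.last (n + 1) := (Fin.last_pos).ne
    have hm : (0 : Fin (n + 2)) - 1 = Fin.last (n + 1) := by
      rw [sub_eq_iff_eq_add, Fin.last_add_one]
    obtain ⟨h, hh, hs⟩ : ∃ h : Equiv.Perm (Fin 4), (h = 1 ∨ h = halfTurn) ∧
        (if s = -1 then halfTurn else 1) = h := by
      by_cases hs : s = -1
      · exact ⟨_, Or.inr rfl, if_pos hs⟩
      · exact ⟨_, Or.inl rfl, if_neg hs⟩
    have e1 : ∀ π m, 2 ≤ π 2 → (monodromyTriangulation w s).next (Fin.last (n + 1), π) m =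
        (0, h * Letter.L.layerPerm (π 2) * π * m.shift) := by
      intro π m hπ
      simp [IdealTriangulation.next, monodromyTriangulation, monoNbr, monoPerm, monoLetter, IsSeam,
        hπ, h1, hs]
    have e2 : ∀ π m, 2 ≤ π 2 → (monodromyTriangulation w s).next (0, π) m =
        (1, Letter.R.layerPerm (π 2) * π * m.shift) := by
      intro π m hπ
      simp [IdealTriangulation.next, monodromyTriangulation, monoNbr, monoPerm, monoLetter, IsSeam,
        hπ, h0, h01]
    have e3 : ∀ π m, ¬ 2 ≤ π 2 → (monodromyTriangulation w s).next (0, π) m =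
        (Fin.last (n + 1), h * Letter.L.layerPerm (π 2) * π * m.shift) := by
      intro π m hπ
      simp [IdealTriangulation.next, monodromyTriangulation, monoNbr, monoPerm, monoLetter, IsSeam,
        if_neg hπ, hm, h1, hs]
    have e4 : ∀ π m, ¬ 2 ≤ π 2 → (monodromyTriangulation w s).next (1, π) m =
        (0, Letter.R.layerPerm (π 2) * π * m.shift) := by
      intro π m hπ
      simp [IdealTriangulation.next, monodromyTriangulation, monoNbr, monoPerm, monoLetter, IsSeam,
        if_neg hπ, h0]
    have half : ∀ π, π = 1 ∨ π = halfTurn → [.same, .switch, .same, .switch].foldl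
        (monodromyTriangulation w s).next (Fin.last (n + 1), π) =
          (Fin.last (n + 1), halfTurn * π) := by
      intro π hπ
      simp only [List.foldl]
      rcases hh with rfl | rfl <;> rcases hπ with rfl | rfl <;>
      · rw [e1 _ _ (by decide), e2 _ _ (by decide), e4 _ _ (by decide), e3 _ _ (by decide)]
        refine congrArg (Prod.mk _) ?_
        decide
    have hp : punctureTurns = [.same, .switch, .same, .switch] ++ [.same, .switch, .same, .switch] :=
      rfl
    rw [hp, List.foldl_append, punctureStart, half _ (Or.inl rfl), half _ (Or.inr (mul_one _))]
    refine congrArg (Prod.mk _) ?_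
    decide

/-- The exponential length of the puncture curve. -/
def punctureLength {n : ℕ} (w : Fin (n + 1) → Letter) (s : ℤˣ) (z : Fin (n + 1) → ℝ) : ℝ :=
  (monodromyTriangulation w s).curveLength z (punctureStart n) punctureTurns

/-! ### The two canonical solutions -/

/-- The cross ratio, normalized so that `∞, 0, 1, z` have cross ratio `z`. -/
def crossRatio (a b c d : ℝ) : ℝ := ((d - b) * (c - a)) / ((d - a) * (c - b))

/-- `z` is the system of shape parameters obtained by projecting the vertices of the parallelograms
under the tetrahedra to the line by a linear form `r` on the plane with `r ∘ W = μ r`. -/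
def IsProjectionShape {n : ℕ} (w : Fin (n + 1) → Letter) (μ : ℝ) (z : Fin (n + 1) → ℝ) : Prop :=
  ∃ r : (Fin 2 → ℝ) →ₗ[ℝ] ℝ, r ≠ 0 ∧
    (∀ v, r (((wordMat w).map (Int.cast : ℤ → ℝ)).mulVec v) = μ * r v) ∧
    ∀ k : Fin (n + 1),
      let p : Fin 4 → ℝ := fun i => r fun j => (((prefixMat w k).mulVec (corner i) j : ℤ) : ℝ)
      z k = crossRatio (p 0) (p 1) (p 2) (p 3)

end PuncturedTorus

end

/-! Every edge of the triangulation is the top edge of exactly one tetrahedron, so edges and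
tetrahedra share the cyclic index set `Fin (n + 1)`. Passing upwards through a letter, the top edge
becomes a side of the next parallelogram, one kind of side stays a side, and the other kind becomes
the bottom edge (`edgeIndex_succ`).

If all shape parameters are positive, tetrahedron `j` has its two angles `π` at one pair of opposite
sides: the vertical ones if `z j > 1`, the horizontal ones if `z j < 1`. Both sides of a pair lie in
the same edge of the triangulation, so the angle condition says that a map from tetrahedra to edges
is bijective. Only two choices are possible: every edge receives its angle in the first tetrahedron
where it is a side, or every edge does so in the last one (`pattern_cases`). Parameters cannot cross
`0` or `1`, so the set of points with a given pattern is relatively open and closed; once it is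
connected, it is a component.

For the first pattern let `x j` be minus the logarithm of the absolute value of the negative
parameter of tetrahedron `j`. The logarithmic edge equations read: `-2 * x i` plus a non-negative
combination of increasing functions of the `x j` is zero, and the left hand sides add up to zero
identically (`BalancedSystem`). The Jacobian has vanishing column sums, is non-negative off the
diagonal and connects all indices, so a Perron–Frobenius argument shows that its kernel vectors are
zero or have entries of one strict sign (`kernel_trichotomy`). The same argument for the equations
themselves shows that the maximum of two solutions is a solution and that solutions are totally
ordered (`le_total_of_mem`). An increasing function `height` is therefore injective on the
solutions; it is also non-critical there and proper, so its values fill the line and the solutions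
form a smooth curve (`BalancedSystem.exists_curve`).

The height is the puncture length in disguise. Add the logarithmic edge equations, each weighted by
the position of its edge. Since the parameters of a tetrahedron multiply to `1` up to sign, only the
numbers of steps back to the edges, which give `height`, and the boundary terms at the seam, which
give the puncture curve, survive (`sum_pos_mul_logHol`).

The second pattern becomes the first by turning the triangulation upside down, which reverses the
word, exchanges the letters and inverts the parameters (`logHol_rev`). The canonical shapes are
squares of quotients of values of an eigenform; the products around edges telescope
(`logHol_sq_ratio`), and the signs of the eigenform decide the pattern. The conjugation to a word is
reduction theory in `SL(2, ℤ)` (`exists_conj_nonneg`, `exists_list_of_nonneg`, `exists_rotation`).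
-/

noncomputable section

namespace PuncturedTorus

/-! ### Cyclic words -/

section Words

variable {n : ℕ} (w : Fin (n + 1) → Letter)

/-- The number of steps back, at least one, from position `j` to the previous letter `X`. -/
def back (X : Letter) (j : Fin (n + 1)) : ℕ :=
  sInf {d : ℕ | 1 ≤ d ∧ w (j - d • (1 : Fin (n + 1))) = X}

/-- The position of the last letter `X` before position `j`, in cyclic order. -/
def last (X : Letter) (j : Fin (n + 1)) : Fin (n + 1) :=
  j - back w X j • (1 : Fin (n + 1))

/-- The edge of the triangulation which is the bottom edge of the `j`-th tetrahedron. -/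
def bot (j : Fin (n + 1)) : Fin (n + 1) := last w (w (j - 1)) (j - 1)

variable {w} {X : Letter}

theorem exists_nsmul_one_eq (i : Fin (n + 1)) : ∃ d : ℕ, 1 ≤ d ∧ d • (1 : Fin (n + 1)) = i := by
  have h : ∀ d : ℕ, ((d • (1 : Fin (n + 1)) : Fin (n + 1)) : ℕ) = d % (n + 1) := by
    intro d
    induction d with
    | zero => simp
    | succ d ih =>
      rw [succ_nsmul, Fin.val_add, ih]
      rcases n with _ | n
      · simp [Nat.mod_one]
      · simp [Nat.add_mod]
  -- The extra full turn makes the number of steps positive even for `i = 0`.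
  refine ⟨i.1 + (n + 1), by omega, Fin.ext ?_⟩
  rw [h]
  simp [Nat.mod_eq_of_lt i.2]

theorem back_mem (hX : ∃ i, w i = X) (j : Fin (n + 1)) :
    1 ≤ back w X j ∧ w (last w X j) = X := by
  obtain ⟨i, hi⟩ := hX
  obtain ⟨d, hd, hd'⟩ := exists_nsmul_one_eq (j - i)
  exact Nat.sInf_mem (s := {d : ℕ | 1 ≤ d ∧ w (j - d • (1 : Fin (n + 1))) = X})
    ⟨d, hd, by rw [hd']; simpa using hi⟩

theorem back_le {j : Fin (n + 1)} {d : ℕ} (hd : 1 ≤ d) (h : w (j - d • (1 : Fin (n + 1))) = X) :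
    back w X j ≤ d :=
  Nat.sInf_le (s := {d : ℕ | 1 ≤ d ∧ w (j - d • (1 : Fin (n + 1))) = X}) ⟨hd, h⟩

theorem back_succ_of_eq {j : Fin (n + 1)} (h : w j = X) : back w X (j + 1) = 1 :=
  le_antisymm (back_le le_rfl (by simpa using h)) (back_mem ⟨j, h⟩ _).1

/-- The first step back from `j + 1` lands on `j`, which does not carry `X`; from there the search
is the one that starts at `j`. -/
theorem back_succ_of_ne (hX : ∃ i, w i = X) {j : Fin (n + 1)} (h : w j ≠ X) :
    back w X (j + 1) = back w X j + 1 := by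
  have e : ∀ d : ℕ, j + 1 - (d + 1) • (1 : Fin (n + 1)) = j - d • (1 : Fin (n + 1)) := by
    intro d; rw [succ_nsmul]; abel
  refine le_antisymm (back_le (by omega) ?_) ?_
  · rw [e]; exact (back_mem hX j).2
  · obtain ⟨h1, h2⟩ := back_mem hX (j + 1)
    rw [last] at h2
    obtain ⟨d, hd⟩ : ∃ d, back w X (j + 1) = d + 1 := ⟨_, (Nat.sub_add_cancel h1).symm⟩
    rw [hd, e] at h2
    rw [hd]
    rcases Nat.eq_zero_or_pos d with rfl | hd0
    · simp at h2; exact absurd h2 h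
    · have := back_le hd0 h2
      omega

theorem last_succ_of_eq {j : Fin (n + 1)} (h : w j = X) : last w X (j + 1) = j := by
  rw [last, back_succ_of_eq h]; simp

theorem last_succ_of_ne (hX : ∃ i, w i = X) {j : Fin (n + 1)} (h : w j ≠ X) :
    last w X (j + 1) = last w X j := by
  rw [last, last, back_succ_of_ne hX h, succ_nsmul]; abel

/-- Induction along the word, starting behind the letters `X`. -/
theorem back_induction (hX : ∃ i, w i = X) {P : Fin (n + 1) → Prop}
    (h1 : ∀ j, w j = X → P (j + 1)) (h2 : ∀ j, w j ≠ X → P j → P (j + 1)) (j : Fin (n + 1)) :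
    P j := by
  suffices ∀ d, ∀ j, back w X j = d → P j from this _ j rfl
  intro d
  induction d using Nat.strong_induction_on with
  | _ d ih =>
    intro j hj
    obtain ⟨i, rfl⟩ : ∃ i, j = i + 1 := ⟨j - 1, by simp⟩
    by_cases hi : w i = X
    · exact h1 i hi
    · rw [back_succ_of_ne hX hi] at hj
      exact h2 i hi (ih (d - 1) (by omega) i (by omega))

theorem bot_succ (j : Fin (n + 1)) : bot w (j + 1) = last w (w j) j := by simp [bot]

end Words

/-! ### The edges of the monodromy triangulation -/

/-- The kind of an edge of a layered tetrahedron: `0` for the top edge, `1` for the bottom edge, `2`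
for the two edges over vertical sides and `3` for those over horizontal sides of the square. -/
def kind (e : Finset (Fin 4)) : Fin 4 :=
  if e = {0, 1} then 0 else if e = {2, 3} then 1 else if e = {0, 2} ∨ e = {1, 3} then 2 else 3

/-- The kind in the next tetrahedron of an edge in a top face. -/
def Letter.kindUp : Letter → Fin 4 → Fin 4
  | .R => ![2, 0, 1, 3]
  | .L => ![3, 0, 2, 1]

/-- The kind in the previous tetrahedron of an edge in a bottom face. -/
def Letter.kindDown : Letter → Fin 4 → Fin 4
  | .R => ![0, 2, 0, 3]
  | .L => ![0, 3, 2, 0]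

/-- A finite check. The half turn at the seam preserves the kind of every edge, so the sign `s` has
no influence on the incidences of edges. -/
theorem kind_map_up (X : Letter) (g : Equiv.Perm (Fin 4)) (hg : g = 1 ∨ g = halfTurn) :
    ∀ f : Fin 4, 2 ≤ f → ∀ e : Finset (Fin 4), e.card = 2 → f ∉ e → kind e ≠ 1 ∧
      kind (e.map (g * X.layerPerm f).toEmbedding) = X.kindUp (kind e) := by
  rcases hg with rfl | rfl <;> cases X <;> decide

theorem kind_map_down (X : Letter) (g : Equiv.Perm (Fin 4)) (hg : g = 1 ∨ g = halfTurn) :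
    ∀ f : Fin 4, ¬ 2 ≤ f → ∀ e : Finset (Fin 4), e.card = 2 → f ∉ e → kind e ≠ 0 ∧
      kind (e.map (g * X.layerPerm f).toEmbedding) = X.kindDown (kind e) := by
  rcases hg with rfl | rfl <;> cases X <;> decide

theorem exists_bottom_face : ∀ e : Finset (Fin 4), e.card = 2 → kind e ≠ 0 →
    ∃ f : Fin 4, ¬ 2 ≤ f ∧ f ∉ e := by
  decide

theorem kind_eq_zero : ∀ e : Finset (Fin 4), kind e = 0 → e = {0, 1} := by
  decide

section Edges

variable {n : ℕ} (w : Fin (n + 1) → Letter) (s : ℤˣ)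

/-- The index of the edge of the triangulation that contains the edges of the given kind of the
`j`-th tetrahedron; an edge has the index of the tetrahedron of which it is the top edge. -/
def edgeIndex (j : Fin (n + 1)) : Fin 4 → Fin (n + 1) :=
  ![j, bot w j, last w .R j, last w .L j]

variable {w}

/-- A letter is a shear: it fixes one kind of side, moves the top diagonal to the other kind, and
moves the old sides of that kind to the bottom diagonal. This matches the recursion of `last`. -/
theorem edgeIndex_succ (hR : ∃ i, w i = .R) (hL : ∃ i, w i = .L) (j : Fin (n + 1)) :
    ∀ κ : Fin 4, κ ≠ 1 → edgeIndex w (j + 1) ((w j).kindUp κ) = edgeIndex w j κ := by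
  rcases hj : w j with _ | _
  · have h1 := last_succ_of_eq hj
    have h2 := last_succ_of_ne hL (j := j) (by simp [hj])
    have h3 := bot_succ (w := w) j
    rw [hj] at h3
    intro κ hκ
    fin_cases κ <;> simp_all [edgeIndex, Letter.kindUp]
  · have h1 := last_succ_of_eq hj
    have h2 := last_succ_of_ne hR (j := j) (by simp [hj])
    have h3 := bot_succ (w := w) j
    rw [hj] at h3
    intro κ hκ
    fin_cases κ <;> simp_all [edgeIndex, Letter.kindUp]

theorem edgeIndex_pred (hR : ∃ i, w i = .R) (hL : ∃ i, w i = .L) (j : Fin (n + 1)) :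
    ∀ κ : Fin 4, κ ≠ 0 →
      edgeIndex w (j - 1) ((w (j - 1)).kindDown κ) = edgeIndex w j κ := by
  obtain ⟨i, rfl⟩ : ∃ i, j = i + 1 := ⟨j - 1, by simp⟩
  intro κ hκ
  rw [add_sub_cancel_right]
  have h := edgeIndex_succ hR hL i ((w i).kindDown κ)
  -- Away from the top edge, going down and up again returns to the same kind.
  have e : ∀ X : Letter, ∀ κ : Fin 4, κ ≠ 0 → X.kindDown κ ≠ 1 ∧
      X.kindUp (X.kindDown κ) = κ := by
    intro X; cases X <;> decide
  rw [← h (e _ κ hκ).1, (e _ κ hκ).2]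

theorem seam_cases (k : Fin (n + 1)) (f : Fin 4) :
    (if s = -1 ∧ IsSeam k f then halfTurn else 1) = 1 ∨
      (if s = -1 ∧ IsSeam k f then halfTurn else 1) = halfTurn := by
  split_ifs <;> simp

/-- This makes `edgeIndex` a function on the edges of the triangulation; it will tell the top edges
apart. -/
theorem edgeIndex_edgeAdj (hR : ∃ i, w i = .R) (hL : ∃ i, w i = .L)
    {a b : EdgeSlot (Fin (n + 1))} (h : (monodromyTriangulation w s).EdgeAdj a b) :
    edgeIndex w a.1 (kind a.2.1) = edgeIndex w b.1 (kind b.2.1) := by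
  obtain ⟨f, hf, h1, h2⟩ := h
  rw [h1, h2]
  simp only [monodromyTriangulation, monoNbr, monoPerm, monoLetter]
  by_cases h2f : 2 ≤ f
  · obtain ⟨h3, h4⟩ := kind_map_up (w a.1) _ (seam_cases s a.1 f) f h2f a.2.1 a.2.2 hf
    rw [if_pos h2f, if_pos h2f, h4, edgeIndex_succ hR hL _ _ h3]
  · obtain ⟨h3, h4⟩ := kind_map_down (w (a.1 - 1)) _ (seam_cases s a.1 f) f h2f a.2.1 a.2.2 hf
    rw [if_neg h2f, if_neg h2f, h4, edgeIndex_pred hR hL _ _ h3]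

variable (w)

/-- The edge of the triangulation with the given index. -/
def topEdge (k : Fin (n + 1)) : (monodromyTriangulation w s).Edge :=
  Quot.mk _ (k, ⟨{0, 1}, rfl⟩)

variable {w}

/-- Every edge of a tetrahedron is, if it is not the top edge, glued to an edge of the previous
tetrahedron. -/
theorem exists_edgeAdj_pred (j : Fin (n + 1)) (e : {e : Finset (Fin 4) // e.card = 2})
    (he : kind e.1 ≠ 0) : ∃ e' : {e : Finset (Fin 4) // e.card = 2},
      (monodromyTriangulation w s).EdgeAdj (j, e) (j - 1, e') ∧
        kind e'.1 = (w (j - 1)).kindDown (kind e.1) := by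
  obtain ⟨f, h2f, hf⟩ := exists_bottom_face e.1 e.2 he
  obtain ⟨-, h4⟩ := kind_map_down (w (j - 1)) _ (seam_cases s j f) f h2f e.1 e.2 hf
  refine ⟨⟨e.1.map (monoPerm w s j f).toEmbedding, by rw [Finset.card_map, e.2]⟩,
    ⟨f, hf, ?_, rfl⟩, ?_⟩
  · simp [monodromyTriangulation, monoNbr, h2f]
  · rw [← h4]
    simp only [monoPerm, monoLetter, if_neg h2f]

/-- An edge slot is followed downwards until it is a top edge. A vertical side becomes one just
below the last `R`, a horizontal side just below the last `L`; hence the two inductions along the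
word. -/
theorem mk_eq_topEdge (hR : ∃ i, w i = .R) (hL : ∃ i, w i = .L) (a : EdgeSlot (Fin (n + 1))) :
    Quot.mk _ a = topEdge w s (edgeIndex w a.1 (kind a.2.1)) := by
  have htop : ∀ j, ∀ e : {e : Finset (Fin 4) // e.card = 2}, kind e.1 = 0 →
      Quot.mk _ (j, e) = topEdge w s (edgeIndex w j (kind e.1)) := by
    intro j e he
    have : e = ⟨{0, 1}, rfl⟩ := Subtype.ext (kind_eq_zero _ he)
    subst this
    rfl
  have hpred : ∀ j, ∀ e : {e : Finset (Fin 4) // e.card = 2}, kind e.1 ≠ 0 →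
      (∀ e' : {e : Finset (Fin 4) // e.card = 2}, kind e'.1 = (w (j - 1)).kindDown (kind e.1) →
        Quot.mk _ (j - 1, e') = topEdge w s (edgeIndex w (j - 1) (kind e'.1))) →
      Quot.mk _ (j, e) = topEdge w s (edgeIndex w j (kind e.1)) := by
    intro j e he ih
    obtain ⟨e', h1, h2⟩ := exists_edgeAdj_pred (w := w) s j e he
    rw [Quot.sound h1, ih e' h2, edgeIndex_edgeAdj s hR hL h1]
  have hvert : ∀ j, ∀ e : {e : Finset (Fin 4) // e.card = 2}, kind e.1 = 2 →
      Quot.mk _ (j, e) = topEdge w s (edgeIndex w j (kind e.1)) := by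
    refine back_induction hR ?_ ?_
    · intro j hj e he
      refine hpred _ e (by simp [he]) fun e' he' => ?_
      rw [add_sub_cancel_right] at he' ⊢
      exact htop _ _ (by rw [he', he, hj]; rfl)
    · intro j hj ih e he
      refine hpred _ e (by simp [he]) fun e' he' => ?_
      rw [add_sub_cancel_right] at he' ⊢
      have hj' : w j = .L := by cases h : w j <;> simp_all
      exact ih _ (by rw [he', he, hj']; rfl)
  have hhor : ∀ j, ∀ e : {e : Finset (Fin 4) // e.card = 2}, kind e.1 = 3 →
      Quot.mk _ (j, e) = topEdge w s (edgeIndex w j (kind e.1)) := by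
    refine back_induction hL ?_ ?_
    · intro j hj e he
      refine hpred _ e (by simp [he]) fun e' he' => ?_
      rw [add_sub_cancel_right] at he' ⊢
      exact htop _ _ (by rw [he', he, hj]; rfl)
    · intro j hj ih e he
      refine hpred _ e (by simp [he]) fun e' he' => ?_
      rw [add_sub_cancel_right] at he' ⊢
      have hj' : w j = .R := by cases h : w j <;> simp_all
      exact ih _ (by rw [he', he, hj']; rfl)
  obtain ⟨j, e⟩ := a
  have h4 : ∀ κ : Fin 4, κ = 0 ∨ κ = 1 ∨ κ = 2 ∨ κ = 3 := by decide
  rcases h4 (kind e.1) with h | h | h | h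
  · exact htop j e h
  -- A bottom edge is a side of the tetrahedron below, of the kind determined by the letter in
  -- between.
  · refine hpred j e (by simp [h]) fun e' he' => ?_
    rcases hw : w (j - 1) with _ | _
    · exact hvert _ _ (by rw [he', h, hw]; rfl)
    · exact hhor _ _ (by rw [he', h, hw]; rfl)
  · exact hvert j e h
  · exact hhor j e h

theorem mk_eq_topEdge_iff (hR : ∃ i, w i = .R) (hL : ∃ i, w i = .L) (a : EdgeSlot (Fin (n + 1)))
    (k : Fin (n + 1)) : Quot.mk _ a = topEdge w s k ↔ edgeIndex w a.1 (kind a.2.1) = k := by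
  refine ⟨fun h => ?_, fun h => h ▸ mk_eq_topEdge s hR hL a⟩
  let F : (monodromyTriangulation w s).Edge → Fin (n + 1) :=
    Quot.lift (fun a => edgeIndex w a.1 (kind a.2.1))
      fun a b hab => edgeIndex_edgeAdj s hR hL hab
  exact congrArg F h

theorem topEdge_surjective (hR : ∃ i, w i = .R) (hL : ∃ i, w i = .L) :
    Function.Surjective (topEdge w s) := by
  intro E
  induction E using Quot.ind with
  | _ a => exact ⟨_, (mk_eq_topEdge s hR hL a).symm⟩

/-! ### Holonomy and angle of an edge, tetrahedron by tetrahedron -/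

theorem univ_edges : (Finset.univ : Finset {e : Finset (Fin 4) // e.card = 2}) =
    {⟨{0, 1}, rfl⟩, ⟨{2, 3}, rfl⟩, ⟨{0, 2}, rfl⟩, ⟨{1, 3}, rfl⟩, ⟨{0, 3}, rfl⟩, ⟨{1, 2}, rfl⟩} := by
  decide

theorem prod_edges (f : {e : Finset (Fin 4) // e.card = 2} → ℝ) :
    ∏ e, f e = f ⟨{0, 1}, rfl⟩ * f ⟨{2, 3}, rfl⟩ * (f ⟨{0, 2}, rfl⟩ * f ⟨{1, 3}, rfl⟩) *
      (f ⟨{0, 3}, rfl⟩ * f ⟨{1, 2}, rfl⟩) := by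
  rw [univ_edges]
  repeat rw [Finset.prod_insert (by decide)]
  rw [Finset.prod_singleton]
  ring

theorem sum_edges (f : {e : Finset (Fin 4) // e.card = 2} → ℝ) :
    ∑ e, f e = f ⟨{0, 1}, rfl⟩ + f ⟨{2, 3}, rfl⟩ + (f ⟨{0, 2}, rfl⟩ + f ⟨{1, 3}, rfl⟩) +
      (f ⟨{0, 3}, rfl⟩ + f ⟨{1, 2}, rfl⟩) := by
  rw [univ_edges]
  repeat rw [Finset.sum_insert (by decide)]
  rw [Finset.sum_singleton]
  ring

theorem edgeParam_top (z : ℝ) : edgeParam z {0, 1} = z := by simp [edgeParam]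

theorem edgeParam_bottom (z : ℝ) : edgeParam z {2, 3} = z := by simp [edgeParam]

theorem edgeParam_vertical (z : ℝ) :
    edgeParam z {0, 2} = 1 / (1 - z) ∧ edgeParam z {1, 3} = 1 / (1 - z) := by
  constructor <;> rw [edgeParam, if_neg (by decide), if_pos (by decide)]

theorem edgeParam_horizontal (z : ℝ) :
    edgeParam z {0, 3} = (z - 1) / z ∧ edgeParam z {1, 2} = (z - 1) / z := by
  constructor <;> rw [edgeParam, if_neg (by decide), if_neg (by decide)]

/-- Opposite sides of a parallelogram have equal parameters and represent the same edge, which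
accounts for the squares. Top and bottom edges may represent different edges and enter separately.
-/
theorem edgeHolonomy_topEdge (hR : ∃ i, w i = .R) (hL : ∃ i, w i = .L) (z : Fin (n + 1) → ℝ)
    (k : Fin (n + 1)) : (monodromyTriangulation w s).edgeHolonomy z (topEdge w s k) =
      ∏ j, (if j = k then z j else 1) * (if bot w j = k then z j else 1) *
        (if last w .R j = k then (1 / (1 - z j)) ^ 2 else 1) *
          (if last w .L j = k then ((z j - 1) / z j) ^ 2 else 1) := by
  rw [IdealTriangulation.edgeHolonomy]
  simp only [mk_eq_topEdge_iff s hR hL]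
  rw [Finset.prod_filter, Fintype.prod_prod_type]
  refine Finset.prod_congr rfl fun j _ => ?_
  rw [prod_edges]
  have k0 : kind {0, 1} = 0 := by decide
  have k1 : kind {2, 3} = 1 := by decide
  have k2 : kind {0, 2} = 2 ∧ kind {1, 3} = 2 := by decide
  have k3 : kind {0, 3} = 3 ∧ kind {1, 2} = 3 := by decide
  simp only [k0, k1, k2.1, k2.2, k3.1, k3.2, edgeParam_top, edgeParam_bottom,
    (edgeParam_vertical _).1, (edgeParam_vertical _).2, (edgeParam_horizontal _).1,
    (edgeParam_horizontal _).2]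
  have i0 : edgeIndex w j 0 = j := rfl
  have i1 : edgeIndex w j 1 = bot w j := rfl
  have i2 : edgeIndex w j 2 = last w .R j := rfl
  have i3 : edgeIndex w j 3 = last w .L j := rfl
  rw [i0, i1, i2, i3]
  congr 1
  · congr 1
    · split_ifs <;> ring
  · split_ifs <;> ring

theorem totalAngle_topEdge (hR : ∃ i, w i = .R) (hL : ∃ i, w i = .L) (z : Fin (n + 1) → ℝ)
    (k : Fin (n + 1)) : (monodromyTriangulation w s).totalAngle z (topEdge w s k) =
      ∑ j, ((if j = k then dihedralAngle (z j) else 0) +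
        (if bot w j = k then dihedralAngle (z j) else 0) +
        2 * (if last w .R j = k then dihedralAngle (1 / (1 - z j)) else 0) +
          2 * (if last w .L j = k then dihedralAngle ((z j - 1) / z j) else 0)) := by
  rw [IdealTriangulation.totalAngle]
  simp only [mk_eq_topEdge_iff s hR hL]
  rw [Finset.sum_filter, Fintype.sum_prod_type]
  refine Finset.sum_congr rfl fun j _ => ?_
  rw [sum_edges]
  have k0 : kind {0, 1} = 0 := by decide
  have k1 : kind {2, 3} = 1 := by decide
  have k2 : kind {0, 2} = 2 ∧ kind {1, 3} = 2 := by decide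
  have k3 : kind {0, 3} = 3 ∧ kind {1, 2} = 3 := by decide
  simp only [k0, k1, k2.1, k2.2, k3.1, k3.2, edgeParam_top, edgeParam_bottom,
    (edgeParam_vertical _).1, (edgeParam_vertical _).2, (edgeParam_horizontal _).1,
    (edgeParam_horizontal _).2]
  have i0 : edgeIndex w j 0 = j := rfl
  have i1 : edgeIndex w j 1 = bot w j := rfl
  have i2 : edgeIndex w j 2 = last w .R j := rfl
  have i3 : edgeIndex w j 3 = last w .L j := rfl
  rw [i0, i1, i2, i3]
  ring

end Edges

/-! ### The softplus function and the logarithms of the shape parameters -/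

/-- The softplus function. -/
def softplus (x : ℝ) : ℝ := Real.log (1 + Real.exp x)

/-- The logistic function, the derivative of `softplus`. -/
def logistic (x : ℝ) : ℝ := Real.exp x / (1 + Real.exp x)

theorem one_add_exp_pos (x : ℝ) : 0 < 1 + Real.exp x := by positivity

theorem contDiff_softplus : ContDiff ℝ ∞ softplus :=
  (contDiff_const.add Real.contDiff_exp).log fun x => (one_add_exp_pos x).ne'

theorem hasDerivAt_softplus (x : ℝ) : HasDerivAt softplus (logistic x) x :=
  ((Real.hasDerivAt_exp x).const_add 1).log (one_add_exp_pos x).ne'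

theorem logistic_pos (x : ℝ) : 0 < logistic x := by unfold logistic; positivity

theorem logistic_add_logistic_neg (x : ℝ) : logistic x + logistic (-x) = 1 := by
  have h := Real.exp_pos x
  rw [logistic, logistic, Real.exp_neg]
  field_simp
  ring

theorem softplus_sub_softplus_neg (x : ℝ) : softplus x - softplus (-x) = x := by
  have h := Real.exp_pos x
  rw [softplus, softplus, ← Real.log_div (one_add_exp_pos _).ne' (one_add_exp_pos _).ne',
    Real.exp_neg]
  have : (1 + Real.exp x) / (1 + (Real.exp x)⁻¹) = Real.exp x := by
    field_simp
    ring
  rw [this, Real.log_exp]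

theorem le_softplus (x : ℝ) : x ≤ softplus x := by
  rw [softplus, Real.le_log_iff_exp_le (one_add_exp_pos x)]
  linarith

/-- The logarithm of the shape parameter `z`, as a function of the coordinate `x`: the parameter is
`1 + exp x` for the letter `R` and `1 / (1 + exp (-x))` for the letter `L`. -/
def Letter.logParam : Letter → ℝ → ℝ
  | .R, x => softplus x
  | .L, x => -softplus (-x)

/-- The logarithm of the square of the second positive parameter of the tetrahedron. -/
def Letter.logSide : Letter → ℝ → ℝ
  | .R, x => -2 * softplus (-x)
  | .L, x => 2 * softplus x

/-- The derivative of `Letter.logParam`. -/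
def Letter.dParam : Letter → ℝ → ℝ
  | .R, x => logistic x
  | .L, x => logistic (-x)

/-- The derivative of `Letter.logSide`. -/
def Letter.dSide : Letter → ℝ → ℝ
  | .R, x => 2 * logistic (-x)
  | .L, x => 2 * logistic x

namespace Letter

variable (X : Letter)

/-- In the coordinate `x` this is the relation that the three parameters of a tetrahedron have a
product of absolute value `1`. -/
theorem two_logParam_add_logSide (x : ℝ) : 2 * X.logParam x + X.logSide x = 2 * x := by
  have := softplus_sub_softplus_neg x
  cases X <;> simp only [logParam, logSide] <;> linarith

theorem two_dParam_add_dSide (x : ℝ) : 2 * X.dParam x + X.dSide x = 2 := by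
  have := logistic_add_logistic_neg x
  cases X <;> simp only [dParam, dSide] <;> linarith

theorem dParam_pos (x : ℝ) : 0 < X.dParam x := by
  cases X <;> exact logistic_pos _

theorem dSide_pos (x : ℝ) : 0 < X.dSide x := by
  cases X <;> exact mul_pos two_pos (logistic_pos _)

theorem hasDerivAt_logParam (x : ℝ) : HasDerivAt X.logParam (X.dParam x) x := by
  cases X with
  | R => exact hasDerivAt_softplus x
  | L =>
    have h := ((hasDerivAt_softplus (-x)).comp x (hasDerivAt_neg x)).neg
    rw [mul_neg_one, neg_neg] at h
    exact h

theorem hasDerivAt_logSide (x : ℝ) : HasDerivAt X.logSide (X.dSide x) x := by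
  cases X with
  | R =>
    have h := ((hasDerivAt_softplus (-x)).comp x (hasDerivAt_neg x)).const_mul (-2)
    rw [mul_neg_one, neg_mul_neg] at h
    exact h
  | L => exact (hasDerivAt_softplus x).const_mul 2

theorem contDiff_logParam : ContDiff ℝ ∞ X.logParam := by
  cases X with
  | R => exact contDiff_softplus
  | L => exact (contDiff_softplus.comp contDiff_neg).neg

theorem contDiff_logSide : ContDiff ℝ ∞ X.logSide := by
  cases X with
  | R => exact contDiff_const.mul (contDiff_softplus.comp contDiff_neg)
  | L => exact contDiff_const.mul contDiff_softplus

theorem strictMono_logParam : StrictMono X.logParam :=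
  strictMono_of_hasDerivAt_pos X.hasDerivAt_logParam X.dParam_pos

theorem strictMono_logSide : StrictMono X.logSide :=
  strictMono_of_hasDerivAt_pos X.hasDerivAt_logSide X.dSide_pos

end Letter

/-! ### Balanced systems of equations on a cycle -/

/-- Steps in one direction suffice, because they reach every index of a cycle. -/
theorem cycle_induction {n : ℕ} {P : Fin (n + 1) → Prop} {i : Fin (n + 1)} (hi : P i)
    (h : ∀ j, P (j + 1) → P j) (j : Fin (n + 1)) : P j := by
  obtain ⟨d, -, hd⟩ := exists_nsmul_one_eq (i - j)
  suffices ∀ d : ℕ, P (i - d • (1 : Fin (n + 1))) by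
    have := this d
    rwa [hd, sub_sub_cancel] at this
  intro d
  induction d with
  | zero => simpa using hi
  | succ d ih =>
    refine h _ ?_
    rwa [succ_nsmul, ← sub_sub, sub_add_cancel]

/-- A vector in the kernel of a matrix with vanishing column sums, non-negative outside the diagonal
and connecting the indices cyclically, vanishes or has entries of the same sign. -/
theorem kernel_trichotomy {n : ℕ} {A : Fin (n + 1) → Fin (n + 1) → ℝ}
    (hsum : ∀ j, ∑ i, A i j = 0) (hA : ∀ i j, j ≠ i → 0 ≤ A i j) (hc : ∀ j, 0 < A (j + 1) j)
    {v : Fin (n + 1) → ℝ} (hv : ∀ i, ∑ j, A i j * v j = 0) :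
    v = 0 ∨ (∀ j, 0 < v j) ∨ ∀ j, v j < 0 := by
  have key : ∀ v : Fin (n + 1) → ℝ, (∀ i, ∑ j, A i j * v j = 0) →
      (∀ j, v j ≤ 0) ∨ ∀ j, 0 < v j := by
    intro v hv
    -- The positive part of a kernel vector satisfies the equations as inequalities: the diagonal
    -- term vanishes if `v i ≤ 0` and is unchanged otherwise, and the other terms do not decrease.
    have h1 : ∀ i, 0 ≤ ∑ j, A i j * max (v j) 0 := by
      intro i
      rcases le_total (v i) 0 with h | h
      · refine Finset.sum_nonneg fun j _ => ?_
        by_cases hj : j = i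
        · subst hj; rw [max_eq_right h, mul_zero]
        · exact mul_nonneg (hA i j hj) (le_max_right _ _)
      · refine (hv i).symm.le.trans (Finset.sum_le_sum fun j _ => ?_)
        by_cases hj : j = i
        · subst hj; rw [max_eq_left h]
        · exact mul_le_mul_of_nonneg_left (le_max_left _ _) (hA i j hj)
    -- The column sums vanish, so none of these inequalities can be strict.
    have h2 : ∑ i, ∑ j, A i j * max (v j) 0 = 0 := by
      rw [Finset.sum_comm]
      simp [← Finset.sum_mul, hsum]
    have h3 : ∀ i, ∑ j, A i j * max (v j) 0 = 0 := fun i =>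
      (Finset.sum_eq_zero_iff_of_nonneg fun i _ => h1 i).1 h2 i (Finset.mem_univ i)
    by_cases h : ∀ j, 0 < v j
    · exact Or.inr h
    · push Not at h
      obtain ⟨i, hi⟩ := h
      left
      -- If the entry at `j + 1` is not positive, equation `j + 1` for the positive part is a
      -- vanishing sum of non-negative terms; the term of `j` has a positive coefficient, so the
      -- entry at `j` is not positive either.
      refine cycle_induction hi fun j hj => ?_
      have h4 : ∀ k ∈ Finset.univ, 0 ≤ A (j + 1) k * max (v k) 0 := by
        intro k _
        by_cases hk : k = j + 1
        · subst hk; rw [max_eq_right hj, mul_zero]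
        · exact mul_nonneg (hA _ k hk) (le_max_right _ _)
      have h5 := (Finset.sum_eq_zero_iff_of_nonneg h4).1 (h3 (j + 1)) j (Finset.mem_univ j)
      have h6 := (mul_eq_zero.1 h5).resolve_left (hc j).ne'
      exact max_eq_right_iff.1 h6
  rcases key v hv with h | h
  · rcases key (-v) (fun i => by simp [hv i]) with h' | h'
    · left
      ext j
      exact le_antisymm (h j) (by simpa using h' j)
    · exact Or.inr (Or.inr fun j => by simpa using h' j)
  · exact Or.inr (Or.inl h)

/-- The data of a system of `n + 1` equations in `n + 1` real unknowns, in which the `i`-th unknown is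
balanced against increasing functions of the unknowns. -/
structure BalancedSystem (n : ℕ) where
  letter : Fin (n + 1) → Letter
  coeffParam : Fin (n + 1) → Fin (n + 1) → ℝ
  coeffSide : Fin (n + 1) → Fin (n + 1) → ℝ
  weightParam : Fin (n + 1) → ℝ
  weightSide : Fin (n + 1) → ℝ
  coeffParam_nonneg : ∀ i j, 0 ≤ coeffParam i j
  coeffSide_nonneg : ∀ i j, 0 ≤ coeffSide i j
  one_le_coeffParam : ∀ j, 1 ≤ coeffParam (j + 1) j
  sum_coeffParam : ∀ j, ∑ i, coeffParam i j = 2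
  sum_coeffSide : ∀ j, ∑ i, coeffSide i j = 1
  weightParam_nonneg : ∀ j, 0 ≤ weightParam j
  weightSide_pos : ∀ j, 0 < weightSide j
  exists_R : ∃ j, letter j = .R
  exists_L : ∃ j, letter j = .L

namespace BalancedSystem

variable {n : ℕ} (B : BalancedSystem n)

/-- The left hand side of the `i`-th equation. -/
def flow (i : Fin (n + 1)) (x : Fin (n + 1) → ℝ) : ℝ :=
  -2 * x i + ∑ j, (B.coeffParam i j * (B.letter j).logParam (x j) +
    B.coeffSide i j * (B.letter j).logSide (x j))

/-- An increasing function that will be a coordinate on the set of solutions. -/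
def height (x : Fin (n + 1) → ℝ) : ℝ :=
  ∑ j, (B.weightParam j * (B.letter j).logParam (x j) +
    B.weightSide j * (B.letter j).logSide (x j))

/-- The set of solutions. -/
def solutions : Set (Fin (n + 1) → ℝ) := {x | ∀ i, B.flow i x = 0}

/-- The differential of `flow`. -/
def dflow (i : Fin (n + 1)) (x : Fin (n + 1) → ℝ) : (Fin (n + 1) → ℝ) →L[ℝ] ℝ :=
  (-2 : ℝ) • ContinuousLinearMap.proj i + ∑ j, (B.coeffParam i j * (B.letter j).dParam (x j) +
    B.coeffSide i j * (B.letter j).dSide (x j)) • ContinuousLinearMap.proj j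

/-- The differential of `height`. -/
def dheight (x : Fin (n + 1) → ℝ) : (Fin (n + 1) → ℝ) →L[ℝ] ℝ :=
  ∑ j, (B.weightParam j * (B.letter j).dParam (x j) +
    B.weightSide j * (B.letter j).dSide (x j)) • ContinuousLinearMap.proj j

theorem dflow_apply (i : Fin (n + 1)) (x v : Fin (n + 1) → ℝ) : B.dflow i x v =
    -2 * v i + ∑ j, (B.coeffParam i j * (B.letter j).dParam (x j) +
      B.coeffSide i j * (B.letter j).dSide (x j)) * v j := by
  simp [dflow]

theorem dheight_apply (x v : Fin (n + 1) → ℝ) : B.dheight x v =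
    ∑ j, (B.weightParam j * (B.letter j).dParam (x j) +
      B.weightSide j * (B.letter j).dSide (x j)) * v j := by
  simp [dheight]

theorem hasFDerivAt_combination (a c : Fin (n + 1) → ℝ) (x : Fin (n + 1) → ℝ) :
    HasFDerivAt (fun x : Fin (n + 1) → ℝ => ∑ j, (a j * (B.letter j).logParam (x j) +
      c j * (B.letter j).logSide (x j)))
      (∑ j, (a j * (B.letter j).dParam (x j) +
        c j * (B.letter j).dSide (x j)) •
          (ContinuousLinearMap.proj j : (Fin (n + 1) → ℝ) →L[ℝ] ℝ)) x := by
  refine HasFDerivAt.fun_sum fun j _ => ?_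
  have h1 : HasFDerivAt (fun x : Fin (n + 1) → ℝ => x j)
      (ContinuousLinearMap.proj j : (Fin (n + 1) → ℝ) →L[ℝ] ℝ) x := hasFDerivAt_apply j x
  exact ((((B.letter j).hasDerivAt_logParam (x j)).const_mul (a j)).add
    (((B.letter j).hasDerivAt_logSide (x j)).const_mul (c j))).comp_hasFDerivAt x h1

theorem hasFDerivAt_flow (i : Fin (n + 1)) (x : Fin (n + 1) → ℝ) :
    HasFDerivAt (B.flow i) (B.dflow i x) x := by
  have h1 : HasFDerivAt (fun x : Fin (n + 1) → ℝ => x i)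
      (ContinuousLinearMap.proj i : (Fin (n + 1) → ℝ) →L[ℝ] ℝ) x := hasFDerivAt_apply i x
  exact (h1.const_mul (-2)).add (B.hasFDerivAt_combination _ _ x)

theorem hasFDerivAt_height (x : Fin (n + 1) → ℝ) : HasFDerivAt B.height (B.dheight x) x :=
  B.hasFDerivAt_combination _ _ x

theorem contDiff_combination (a c : Fin (n + 1) → ℝ) :
    ContDiff ℝ ∞ (fun x : Fin (n + 1) → ℝ => ∑ j, (a j * (B.letter j).logParam (x j) +
      c j * (B.letter j).logSide (x j))) := by
  refine ContDiff.sum fun j _ => ?_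
  exact (contDiff_const.mul ((B.letter j).contDiff_logParam.comp (contDiff_apply ℝ ℝ j))).add
    (contDiff_const.mul ((B.letter j).contDiff_logSide.comp (contDiff_apply ℝ ℝ j)))

theorem contDiff_flow (i : Fin (n + 1)) : ContDiff ℝ ∞ (B.flow i) :=
  (contDiff_const.mul (contDiff_apply ℝ ℝ i)).add (B.contDiff_combination _ _)

theorem contDiff_height : ContDiff ℝ ∞ B.height := B.contDiff_combination _ _

/-- In the sum over all equations the unknown `x j` contributes `-2 * x j + 2 * logParam + logSide`,
which is zero. -/
theorem sum_flow (x : Fin (n + 1) → ℝ) : ∑ i, B.flow i x = 0 := by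
  simp only [flow]
  rw [Finset.sum_add_distrib, Finset.sum_comm, ← Finset.sum_add_distrib]
  refine Finset.sum_eq_zero fun j _ => ?_
  rw [Finset.sum_add_distrib, ← Finset.sum_mul, ← Finset.sum_mul, B.sum_coeffParam,
    B.sum_coeffSide]
  linarith [(B.letter j).two_logParam_add_logSide (x j)]

/-- The matrix of the differentials of the equations. -/
def jacobian (x : Fin (n + 1) → ℝ) (i j : Fin (n + 1)) : ℝ :=
  (if j = i then -2 else 0) + (B.coeffParam i j * (B.letter j).dParam (x j) +
    B.coeffSide i j * (B.letter j).dSide (x j))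

theorem dflow_eq_jacobian (i : Fin (n + 1)) (x v : Fin (n + 1) → ℝ) :
    B.dflow i x v = ∑ j, B.jacobian x i j * v j := by
  simp [dflow_apply, jacobian, add_mul, Finset.sum_add_distrib]

theorem sum_jacobian (x : Fin (n + 1) → ℝ) (j : Fin (n + 1)) : ∑ i, B.jacobian x i j = 0 := by
  simp only [jacobian, Finset.sum_add_distrib, ← Finset.sum_mul, B.sum_coeffParam,
    B.sum_coeffSide]
  simp [(B.letter j).two_dParam_add_dSide (x j)]

theorem sum_dflow (x v : Fin (n + 1) → ℝ) : ∑ i, B.dflow i x v = 0 := by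
  simp only [dflow_eq_jacobian]
  rw [Finset.sum_comm]
  simp [← Finset.sum_mul, sum_jacobian]

theorem side_nonneg (x : Fin (n + 1) → ℝ) (i j : Fin (n + 1)) :
    0 ≤ B.coeffSide i j * (B.letter j).dSide (x j) :=
  mul_nonneg (B.coeffSide_nonneg i j) ((B.letter j).dSide_pos _).le

theorem jacobian_nonneg (x : Fin (n + 1) → ℝ) (i j : Fin (n + 1)) (h : j ≠ i) :
    0 ≤ B.jacobian x i j := by
  rw [jacobian, if_neg h, zero_add]
  exact add_nonneg (mul_nonneg (B.coeffParam_nonneg i j) ((B.letter j).dParam_pos _).le)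
    (B.side_nonneg x i j)

/-- Both letters occur, so there are at least two indices. -/
theorem ne_succ {n : ℕ} (B : BalancedSystem n) (j : Fin (n + 1)) : j ≠ j + 1 := by
  rcases n with _ | n
  · obtain ⟨i, hi⟩ := B.exists_R
    obtain ⟨j, hj⟩ := B.exists_L
    rw [Fin.fin_one_eq_zero i] at hi
    rw [Fin.fin_one_eq_zero j, hi] at hj
    cases hj
  · simp

theorem jacobian_succ_pos (x : Fin (n + 1) → ℝ) (j : Fin (n + 1)) :
    0 < B.jacobian x (j + 1) j := by
  rw [jacobian, if_neg (B.ne_succ j), zero_add]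
  exact add_pos_of_pos_of_nonneg
    (mul_pos (by linarith [B.one_le_coeffParam j]) ((B.letter j).dParam_pos _))
    (B.side_nonneg x _ j)

theorem dheight_pos (x : Fin (n + 1) → ℝ) {v : Fin (n + 1) → ℝ} (hv : ∀ j, 0 < v j) :
    0 < B.dheight x v := by
  rw [dheight_apply]
  refine Finset.sum_pos (fun j _ => mul_pos ?_ (hv j)) Finset.univ_nonempty
  exact add_pos_of_nonneg_of_pos
    (mul_nonneg (B.weightParam_nonneg j) ((B.letter j).dParam_pos _).le)
    (mul_pos (B.weightSide_pos j) ((B.letter j).dSide_pos _))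

/-- The height has no critical point on the kernel of the differentials of the equations. -/
theorem kernel_cases (x : Fin (n + 1) → ℝ) {v : Fin (n + 1) → ℝ} (hv : ∀ i, B.dflow i x v = 0) :
    v = 0 ∨ (0 < B.dheight x v ∧ ∀ j, 0 < v j) ∨ (B.dheight x v < 0 ∧ ∀ j, v j < 0) := by
  simp only [dflow_eq_jacobian] at hv
  rcases kernel_trichotomy (B.sum_jacobian x) (B.jacobian_nonneg x) (B.jacobian_succ_pos x) hv with
    h | h | h
  · exact Or.inl h
  · exact Or.inr (Or.inl ⟨B.dheight_pos x h, h⟩)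
  · refine Or.inr (Or.inr ⟨?_, h⟩)
    have := B.dheight_pos x (v := -v) (fun j => by simpa using h j)
    simpa using this

/-! #### Comparison of solutions -/

theorem term_mono (a c : ℝ) (ha : 0 ≤ a) (hc : 0 ≤ c) (j : Fin (n + 1)) {s t : ℝ} (h : s ≤ t) :
    a * (B.letter j).logParam s + c * (B.letter j).logSide s ≤
      a * (B.letter j).logParam t + c * (B.letter j).logSide t :=
  add_le_add (mul_le_mul_of_nonneg_left ((B.letter j).strictMono_logParam.monotone h) ha)
    (mul_le_mul_of_nonneg_left ((B.letter j).strictMono_logSide.monotone h) hc)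

theorem flow_mono {x y : Fin (n + 1) → ℝ} (h : x ≤ y) {i : Fin (n + 1)} (hi : x i = y i) :
    B.flow i x ≤ B.flow i y := by
  rw [flow, flow, hi]
  exact add_le_add_right (Finset.sum_le_sum fun j _ => B.term_mono _ _ (B.coeffParam_nonneg i j)
    (B.coeffSide_nonneg i j) j (h j)) _

/-- At each index the supremum agrees with one of the two solutions and lies above it, so each
`flow` is non-negative there; their sum is zero, so each of them vanishes. -/
theorem sup_mem_solutions {x y : Fin (n + 1) → ℝ} (hx : x ∈ B.solutions) (hy : y ∈ B.solutions) :
    x ⊔ y ∈ B.solutions := by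
  have h : ∀ i, 0 ≤ B.flow i (x ⊔ y) := by
    intro i
    rcases le_total (x i) (y i) with h | h
    · rw [← hy i]
      exact B.flow_mono le_sup_right (by simp [h])
    · rw [← hx i]
      exact B.flow_mono le_sup_left (by simp [h])
  intro i
  exact (Finset.sum_eq_zero_iff_of_nonneg fun i _ => h i).1 (B.sum_flow _) i (Finset.mem_univ i)

/-- A lower bound for the difference of the values of `flow`. -/
theorem flow_sub_ge {x y : Fin (n + 1) → ℝ} (h : x ≤ y) (j : Fin (n + 1)) :
    -2 * (y (j + 1) - x (j + 1)) + ((B.letter j).logParam (y j) - (B.letter j).logParam (x j)) ≤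
      B.flow (j + 1) y - B.flow (j + 1) x := by
  have h1 : (B.letter j).logParam (y j) - (B.letter j).logParam (x j) ≤
      ∑ k, ((B.coeffParam (j + 1) k * (B.letter k).logParam (y k) +
        B.coeffSide (j + 1) k * (B.letter k).logSide (y k)) -
        (B.coeffParam (j + 1) k * (B.letter k).logParam (x k) +
        B.coeffSide (j + 1) k * (B.letter k).logSide (x k))) := by
    refine le_trans ?_ (Finset.single_le_sum (f := fun k =>
      ((B.coeffParam (j + 1) k * (B.letter k).logParam (y k) +
        B.coeffSide (j + 1) k * (B.letter k).logSide (y k)) -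
        (B.coeffParam (j + 1) k * (B.letter k).logParam (x k) +
        B.coeffSide (j + 1) k * (B.letter k).logSide (x k)))) (fun k _ => ?_) (Finset.mem_univ j))
    · have h2 : 0 ≤ (B.letter j).logParam (y j) - (B.letter j).logParam (x j) :=
        sub_nonneg.2 ((B.letter j).strictMono_logParam.monotone (h j))
      have h3 : 0 ≤ (B.letter j).logSide (y j) - (B.letter j).logSide (x j) :=
        sub_nonneg.2 ((B.letter j).strictMono_logSide.monotone (h j))
      nlinarith [mul_nonneg (sub_nonneg.2 (B.one_le_coeffParam j)) h2,
        mul_nonneg (B.coeffSide_nonneg (j + 1) j) h3]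
    · exact sub_nonneg.2 (B.term_mono _ _ (B.coeffParam_nonneg _ k) (B.coeffSide_nonneg _ k) k (h k))
  rw [Finset.sum_sub_distrib] at h1
  rw [flow, flow]
  linarith

theorem height_sub_ge {x y : Fin (n + 1) → ℝ} (h : x ≤ y) (j : Fin (n + 1)) :
    B.weightSide j * ((B.letter j).logSide (y j) - (B.letter j).logSide (x j)) ≤
      B.height y - B.height x := by
  rw [height, height, ← Finset.sum_sub_distrib]
  refine le_trans ?_ (Finset.single_le_sum (f := fun k =>
    (B.weightParam k * (B.letter k).logParam (y k) + B.weightSide k * (B.letter k).logSide (y k)) -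
    (B.weightParam k * (B.letter k).logParam (x k) + B.weightSide k * (B.letter k).logSide (x k)))
    (fun k _ => ?_) (Finset.mem_univ j))
  · have h2 : 0 ≤ (B.letter j).logParam (y j) - (B.letter j).logParam (x j) :=
      sub_nonneg.2 ((B.letter j).strictMono_logParam.monotone (h j))
    nlinarith [mul_nonneg (B.weightParam_nonneg j) h2]
  · exact sub_nonneg.2 (B.term_mono _ _ (B.weightParam_nonneg k) (B.weightSide_pos k).le k (h k))

/-- Equality at `j + 1` forces equality at `j`: equation `j + 1` contains a strictly increasing
function of the `j`-th unknown with coefficient at least `1`, and no other term can compensate for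
its growth. -/
theorem eq_of_le_of_eq {x y : Fin (n + 1) → ℝ} (hx : x ∈ B.solutions) (hy : y ∈ B.solutions)
    (h : x ≤ y) {i : Fin (n + 1)} (hi : x i = y i) : x = y := by
  ext j
  refine cycle_induction (P := fun j => x j = y j) hi (fun j hj => ?_) j
  have h1 := B.flow_sub_ge h j
  rw [hx, hy, hj] at h1
  refine le_antisymm (h j) ((B.letter j).strictMono_logParam.le_iff_le.1 ?_)
  linarith

/-- The supremum is a solution and touches `x` or `y` at index `0`, so it coincides with one of
them. -/
theorem le_total_of_mem {x y : Fin (n + 1) → ℝ} (hx : x ∈ B.solutions) (hy : y ∈ B.solutions) :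
    x ≤ y ∨ y ≤ x := by
  have h := B.sup_mem_solutions hx hy
  rcases le_total (x 0) (y 0) with h0 | h0
  · left
    rw [B.eq_of_le_of_eq hy h le_sup_right (i := 0) (by simp [h0])]
    exact le_sup_left
  · right
    rw [B.eq_of_le_of_eq hx h le_sup_left (i := 0) (by simp [h0])]
    exact le_sup_right

theorem eq_of_height_eq {x y : Fin (n + 1) → ℝ} (hx : x ∈ B.solutions) (hy : y ∈ B.solutions)
    (h : B.height x = B.height y) : x = y := by
  have key : ∀ x y : Fin (n + 1) → ℝ, B.height x = B.height y → x ≤ y → x = y := by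
    intro x y h hxy
    ext j
    have h1 := B.height_sub_ge hxy j
    rw [h, sub_self] at h1
    have h2 : (B.letter j).logSide (y j) ≤ (B.letter j).logSide (x j) := by
      by_contra! h3
      have := mul_pos (B.weightSide_pos j) (sub_pos.2 h3)
      linarith
    exact le_antisymm (hxy j) ((B.letter j).strictMono_logSide.le_iff_le.1 h2)
  rcases B.le_total_of_mem hx hy with h1 | h1
  · exact key x y h h1
  · exact (key y x h.symm h1).symm

/-! #### Compactness -/

/-- After a letter `L`, `logSide` is `2 * softplus` and is controlled by the height; it grows at
least linearly. After a letter `R` it is bounded above and gives nothing, but there `logParam` is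
`softplus`, and the next equation bounds it by the following unknown. The bounds travel backwards
from an `L`. -/
theorem exists_upper_bound {x : Fin (n + 1) → ℝ} (hx : x ∈ B.solutions) (M : ℝ)
    (j : Fin (n + 1)) : ∃ C, ∀ y ∈ B.solutions, x ≤ y → B.height y ≤ M → y j ≤ C := by
  have hL : ∀ j, B.letter j = .L → ∃ C, ∀ y ∈ B.solutions, x ≤ y → B.height y ≤ M → y j ≤ C := by
    intro j hj
    refine ⟨((M - B.height x) / B.weightSide j + (B.letter j).logSide (x j)) / 2,
      fun y _ hxy hM => ?_⟩
    have h1 := B.height_sub_ge hxy j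
    have h2 : (B.letter j).logSide (y j) - (B.letter j).logSide (x j) ≤
        (M - B.height x) / B.weightSide j := by
      rw [le_div_iff₀ (B.weightSide_pos j)]
      linarith
    have h3 : (B.letter j).logSide (y j) = 2 * softplus (y j) := by rw [hj]; rfl
    linarith [le_softplus (y j)]
  obtain ⟨i, hi⟩ := B.exists_L
  refine cycle_induction (P := fun j => ∃ C, ∀ y ∈ B.solutions, x ≤ y → B.height y ≤ M → y j ≤ C)
    (hL i hi) (fun j ⟨C, hC⟩ => ?_) j
  rcases hj : B.letter j with _ | _
  · refine ⟨(B.letter j).logParam (x j) + 2 * (C - x (j + 1)), fun y hy hxy hM => ?_⟩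
    have h1 := B.flow_sub_ge hxy j
    rw [hx, hy] at h1
    have h2 := hC y hy hxy hM
    have h3 : (B.letter j).logParam (y j) = softplus (y j) := by rw [hj]; rfl
    linarith [le_softplus (y j)]
  · exact hL j hj

/-- The mirror image of the upper bound: now `R` is the letter for which the height controls the
unknown, and the equations carry the bound across the letters `L`. -/
theorem exists_lower_bound {x : Fin (n + 1) → ℝ} (hx : x ∈ B.solutions) (M : ℝ)
    (j : Fin (n + 1)) : ∃ C, ∀ y ∈ B.solutions, y ≤ x → M ≤ B.height y → C ≤ y j := by
  have hR : ∀ j, B.letter j = .R → ∃ C, ∀ y ∈ B.solutions, y ≤ x → M ≤ B.height y → C ≤ y j := by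
    intro j hj
    refine ⟨((B.letter j).logSide (x j) - (B.height x - M) / B.weightSide j) / 2,
      fun y _ hxy hM => ?_⟩
    have h1 := B.height_sub_ge hxy j
    have h2 : (B.letter j).logSide (x j) - (B.letter j).logSide (y j) ≤
        (B.height x - M) / B.weightSide j := by
      rw [le_div_iff₀ (B.weightSide_pos j)]
      linarith
    have h3 : (B.letter j).logSide (y j) = -2 * softplus (-y j) := by rw [hj]; rfl
    linarith [le_softplus (-y j)]
  obtain ⟨i, hi⟩ := B.exists_R
  refine cycle_induction (P := fun j => ∃ C, ∀ y ∈ B.solutions, y ≤ x → M ≤ B.height y → C ≤ y j)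
    (hR i hi) (fun j ⟨C, hC⟩ => ?_) j
  rcases hj : B.letter j with _ | _
  · exact hR j hj
  · refine ⟨(B.letter j).logParam (x j) - 2 * (x (j + 1) - C), fun y hy hxy hM => ?_⟩
    have h1 := B.flow_sub_ge hxy j
    rw [hx, hy] at h1
    have h2 := hC y hy hxy hM
    have h3 : (B.letter j).logParam (y j) = -softplus (-y j) := by rw [hj]; rfl
    linarith [le_softplus (-y j)]

theorem isClosed_solutions : IsClosed B.solutions := by
  rw [solutions, Set.ofPred_forall]
  exact isClosed_iInter fun i => isClosed_eq (B.contDiff_flow i).continuous continuous_const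

/-- Every solution lies above or below a fixed one, so the two one-sided bounds cover all of them.
-/
theorem isCompact_solutions_slab (a c : ℝ) :
    IsCompact (B.solutions ∩ B.height ⁻¹' Set.Icc a c) := by
  rcases Set.eq_empty_or_nonempty B.solutions with h | ⟨x, hx⟩
  · simp [h]
  choose C hC using B.exists_upper_bound hx c
  choose D hD using B.exists_lower_bound hx a
  refine IsCompact.of_isClosed_subset (isCompact_Icc (a := D ⊓ x) (b := C ⊔ x))
    (B.isClosed_solutions.inter (isClosed_Icc.preimage B.contDiff_height.continuous)) ?_
  rintro y ⟨hy, h1, h2⟩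
  rcases B.le_total_of_mem hx hy with h | h
  · exact ⟨inf_le_right.trans h, fun j => (hC j y hy h h2).trans le_sup_left⟩
  · exact ⟨fun j => inf_le_left.trans (hD j y hy h h1), h.trans le_sup_right⟩

/-- Near a limit value only a slab of solutions matters, and the image of a compact slab is closed.
-/
theorem isClosed_image_height : IsClosed (B.height '' B.solutions) := by
  rw [← closure_subset_iff_isClosed]
  intro t ht
  have h : IsClosed (B.height '' (B.solutions ∩ B.height ⁻¹' Set.Icc (t - 1) (t + 1))) :=
    ((B.isCompact_solutions_slab _ _).image B.contDiff_height.continuous).isClosed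
  have h2 : t ∈ closure (B.height '' (B.solutions ∩ B.height ⁻¹' Set.Icc (t - 1) (t + 1))) := by
    have h3 : B.height '' (B.solutions ∩ B.height ⁻¹' Set.Icc (t - 1) (t + 1)) =
        B.height '' B.solutions ∩ Set.Icc (t - 1) (t + 1) := Set.image_inter_preimage _ _ _
    rw [h3, mem_closure_iff_nhds]
    intro U hU
    obtain ⟨y, hy1, hy2⟩ := mem_closure_iff_nhds.1 ht (U ∩ Set.Icc (t - 1) (t + 1))
      (Filter.inter_mem hU (Icc_mem_nhds (by linarith) (by linarith)))
    exact ⟨y, hy1.1, hy2, hy1.2⟩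
  rw [h.closure_eq] at h2
  exact Set.image_mono Set.inter_subset_left h2

/-! #### The curve of solutions -/

/-- The equations, combined with the height. -/
def chart (x : Fin (n + 1) → ℝ) : Fin (n + 1) → ℝ := fun i => B.flow i x + B.height x

theorem contDiff_chart : ContDiff ℝ ∞ B.chart :=
  contDiff_pi.2 fun i => (B.contDiff_flow i).add B.contDiff_height

/-- Summing the entries of `chart` removes the flows and leaves a multiple of the height; hence the
diagonal corresponds exactly to the solutions. -/
theorem chart_eq_const_iff (x : Fin (n + 1) → ℝ) (t : ℝ) :
    (B.chart x = fun _ => t) ↔ x ∈ B.solutions ∧ B.height x = t := by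
  refine ⟨fun h => ?_, fun ⟨h1, h2⟩ => ?_⟩
  · have h1 : ∀ i, B.flow i x + B.height x = t := fun i => congrFun h i
    have h2 : ∑ i, (B.flow i x + B.height x) = ∑ _i : Fin (n + 1), t :=
      Finset.sum_congr rfl fun i _ => h1 i
    rw [Finset.sum_add_distrib, B.sum_flow, zero_add, Finset.sum_const, Finset.sum_const] at h2
    have h3 : B.height x = t := nsmul_right_injective (by simp) h2
    exact ⟨fun i => by linarith [h1 i], h3⟩
  · ext i
    simp [chart, h1 i, h2]

/-- The differential of `chart`. -/
def dchart (x : Fin (n + 1) → ℝ) : (Fin (n + 1) → ℝ) →L[ℝ] (Fin (n + 1) → ℝ) :=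
  ContinuousLinearMap.pi fun i => B.dflow i x + B.dheight x

theorem hasFDerivAt_chart (x : Fin (n + 1) → ℝ) : HasFDerivAt B.chart (B.dchart x) x :=
  hasFDerivAt_pi.2 fun i => (B.hasFDerivAt_flow i x).add (B.hasFDerivAt_height x)

/-- Summing entries again shows that a kernel vector kills the differential of the height, hence
those of all flows; on their common kernel the height has non-zero derivative in every non-zero
direction. -/
theorem dchart_injective (x : Fin (n + 1) → ℝ) : Function.Injective (B.dchart x) := by
  rw [injective_iff_map_eq_zero]
  intro v hv
  have h1 : ∀ i, B.dflow i x v + B.dheight x v = 0 := fun i => congrFun hv i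
  have h2 : ∑ i, (B.dflow i x v + B.dheight x v) = 0 := Finset.sum_eq_zero fun i _ => h1 i
  rw [Finset.sum_add_distrib, B.sum_dflow, zero_add, Finset.sum_const, smul_eq_zero] at h2
  have h3 : B.dheight x v = 0 := h2.resolve_left (by simp)
  rcases B.kernel_cases x (v := v) (fun i => by linarith [h1 i]) with h | h | h
  · exact h
  · exact absurd h3 h.1.ne'
  · exact absurd h3 h.1.ne

/-- The differential of `chart` as an equivalence. -/
def dchartEquiv (x : Fin (n + 1) → ℝ) : (Fin (n + 1) → ℝ) ≃L[ℝ] (Fin (n + 1) → ℝ) :=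
  (LinearEquiv.ofInjectiveEndo (B.dchart x).toLinearMap
    (B.dchart_injective x)).toContinuousLinearEquiv

theorem hasFDerivAt_chart_equiv (x : Fin (n + 1) → ℝ) :
    HasFDerivAt B.chart (B.dchartEquiv x : (Fin (n + 1) → ℝ) →L[ℝ] (Fin (n + 1) → ℝ)) x := by
  have : (B.dchartEquiv x : (Fin (n + 1) → ℝ) →L[ℝ] (Fin (n + 1) → ℝ)) = B.dchart x := by
    ext v i
    rfl
  rw [this]
  exact B.hasFDerivAt_chart x

/-- Through every solution there is a local smooth curve of solutions, parameterized by height. -/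
theorem exists_local_curve {x : Fin (n + 1) → ℝ} (hx : x ∈ B.solutions) :
    ∃ g : ℝ → Fin (n + 1) → ℝ, ContDiffAt ℝ ∞ g (B.height x) ∧
      ∀ᶠ t in nhds (B.height x), g t ∈ B.solutions ∧ B.height (g t) = t := by
  have hn : (∞ : WithTop ℕ∞) ≠ 0 := by simp
  have hc : B.chart x = fun _ => B.height x := (B.chart_eq_const_iff x _).2 ⟨hx, rfl⟩
  have hd := B.hasFDerivAt_chart_equiv x
  have hf : ContDiffAt ℝ ∞ B.chart x := B.contDiff_chart.contDiffAt
  have h1 := hf.to_localInverse hd hn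
  have h2 := (hf.hasStrictFDerivAt' hd hn).eventually_right_inverse
  have hdiag : ContDiff ℝ ∞ (fun (t : ℝ) (_ : Fin (n + 1)) => t) := contDiff_pi.2 fun _ => contDiff_id
  rw [hc] at h1 h2
  -- The curve is the local inverse of `chart`, restricted to the diagonal.
  refine ⟨fun t => hf.localInverse hd hn fun _ => t,
    ContDiffAt.comp (B.height x) h1 hdiag.contDiffAt, ?_⟩
  have h3 := (hdiag.continuous.tendsto (B.height x)).eventually h2
  filter_upwards [h3] with t ht
  exact (B.chart_eq_const_iff _ t).1 ht

/-- The set of heights is closed by properness and open by the local curves, and the line is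
connected. -/
theorem image_height (h : B.solutions.Nonempty) : B.height '' B.solutions = Set.univ := by
  refine IsClopen.eq_univ ⟨B.isClosed_image_height, ?_⟩ (h.image _)
  rw [isOpen_iff_mem_nhds]
  rintro _ ⟨x, hx, rfl⟩
  obtain ⟨g, -, hg⟩ := B.exists_local_curve hx
  filter_upwards [hg] with t ht
  exact ⟨g t, ht⟩

/-- The solutions form a smooth curve, parameterized by the height, along which all unknowns
increase. -/
theorem exists_curve (h : B.solutions.Nonempty) : ∃ γ γ' : ℝ → Fin (n + 1) → ℝ,
    ContDiff ℝ ∞ γ ∧ (∀ t, HasDerivAt γ (γ' t) t) ∧ Set.range γ = B.solutions ∧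
      (∀ t, B.height (γ t) = t) ∧ (∀ t j, 0 < γ' t j) ∧
      ∀ t v, (∀ i, B.dflow i (γ t) v = 0) ↔ ∃ a : ℝ, v = a • γ' t := by
  have h1 : ∀ t : ℝ, ∃ x ∈ B.solutions, B.height x = t := by
    intro t
    have : t ∈ B.height '' B.solutions := by rw [B.image_height h]; trivial
    exact this
  choose γ hγ hγt using h1
  have hsm : ContDiff ℝ ∞ γ := by
    rw [contDiff_iff_contDiffAt]
    intro t
    obtain ⟨g, hg1, hg2⟩ := B.exists_local_curve (hγ t)
    rw [hγt] at hg1 hg2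
    -- A solution is determined by its height, so the pointwise choice agrees with the smooth local
    -- curve.
    refine hg1.congr_of_eventuallyEq ?_
    filter_upwards [hg2] with u hu
    exact B.eq_of_height_eq (hγ u) hu.1 (by rw [hγt, hu.2])
  have hd : ∀ t, HasDerivAt γ (deriv γ t) t := fun t =>
    (hsm.differentiable (by simp) t).hasDerivAt
  have hker : ∀ t i, B.dflow i (γ t) (deriv γ t) = 0 := by
    intro t i
    have h2 := (B.hasFDerivAt_flow i (γ t)).comp_hasDerivAt t (hd t)
    have h3 : B.flow i ∘ γ = fun _ => 0 := funext fun u => hγ u i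
    rw [h3] at h2
    exact h2.unique (hasDerivAt_const t 0)
  have hone : ∀ t, B.dheight (γ t) (deriv γ t) = 1 := by
    intro t
    have h2 := (B.hasFDerivAt_height (γ t)).comp_hasDerivAt t (hd t)
    have h3 : B.height ∘ γ = id := funext fun u => hγt u
    rw [h3] at h2
    exact h2.unique (hasDerivAt_id t)
  refine ⟨γ, deriv γ, hsm, hd, ?_, hγt, ?_, ?_⟩
  · ext x
    refine ⟨?_, fun hx => ⟨B.height x, B.eq_of_height_eq (hγ _) hx (hγt _)⟩⟩
    rintro ⟨t, rfl⟩
    exact hγ t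
  · intro t
    have h1 := hone t
    rcases B.kernel_cases (γ t) (hker t) with h | h | h
    · rw [h, map_zero] at h1
      exact absurd h1 zero_ne_one
    · exact h.2
    · linarith [h.1]
  · intro t v
    constructor
    · intro hv
      refine ⟨B.dheight (γ t) v, ?_⟩
      have h1 : B.dheight (γ t) (v - B.dheight (γ t) v • deriv γ t) = 0 := by
        rw [map_sub, map_smul, hone, smul_eq_mul, mul_one, sub_self]
      rcases B.kernel_cases (γ t) (v := v - B.dheight (γ t) v • deriv γ t)
        (fun i => by rw [map_sub, map_smul, hker, hv, smul_zero, sub_self]) with h | h | h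
      · exact sub_eq_zero.1 h
      · exact absurd h1 h.1.ne'
      · exact absurd h1 h.1.ne
    · rintro ⟨a, rfl⟩ i
      rw [map_smul, hker, smul_zero]

end BalancedSystem

instance : DecidableEq Letter := fun a b => by
  cases a <;> cases b
  exacts [isTrue rfl, isFalse (by simp), isFalse (by simp), isTrue rfl]

/-! ### The logarithmic form of the edge equations -/

/-- The logarithm of the square of the shape parameter `1 / (1 - z)`. -/
def logVert (z : ℝ) : ℝ := -2 * Real.log (1 - z)

/-- The logarithm of the square of the shape parameter `(z - 1) / z`. -/
def logHor (z : ℝ) : ℝ := 2 * Real.log (1 - z) - 2 * Real.log z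

theorem two_log_add_logVert_add_logHor (z : ℝ) : 2 * Real.log z + logVert z + logHor z = 0 := by
  unfold logVert logHor; ring

/-- The logarithm of the square of the parameter at the edges over the sides of the square which are
fixed by the other letter. -/
def Letter.logSq : Letter → ℝ → ℝ
  | .R => logVert
  | .L => logHor

theorem exp_two_mul_log {a : ℝ} (ha : a ≠ 0) : Real.exp (2 * Real.log a) = a ^ 2 := by
  rw [two_mul, Real.exp_add, Real.exp_log_eq_abs ha, ← sq, sq_abs]

theorem exp_logVert {z : ℝ} (h1 : z ≠ 1) : Real.exp (logVert z) = (1 / (1 - z)) ^ 2 := by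
  rw [logVert, neg_mul, Real.exp_neg, exp_two_mul_log (sub_ne_zero.2 h1.symm), one_div, inv_pow]

theorem exp_logHor {z : ℝ} (h0 : z ≠ 0) (h1 : z ≠ 1) :
    Real.exp (logHor z) = ((z - 1) / z) ^ 2 := by
  rw [logHor, Real.exp_sub, exp_two_mul_log (sub_ne_zero.2 h1.symm), exp_two_mul_log h0, div_pow]
  congr 1
  ring

section LogHolonomy

variable {n : ℕ} (w : Fin (n + 1) → Letter)

/-- The logarithm of the holonomy of the `k`-th edge. -/
def logHol (z : Fin (n + 1) → ℝ) (k : Fin (n + 1)) : ℝ :=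
  ∑ j, ((if j = k then Real.log (z j) else 0) + (if bot w j = k then Real.log (z j) else 0) +
    (if last w .R j = k then logVert (z j) else 0) + (if last w .L j = k then logHor (z j) else 0))

variable {w}

theorem edgeHolonomy_eq_exp (s : ℤˣ) (hR : ∃ i, w i = .R) (hL : ∃ i, w i = .L)
    {z : Fin (n + 1) → ℝ} (h0 : ∀ j, 0 < z j) (h1 : ∀ j, z j ≠ 1) (k : Fin (n + 1)) :
    (monodromyTriangulation w s).edgeHolonomy z (topEdge w s k) = Real.exp (logHol w z k) := by
  rw [edgeHolonomy_topEdge s hR hL, logHol, Real.exp_sum]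
  refine Finset.prod_congr rfl fun j _ => ?_
  rw [Real.exp_add, Real.exp_add, Real.exp_add]
  congr 1
  · congr 1
    · congr 1
      · split_ifs <;> simp [Real.exp_log (h0 j)]
      · split_ifs <;> simp [Real.exp_log (h0 j)]
    · split_ifs
      · exact (exp_logVert (h1 j)).symm
      · simp
  · split_ifs
    · exact (exp_logHor (h0 j).ne' (h1 j)).symm
    · simp

/-- Weighted sums of the logarithmic edge holonomies. -/
theorem sum_mul_logHol (p : Fin (n + 1) → ℝ) (z : Fin (n + 1) → ℝ) :
    ∑ k, p k * logHol w z k = ∑ j, (p j * Real.log (z j) + p (bot w j) * Real.log (z j) +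
      p (last w .R j) * logVert (z j) + p (last w .L j) * logHor (z j)) := by
  simp only [logHol, Finset.mul_sum]
  rw [Finset.sum_comm]
  refine Finset.sum_congr rfl fun j _ => ?_
  simp only [mul_add, Finset.sum_add_distrib, mul_ite, mul_zero]
  simp

/-! ### The puncture curve as a coordinate -/

/-- The position of an edge, counted from the last one. -/
def pos (k : Fin (n + 1)) : ℝ := ((k + 1 : Fin (n + 1)) : ℕ)

/-- The position is `0` at the last index and increases by `1` from there on; the jump occurs on
arriving at the last index again. -/
theorem pos_succ (k : Fin (n + 1)) :
    pos (k + 1) = pos k + 1 - (n + 1) * (if k + 1 = Fin.last n then 1 else 0) := by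
  unfold pos
  rw [Fin.val_add_one (k + 1)]
  split_ifs with h
  · rw [h]; simp
  · push_cast; ring

/-- The number of times that the way back to the last letter `X` passes the last position. -/
def wraps (X : Letter) (j : Fin (n + 1)) : ℝ :=
  (if j = Fin.last n then 1 else 0) + (if X = .R ∧ j = 0 then 1 else 0)

/-- Each step back lowers the position by `1`, except for the step away from the last index, which
raises it by `n`. Since the word ends with `L` and begins with `R`, a search for `L` takes that step
only when it starts at the last index, and a search for `R` only from the last index or from `0`. -/
theorem pos_last (h0 : w 0 = .R) (h1 : w (Fin.last n) = .L) (X : Letter) (j : Fin (n + 1)) :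
    pos (last w X j) = pos j - back w X j + (n + 1) * wraps X j := by
  have hX : ∃ i, w i = X := by
    cases X
    · exact ⟨_, h0⟩
    · exact ⟨_, h1⟩
  refine back_induction
    (P := fun j => pos (last w X j) = pos j - back w X j + (n + 1) * wraps X j) hX
    (fun j hj => ?_) (fun j hj ih => ?_) j
  · rw [last_succ_of_eq hj, back_succ_of_eq hj, pos_succ, wraps]
    have : ¬ (X = .R ∧ j + 1 = 0) := by
      rintro ⟨rfl, h⟩
      rw [← Fin.last_add_one n, add_left_inj] at h
      rw [h, h1] at hj
      cases hj
    rw [if_neg this]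
    push_cast
    ring
  · rw [last_succ_of_ne hX hj, back_succ_of_ne hX hj, ih, pos_succ, wraps, wraps]
    have h2 : (if j = Fin.last n then (1 : ℝ) else 0) + (if X = .R ∧ j = 0 then 1 else 0) =
        if X = .R ∧ j + 1 = 0 then 1 else 0 := by
      have h3 : ¬ (X = .R ∧ j = 0) := by
        rintro ⟨rfl, rfl⟩
        exact hj h0
      rw [if_neg h3, add_zero]
      congr 1
      rw [← Fin.last_add_one n, add_left_inj, eq_iff_iff]
      refine ⟨fun h => ⟨?_, h⟩, fun h => h.2⟩
      rw [h, h1] at hj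
      cases X <;> simp_all
    rw [h2]
    push_cast
    ring

/-- Half the logarithm of the exponential length of the puncture curve, up to sign. -/
def logPuncture (z : Fin (n + 1) → ℝ) : ℝ :=
  Real.log (z (Fin.last n)) - Real.log (z 0) - logVert (z 0) - Real.log (z 1)

/-- A summation by parts around the cycle. The step counts form the sum that becomes the height; the
passages over the seam concern only the tetrahedra at `Fin.last n`, `0` and `1`, through which the
puncture curve runs. -/
theorem sum_pos_mul_logHol (h0 : w 0 = .R) (h1 : w (Fin.last n) = .L) (z : Fin (n + 1) → ℝ) :
    ∑ k, pos k * logHol w z k =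
      -∑ j, (((back w (w (j - 1)) (j - 1) : ℝ) + 1) * Real.log (z j) +
        back w .R j * logVert (z j) + back w .L j * logHor (z j)) - (n + 1) * logPuncture z := by
  rw [sum_mul_logHol]
  have hb : ∀ j : Fin (n + 1), pos (bot w j) = pos j - (back w (w (j - 1)) (j - 1) + 1) +
      (n + 1) * ((if j = Fin.last n then 1 else 0) + wraps (w (j - 1)) (j - 1)) := by
    intro j
    obtain ⟨i, rfl⟩ : ∃ i, j = i + 1 := ⟨j - 1, by simp⟩
    rw [bot_succ, pos_last h0 h1, add_sub_cancel_right, pos_succ]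
    ring
  have hw : ∑ j : Fin (n + 1), wraps (w (j - 1)) (j - 1) * Real.log (z j) =
      Real.log (z 0) + Real.log (z 1) := by
    rw [← Equiv.sum_comp (Equiv.addRight (1 : Fin (n + 1)))]
    simp only [Equiv.coe_addRight, add_sub_cancel_right, wraps, add_mul, Finset.sum_add_distrib]
    have e1 : ∑ x : Fin (n + 1), (if x = Fin.last n then (1 : ℝ) else 0) * Real.log (z (x + 1)) =
        Real.log (z 0) := by
      simp
    have e2 : ∀ x : Fin (n + 1), (w x = .R ∧ x = 0) ↔ x = 0 := by
      intro x
      refine ⟨fun h => h.2, fun h => ⟨?_, h⟩⟩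
      rw [h, h0]
    rw [e1]
    simp [e2]
  have hl : ∀ f : Fin (n + 1) → ℝ, ∑ j, (if j = Fin.last n then (1 : ℝ) else 0) * f j =
      f (Fin.last n) := by
    intro f; simp
  have hz : ∀ f : Fin (n + 1) → ℝ, ∑ j, (if j = 0 then (1 : ℝ) else 0) * f j = f 0 := by
    intro f; simp
  have e : ∀ j : Fin (n + 1), pos j * Real.log (z j) + pos (bot w j) * Real.log (z j) +
      pos (last w .R j) * logVert (z j) + pos (last w .L j) * logHor (z j) =
      -(((back w (w (j - 1)) (j - 1) : ℝ) + 1) * Real.log (z j) +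
        back w .R j * logVert (z j) + back w .L j * logHor (z j)) +
      ((n + 1) * (wraps (w (j - 1)) (j - 1) * Real.log (z j)) +
      ((n + 1) * ((if j = Fin.last n then (1 : ℝ) else 0) * (-Real.log (z j))) +
      (n + 1) * ((if j = 0 then (1 : ℝ) else 0) * logVert (z j)))) := by
    intro j
    rw [hb, pos_last h0 h1, pos_last h0 h1]
    simp only [wraps, reduceCtorEq, false_and, if_false, true_and]
    -- The terms with the common position cancel, because the logarithms of the parameters of one
    -- tetrahedron add up to zero.
    linear_combination (pos j + (n + 1) * (if j = Fin.last n then (1 : ℝ) else 0)) *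
      two_log_add_logVert_add_logHor (z j)
  rw [Finset.sum_congr rfl fun j _ => e j]
  simp only [Finset.sum_add_distrib, ← Finset.mul_sum, Finset.sum_neg_distrib]
  simp only [hl, hw, hz]
  rw [logPuncture]
  ring

end LogHolonomy

/-! ### The balanced system of a word -/

/-- The other letter. -/
def Letter.other : Letter → Letter
  | .R => .L
  | .L => .R

theorem Letter.ne_other (X : Letter) : X ≠ X.other := by cases X <;> simp [Letter.other]

/-- The shape parameter as a function of the coordinate. -/
def Letter.param : Letter → ℝ → ℝ
  | .R, x => 1 + Real.exp x
  | .L, x => 1 / (1 + Real.exp (-x))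

theorem Letter.log_param (X : Letter) (x : ℝ) : Real.log (X.param x) = X.logParam x := by
  cases X
  · rfl
  · rw [param, logParam, one_div, Real.log_inv, softplus]

theorem Letter.logSq_param (X : Letter) (x : ℝ) : X.logSq (X.param x) = -2 * x := by
  cases X
  · simp [logSq, logVert, param]
  · rw [logSq, logHor, param]
    have h := one_add_exp_pos (-x)
    have e : 1 - 1 / (1 + Real.exp (-x)) = Real.exp (-x) / (1 + Real.exp (-x)) := by
      field_simp
      ring
    rw [e, Real.log_div (Real.exp_pos _).ne' h.ne', Real.log_exp, one_div, Real.log_inv]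
    ring

theorem Letter.logSq_other_param (X : Letter) (x : ℝ) :
    X.other.logSq (X.param x) = X.logSide x := by
  have h1 := X.two_logParam_add_logSide x
  have h2 := two_log_add_logVert_add_logHor (X.param x)
  have h3 := X.logSq_param x
  have h4 := X.log_param x
  cases X <;> simp only [logSq, other] at * <;> linarith

/-- For each letter, the parameters that the coordinate takes. -/
def Letter.InRange : Letter → ℝ → Prop
  | .R, z => 1 < z
  | .L, z => 0 < z ∧ z < 1

theorem Letter.inRange_iff (X : Letter) (z : ℝ) : X.InRange z ↔ ∃ x, X.param x = z := by
  cases X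
  · refine ⟨fun h => ⟨Real.log (z - 1), ?_⟩, ?_⟩
    · rw [param, Real.exp_log (sub_pos.2 h)]; ring
    · rintro ⟨x, rfl⟩
      have := Real.exp_pos x
      simp only [InRange, param]; linarith
  · refine ⟨fun ⟨h0, h1⟩ => ⟨-Real.log (1 / z - 1), ?_⟩, ?_⟩
    · have : 0 < 1 / z - 1 := by rw [sub_pos, lt_div_iff₀ h0]; linarith
      rw [param, neg_neg, Real.exp_log this]; field_simp; ring
    · rintro ⟨x, rfl⟩
      have := Real.exp_pos (-x)
      simp only [InRange, param]
      refine ⟨by positivity, ?_⟩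
      rw [div_lt_one (by positivity)]; linarith

theorem Letter.InRange.pos {X : Letter} {z : ℝ} (h : X.InRange z) : 0 < z := by
  cases X
  · exact zero_lt_one.trans h
  · exact h.1

theorem Letter.InRange.ne_one {X : Letter} {z : ℝ} (h : X.InRange z) : z ≠ 1 := by
  cases X
  · exact (ne_of_lt h).symm
  · exact h.2.ne

section WordSystem

variable {n : ℕ} (w : Fin (n + 1) → Letter)

/-- The balanced system for the edge equations, if the shape parameters are greater than `1` behind
the letters `R` and less than `1` behind the letters `L`. -/
def wordSystem (hR : ∃ i, w i = .R) (hL : ∃ i, w i = .L) : BalancedSystem n where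
  letter j := w (j - 1)
  coeffParam i j := (if j + 1 = i then 1 else 0) + (if bot w j + 1 = i then 1 else 0)
  coeffSide i j := if last w (w (j - 1)).other j + 1 = i then 1 else 0
  -- These are the step counts left over when the logarithm of the squared negative parameter, whose
  -- step count is `1`, is eliminated by the relation between the three parameters.
  weightParam j := back w (w (j - 1)) (j - 1) - 1
  weightSide j := back w (w (j - 1)).other j - 1
  coeffParam_nonneg i j := by split_ifs <;> norm_num
  coeffSide_nonneg i j := by split_ifs <;> norm_num
  one_le_coeffParam j := by rw [if_pos rfl]; split_ifs <;> norm_num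
  sum_coeffParam j := by
    rw [Finset.sum_add_distrib]; simp; norm_num
  sum_coeffSide j := by simp
  weightParam_nonneg j := by
    have := (back_mem (w := w) ⟨j - 1, rfl⟩ (j - 1)).1
    rw [sub_nonneg]
    exact_mod_cast this
  weightSide_pos j := by
    obtain ⟨i, rfl⟩ : ∃ i, j = i + 1 := ⟨j - 1, by simp⟩
    rw [add_sub_cancel_right]
    have hX : ∃ k, w k = (w i).other := by
      cases w i
      · exact hL
      · exact hR
    -- The letter just before position `i + 1` is `w i`, so the other letter is at least two steps
    -- back and the weight is positive.
    rw [back_succ_of_ne hX (Letter.ne_other _)]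
    have := (back_mem hX i).1
    push_cast
    have h : (1 : ℝ) ≤ back w (w i).other i := by exact_mod_cast this
    linarith
  exists_R := by
    obtain ⟨i, hi⟩ := hR
    exact ⟨i + 1, by simpa using hi⟩
  exists_L := by
    obtain ⟨i, hi⟩ := hL
    exact ⟨i + 1, by simpa using hi⟩

/-- The shape parameters as functions of the coordinates. -/
def wordParam (x : Fin (n + 1) → ℝ) : Fin (n + 1) → ℝ := fun j => (w (j - 1)).param (x j)

variable {w} (hR : ∃ i, w i = .R) (hL : ∃ i, w i = .L)

/-- The index shift pairs each edge with the tetrahedron where it has its angle `π`: the top edge of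
tetrahedron `k` is a side of tetrahedron `k + 1`, and its squared parameter there has logarithm `-2
* x (k + 1)`. -/
theorem logHol_wordParam (x : Fin (n + 1) → ℝ) (k : Fin (n + 1)) :
    logHol w (wordParam w x) k = (wordSystem w hR hL).flow (k + 1) x := by
  have e : ∀ j, ((if j = k then Real.log (wordParam w x j) else 0) +
      (if bot w j = k then Real.log (wordParam w x j) else 0) +
      (if last w .R j = k then logVert (wordParam w x j) else 0) +
      (if last w .L j = k then logHor (wordParam w x j) else 0)) =
      (if j = k + 1 then -2 * x j else 0) +
      ((wordSystem w hR hL).coeffParam (k + 1) j * (w (j - 1)).logParam (x j) +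
      (wordSystem w hR hL).coeffSide (k + 1) j * (w (j - 1)).logSide (x j)) := by
    intro j
    obtain ⟨i, rfl⟩ : ∃ i, j = i + 1 := ⟨j - 1, by simp⟩
    have h1 := last_succ_of_eq (w := w) (j := i) rfl
    have h2 := (w i).log_param (x (i + 1))
    have h3 := (w i).logSq_param (x (i + 1))
    have h4 := (w i).logSq_other_param (x (i + 1))
    have hp : (wordSystem w hR hL).coeffParam (k + 1) (i + 1) =
        (if i + 1 = k then 1 else 0) + (if bot w (i + 1) = k then 1 else 0) := by
      simp [wordSystem]
    have hs : ∀ Y, (w i).other = Y → (wordSystem w hR hL).coeffSide (k + 1) (i + 1) =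
        if last w Y (i + 1) = k then 1 else 0 := by
      rintro _ rfl
      simp [wordSystem]
    simp only [wordParam, add_sub_cancel_right, add_left_inj]
    rw [h2, hp]
    rcases hX : w i with _ | _
    · rw [hs .L (by rw [hX]; rfl)]
      simp only [hX, Letter.logSq, Letter.other] at h1 h3 h4 ⊢
      rw [h1, h3, h4]
      split_ifs <;> ring
    · rw [hs .R (by rw [hX]; rfl)]
      simp only [hX, Letter.logSq, Letter.other] at h1 h3 h4 ⊢
      rw [h1, h3, h4]
      split_ifs <;> ring
  rw [logHol, Finset.sum_congr rfl fun j _ => e j, Finset.sum_add_distrib]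
  simp [BalancedSystem.flow, wordSystem]

/-- On solutions the weighted sum of the edge equations is zero, so its height part and its puncture
part balance. -/
theorem height_wordSystem (h0 : w 0 = .R) (h1 : w (Fin.last n) = .L) {x : Fin (n + 1) → ℝ}
    (hx : x ∈ (wordSystem w hR hL).solutions) :
    (wordSystem w hR hL).height x = -((n + 1) * logPuncture (wordParam w x)) := by
  have h2 := sum_pos_mul_logHol h0 h1 (wordParam w x)
  rw [Finset.sum_eq_zero fun k _ => by rw [logHol_wordParam hR hL, hx, mul_zero]] at h2
  have e : (wordSystem w hR hL).height x =
      ∑ j, (((back w (w (j - 1)) (j - 1) : ℝ) + 1) * Real.log (wordParam w x j) +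
        back w .R j * logVert (wordParam w x j) + back w .L j * logHor (wordParam w x j)) := by
    refine Finset.sum_congr rfl fun j _ => ?_
    obtain ⟨i, rfl⟩ : ∃ i, j = i + 1 := ⟨j - 1, by simp⟩
    have h1 := back_succ_of_eq (w := w) (j := i) rfl
    have h2 := (w i).log_param (x (i + 1))
    have h3 := (w i).logSq_param (x (i + 1))
    have h4 := (w i).logSq_other_param (x (i + 1))
    have h5 := (w i).two_logParam_add_logSide (x (i + 1))
    simp only [wordParam, add_sub_cancel_right, wordSystem]
    rw [h2]
    generalize w i = X at *
    cases X
    · simp only [Letter.logSq, Letter.other] at *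
      rw [h1, h3, h4]
      push_cast
      linear_combination -h5
    · simp only [Letter.logSq, Letter.other] at *
      rw [h1, h3, h4]
      push_cast
      linear_combination -h5
  rw [e]
  linarith

end WordSystem

/-! ### The length of the puncture curve -/

theorem IdealTriangulation.curveLength_append {T : Type} (𝒯 : IdealTriangulation T) (z : T → ℝ)
    (a : Segment T) (l l' : List Turn) : 𝒯.curveLength z a (l ++ l') =
      𝒯.curveLength z a l * 𝒯.curveLength z (l.foldl 𝒯.next a) l' := by
  induction l generalizing a with
  | nil => simp [IdealTriangulation.curveLength]
  | cons m l ih => simp [IdealTriangulation.curveLength, ih, mul_assoc]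

theorem segmentLength_eq {T : Type} (z : T → ℝ) (t : T) (π : Equiv.Perm (Fin 4)) (ε : ℤ)
    (e : Finset (Fin 4)) (he : {π 0, π 1} = e) (hε : ((Equiv.Perm.sign π : ℤˣ) : ℤ) = ε) :
    segmentLength z (t, π) = edgeParam (z t) e ^ ε := by
  simp only [segmentLength, he, hε]

/-- The curve consists of two halves that differ by the half turn of the square. This preserves the
parameters, so the length is a square, whatever the sign of the monodromy. -/
theorem punctureLength_eq {n : ℕ} {w : Fin (n + 1) → Letter} (s : ℤˣ) (h0 : w 0 = .R)
    (h1 : w (Fin.last n) = .L) (z : Fin (n + 1) → ℝ) : punctureLength w s z =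
      (z (Fin.last n) * ((z 0 - 1) / z 0) * (z 1)⁻¹ * (1 / (1 - z 0))⁻¹) ^ 2 := by
  cases n with
  | zero =>
    have h2 : w 0 = .L := h1
    rw [h0] at h2
    cases h2
  | succ n =>
    have h01 : (0 : Fin (n + 2)) ≠ Fin.last (n + 1) := (Fin.last_pos).ne
    have hm : (0 : Fin (n + 2)) - 1 = Fin.last (n + 1) := by
      rw [sub_eq_iff_eq_add, Fin.last_add_one]
    obtain ⟨h, hh, hs⟩ : ∃ h : Equiv.Perm (Fin 4), (h = 1 ∨ h = halfTurn) ∧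
        (if s = -1 then halfTurn else 1) = h := by
      by_cases hs : s = -1
      · exact ⟨_, Or.inr rfl, if_pos hs⟩
      · exact ⟨_, Or.inl rfl, if_neg hs⟩
    have e1 : ∀ π m, 2 ≤ π 2 → (monodromyTriangulation w s).next (Fin.last (n + 1), π) m =
        (0, h * Letter.L.layerPerm (π 2) * π * m.shift) := by
      intro π m hπ
      simp [IdealTriangulation.next, monodromyTriangulation, monoNbr, monoPerm, monoLetter, IsSeam,
        hπ, h1, hs]
    have e2 : ∀ π m, 2 ≤ π 2 → (monodromyTriangulation w s).next (0, π) m =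
        (1, Letter.R.layerPerm (π 2) * π * m.shift) := by
      intro π m hπ
      simp [IdealTriangulation.next, monodromyTriangulation, monoNbr, monoPerm, monoLetter, IsSeam,
        hπ, h0, h01]
    have e3 : ∀ π m, ¬ 2 ≤ π 2 → (monodromyTriangulation w s).next (0, π) m =
        (Fin.last (n + 1), h * Letter.L.layerPerm (π 2) * π * m.shift) := by
      intro π m hπ
      simp [IdealTriangulation.next, monodromyTriangulation, monoNbr, monoPerm, monoLetter, IsSeam,
        if_neg hπ, hm, h1, hs]
    have e4 : ∀ π m, ¬ 2 ≤ π 2 → (monodromyTriangulation w s).next (1, π) m =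
        (0, Letter.R.layerPerm (π 2) * π * m.shift) := by
      intro π m hπ
      simp [IdealTriangulation.next, monodromyTriangulation, monoNbr, monoPerm, monoLetter, IsSeam,
        if_neg hπ, h0]
    have half : ∀ π, π = 1 ∨ π = halfTurn → [.same, .switch, .same, .switch].foldl
        (monodromyTriangulation w s).next (Fin.last (n + 1), π) =
          (Fin.last (n + 1), halfTurn * π) := by
      intro π hπ
      simp only [List.foldl]
      rcases hh with rfl | rfl <;> rcases hπ with rfl | rfl <;>
      · rw [e1 _ _ (by decide), e2 _ _ (by decide), e4 _ _ (by decide), e3 _ _ (by decide)]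
        refine congrArg (Prod.mk _) ?_
        decide
    have len : ∀ π, π = 1 ∨ π = halfTurn → (monodromyTriangulation w s).curveLength z
        (Fin.last (n + 1), π) [.same, .switch, .same, .switch] =
        z (Fin.last (n + 1)) * ((z 0 - 1) / z 0) * (z 1)⁻¹ * (1 / (1 - z 0))⁻¹ := by
      intro π hπ
      simp only [IdealTriangulation.curveLength]
      rcases hh with rfl | rfl <;> rcases hπ with rfl | rfl
      · rw [e1 _ _ (by decide), e2 _ _ (by decide), e4 _ _ (by decide),
          segmentLength_eq z _ _ 1 {0, 1} (by decide) (by decide),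
          segmentLength_eq z _ _ 1 {1, 2} (by decide) (by decide),
          segmentLength_eq z _ _ (-1) {2, 3} (by decide) (by decide),
          segmentLength_eq z _ _ (-1) {1, 3} (by decide) (by decide),
          edgeParam_top, edgeParam_bottom, (edgeParam_vertical _).2, (edgeParam_horizontal _).2]
        simp only [zpow_one, zpow_neg, mul_one, mul_assoc]
      · rw [e1 _ _ (by decide), e2 _ _ (by decide), e4 _ _ (by decide),
          segmentLength_eq z _ _ 1 {0, 1} (by decide) (by decide),
          segmentLength_eq z _ _ 1 {0, 3} (by decide) (by decide),
          segmentLength_eq z _ _ (-1) {2, 3} (by decide) (by decide),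
          segmentLength_eq z _ _ (-1) {0, 2} (by decide) (by decide),
          edgeParam_top, edgeParam_bottom, (edgeParam_vertical _).1, (edgeParam_horizontal _).1]
        simp only [zpow_one, zpow_neg, mul_one, mul_assoc]
      · rw [e1 _ _ (by decide), e2 _ _ (by decide), e4 _ _ (by decide),
          segmentLength_eq z _ _ 1 {0, 1} (by decide) (by decide),
          segmentLength_eq z _ _ 1 {0, 3} (by decide) (by decide),
          segmentLength_eq z _ _ (-1) {2, 3} (by decide) (by decide),
          segmentLength_eq z _ _ (-1) {0, 2} (by decide) (by decide),
          edgeParam_top, edgeParam_bottom, (edgeParam_vertical _).1, (edgeParam_horizontal _).1]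
        simp only [zpow_one, zpow_neg, mul_one, mul_assoc]
      · rw [e1 _ _ (by decide), e2 _ _ (by decide), e4 _ _ (by decide),
          segmentLength_eq z _ _ 1 {0, 1} (by decide) (by decide),
          segmentLength_eq z _ _ 1 {1, 2} (by decide) (by decide),
          segmentLength_eq z _ _ (-1) {2, 3} (by decide) (by decide),
          segmentLength_eq z _ _ (-1) {1, 3} (by decide) (by decide),
          edgeParam_top, edgeParam_bottom, (edgeParam_vertical _).2, (edgeParam_horizontal _).2]
        simp only [zpow_one, zpow_neg, mul_one, mul_assoc]
    have hp : punctureTurns = [.same, .switch, .same, .switch] ++ [.same, .switch, .same, .switch] :=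
      rfl
    rw [punctureLength, hp, IdealTriangulation.curveLength_append, punctureStart,
      half _ (Or.inl rfl), len _ (Or.inl rfl), len _ (Or.inr (mul_one _)), sq]

theorem punctureLength_pos {n : ℕ} {w : Fin (n + 1) → Letter} (s : ℤˣ) (h0 : w 0 = .R)
    (h1 : w (Fin.last n) = .L) {z : Fin (n + 1) → ℝ} (hz0 : ∀ j, z j ≠ 0) (hz1 : ∀ j, z j ≠ 1) :
    0 < punctureLength w s z := by
  rw [punctureLength_eq s h0 h1]
  have h2 : z 0 - 1 ≠ 0 := sub_ne_zero.2 (hz1 0)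
  have h3 : 1 - z 0 ≠ 0 := sub_ne_zero.2 (hz1 0).symm
  have h4 := hz0 (Fin.last n)
  have h5 := hz0 0
  have h6 := hz0 1
  positivity

/-- `Real.log` ignores signs, so `z 0 - 1` and `1 - z 0` may be identified; their two contributions
add up to `-logVert (z 0)`. -/
theorem log_punctureLength {n : ℕ} {w : Fin (n + 1) → Letter} (s : ℤˣ) (h0 : w 0 = .R)
    (h1 : w (Fin.last n) = .L) {z : Fin (n + 1) → ℝ} (hz0 : ∀ j, z j ≠ 0) (hz1 : ∀ j, z j ≠ 1) :
    Real.log (punctureLength w s z) = 2 * logPuncture z := by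
  rw [punctureLength_eq s h0 h1]
  have h2 : z 0 - 1 ≠ 0 := sub_ne_zero.2 (hz1 0)
  have h3 : 1 - z 0 ≠ 0 := sub_ne_zero.2 (hz1 0).symm
  have h4 := hz0 (Fin.last n)
  have h5 := hz0 0
  have h6 := hz0 1
  rw [Real.log_pow, Real.log_mul (by positivity) (by positivity),
    Real.log_mul (by positivity) (by positivity), Real.log_mul (by positivity) (by positivity),
    Real.log_div h2 h5, Real.log_inv, Real.log_inv, one_div, Real.log_inv,
    ← Real.log_neg_eq_log (z 0 - 1), neg_sub, logPuncture, logVert]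
  push_cast
  ring

/-! ### Reversing a word -/

theorem Letter.other_other (X : Letter) : X.other.other = X := by cases X <;> rfl

theorem Letter.eq_other_of_ne {X Y : Letter} (h : X ≠ Y) : X = Y.other := by
  cases X <;> cases Y <;> simp_all [Letter.other]

section Reverse

variable {n : ℕ} (w : Fin (n + 1) → Letter)

/-- The word read backwards, with the letters exchanged. -/
def rev : Fin (n + 1) → Letter := fun i => (w (-(i + 1))).other

variable {w}

theorem rev_neg_succ (j : Fin (n + 1)) : rev w (-(j + 1)) = (w j).other := by
  simp [rev]

theorem exists_rev_eq {X : Letter} (hX : ∃ i, w i = X.other) : ∃ i, rev w i = X := by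
  obtain ⟨i, hi⟩ := hX
  exact ⟨-(i + 1), by rw [rev_neg_succ, hi, Letter.other_other]⟩

/-- Upside down, `i` becomes `-i`, the letters are exchanged, and the edge with a given top
tetrahedron is named by its bottom tetrahedron; `bot` translates back to the original names. -/
theorem bot_neg_last_rev {X : Letter} (hX : ∃ i, w i = X.other) (i : Fin (n + 1)) :
    bot w (-(last (rev w) X i)) = last w X.other (-i) := by
  refine back_induction (P := fun i => bot w (-(last (rev w) X i)) = last w X.other (-i))
    (exists_rev_eq hX) (fun i hi => ?_) (fun i hi ih => ?_) i
  · have h : w (-(i + 1)) = X.other := by rw [← hi, rev, Letter.other_other]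
    rw [last_succ_of_eq hi, bot, ← h]
    congr 2 <;> abel
  · have h : w (-(i + 1)) ≠ X.other := fun h => hi (by rw [rev, h, Letter.other_other])
    rw [last_succ_of_ne (exists_rev_eq hX) hi, ih, ← last_succ_of_ne hX h]
    congr 1
    abel

/-- Reversal exchanges the roles of top and bottom edge. In particular every edge is the bottom edge
of some tetrahedron, which yields the bijectivity of `bot`. -/
theorem bot_neg_bot_rev (i : Fin (n + 1)) : bot w (-(bot (rev w) i)) = -i := by
  obtain ⟨j, rfl⟩ : ∃ j, i = -(j + 1) + 1 := ⟨-i, by abel⟩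
  rw [bot_succ, bot_neg_last_rev ⟨j, by rw [rev_neg_succ, Letter.other_other]⟩, rev_neg_succ,
    Letter.other_other, neg_neg, last_succ_of_eq rfl]
  abel

theorem bot_bijective : Function.Bijective (bot w) := by
  refine Function.Surjective.bijective_of_finite fun j => ⟨-(bot (rev w) (-j)), ?_⟩
  rw [bot_neg_bot_rev, neg_neg]

theorem logVert_inv {z : ℝ} (h0 : z ≠ 0) (h1 : z ≠ 1) : logVert (1 / z) = -logHor z := by
  have e : 1 - 1 / z = -((1 - z) / z) := by field_simp; ring
  rw [logVert, e, Real.log_neg_eq_log, Real.log_div (sub_ne_zero.2 h1.symm) h0, logHor]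
  ring

theorem logHor_inv {z : ℝ} (h0 : z ≠ 0) (h1 : z ≠ 1) : logHor (1 / z) = -logVert z := by
  have h2 := two_log_add_logVert_add_logHor z
  have h3 := two_log_add_logVert_add_logHor (1 / z)
  rw [logVert_inv h0 h1, one_div, Real.log_inv] at h3
  rw [one_div]
  linarith

/-- Turning a tetrahedron upside down exchanges vertical and horizontal sides; replacing `z` by `1 /
z` also swaps the two side parameters, up to inversion. So every contribution to an edge changes
sign. -/
theorem logHol_rev (hR : ∃ i, w i = .R) (hL : ∃ i, w i = .L) {z : Fin (n + 1) → ℝ} (h0 : ∀ j, z j ≠ 0) (h1 : ∀ j, z j ≠ 1)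
    (k : Fin (n + 1)) :
    logHol (rev w) (fun i => 1 / z (-i)) k = -logHol w z (bot w (-k)) := by
  have hb : ∀ i j : Fin (n + 1), bot w (-i) = bot w (-j) ↔ i = j := fun i j => by
    rw [bot_bijective.1.eq_iff, neg_inj]
  rw [logHol, logHol, ← Finset.sum_neg_distrib,
    ← Equiv.sum_comp (Equiv.neg (Fin (n + 1))) (fun j => -(_ + _ + _ + _))]
  refine Finset.sum_congr rfl fun i _ => ?_
  have q : -i = bot w (-k) ↔ bot (rev w) i = k := by rw [← bot_neg_bot_rev, hb]
  have qR : last w .R (-i) = bot w (-k) ↔ last (rev w) .L i = k := by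
    rw [← hb (last (rev w) .L i), bot_neg_last_rev (X := .L) hR]; rfl
  have qL : last w .L (-i) = bot w (-k) ↔ last (rev w) .R i = k := by
    rw [← hb (last (rev w) .R i), bot_neg_last_rev (X := .R) hL]; rfl
  simp only [Equiv.neg_apply, q, qR, qL, hb, logVert_inv (h0 _) (h1 _), logHor_inv (h0 _) (h1 _)]
  rw [one_div, Real.log_inv]
  split_ifs <;> ring

theorem logPuncture_inv_neg {z : Fin (n + 1) → ℝ} (h0 : ∀ j, z j ≠ 0) (h1 : ∀ j, z j ≠ 1) :
    logPuncture (fun i => 1 / z (-i)) = logPuncture z := by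
  have e1 : -Fin.last n = 1 := by rw [neg_eq_iff_add_eq_zero, Fin.last_add_one]
  have e2 : (-1 : Fin (n + 1)) = Fin.last n := by rw [← e1, neg_neg]
  simp only [logPuncture, e1, e2, neg_zero]
  rw [logVert_inv (h0 _) (h1 _)]
  simp only [one_div, Real.log_inv]
  linarith [two_log_add_logVert_add_logHor (z 0)]

end Reverse

/-! ### From solutions of balanced systems to curves of shape parameters -/

/-- A single strictly monotone coordinate already embeds the line; `ε` allows it to be decreasing.
-/
theorem isEmbedding_of_deriv_pos {n : ℕ} {f f' : ℝ → Fin (n + 1) → ℝ} {ε : ℝ} (i : Fin (n + 1))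
    (hf : ∀ t, HasDerivAt f (f' t) t) (h : ∀ t, 0 < ε * f' t i) : Topology.IsEmbedding f := by
  have hc : Continuous f := continuous_iff_continuousAt.2 fun t => (hf t).continuousAt
  have hg : Continuous fun x : Fin (n + 1) → ℝ => ε * x i :=
    continuous_const.mul (continuous_apply i)
  refine Topology.IsEmbedding.of_comp hc hg ?_
  have hm : StrictMono ((fun x : Fin (n + 1) → ℝ => ε * x i) ∘ f) :=
    strictMono_of_hasDerivAt_pos (f' := fun t => ε * f' t i)
      (fun t => (hasDerivAt_pi.1 (hf t) i).const_mul ε) h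
  refine hm.isEmbedding_of_ordConnected ?_
  exact (isPreconnected_range (hg.comp hc)).ordConnected

theorem differentiableAt_edgeHolonomy {n : ℕ} {w : Fin (n + 1) → Letter} (s : ℤˣ)
    (hR : ∃ i, w i = .R) (hL : ∃ i, w i = .L) {z : Fin (n + 1) → ℝ} (h0 : ∀ j, z j ≠ 0)
    (h1 : ∀ j, z j ≠ 1) (k : Fin (n + 1)) : DifferentiableAt ℝ
      (fun z' => (monodromyTriangulation w s).edgeHolonomy z' (topEdge w s k)) z := by
  have e : (fun z' => (monodromyTriangulation w s).edgeHolonomy z' (topEdge w s k)) = _ :=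
    funext fun z' => edgeHolonomy_topEdge s hR hL z' k
  rw [e]
  refine (HasFDerivAt.finsetProd fun j _ => DifferentiableAt.hasFDerivAt ?_).differentiableAt
  have hj : DifferentiableAt ℝ (fun z' : Fin (n + 1) → ℝ => z' j) z := differentiableAt_apply j z
  have hs : 1 - z j ≠ 0 := sub_ne_zero.2 (h1 j).symm
  have hif : ∀ (p : Prop) [Decidable p] (f : (Fin (n + 1) → ℝ) → ℝ), DifferentiableAt ℝ f z →
      DifferentiableAt ℝ (fun z' => if p then f z' else 1) z := by
    intro p _ f hf
    split_ifs
    · exact hf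
    · exact differentiableAt_const _
  have hx : DifferentiableAt ℝ (fun z' : Fin (n + 1) → ℝ => (1 / (1 - z' j)) ^ 2) z := by
    fun_prop (disch := exact hs)
  have hy : DifferentiableAt ℝ (fun z' : Fin (n + 1) → ℝ => ((z' j - 1) / z' j) ^ 2) z := by
    fun_prop (disch := exact h0 j)
  exact (((hif _ _ hj).fun_mul (hif _ _ hj)).fun_mul (hif _ _ hx)).fun_mul (hif _ _ hy)

/-- A parameterization of shape parameters by the unknowns of a balanced system, which turns the edge
equations into those of the system. -/
structure ShapeChart {n : ℕ} (w : Fin (n + 1) → Letter) (B : BalancedSystem n) where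
  coord : Fin (n + 1) → ℝ → ℝ
  coord' : Fin (n + 1) → ℝ → ℝ
  index : Equiv.Perm (Fin (n + 1))
  orient : ℝ
  edge : Fin (n + 1) → Fin (n + 1)
  sgn : ℝ
  scale : ℝ
  contDiff_coord : ∀ j, ContDiff ℝ ∞ (coord j)
  hasDerivAt_coord : ∀ j x, HasDerivAt (coord j) (coord' j x) x
  orient_mul_pos : ∀ j x, 0 < orient * coord' j x
  coord_pos : ∀ j x, 0 < coord j x
  coord_ne_one : ∀ j x, coord j x ≠ 1
  edge_surjective : Function.Surjective edge
  sgn_ne_zero : sgn ≠ 0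
  scale_ne_zero : scale ≠ 0
  logHol_eq : ∀ x k, logHol w (fun j => coord j (x (index j))) (edge k) = sgn * B.flow k x
  height_eq : ∀ x ∈ B.solutions,
    B.height x = scale * logPuncture (fun j => coord j (x (index j)))

namespace ShapeChart

variable {n : ℕ} {w : Fin (n + 1) → Letter} {B : BalancedSystem n} (C : ShapeChart w B)

/-- The shape parameters with the given coordinates. -/
def shape (x : Fin (n + 1) → ℝ) : Fin (n + 1) → ℝ := fun j => C.coord j (x (C.index j))

/-- The differential of `shape`. -/
def dshape (x : Fin (n + 1) → ℝ) : (Fin (n + 1) → ℝ) →L[ℝ] (Fin (n + 1) → ℝ) :=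
  ContinuousLinearMap.pi fun j =>
    C.coord' j (x (C.index j)) • ContinuousLinearMap.proj (C.index j)

theorem dshape_apply (x v : Fin (n + 1) → ℝ) (j : Fin (n + 1)) :
    C.dshape x v j = C.coord' j (x (C.index j)) * v (C.index j) := by
  simp [dshape]

theorem contDiff_shape : ContDiff ℝ ∞ C.shape :=
  contDiff_pi.2 fun j => (C.contDiff_coord j).comp (contDiff_apply ℝ ℝ (C.index j))

theorem hasFDerivAt_shape (x : Fin (n + 1) → ℝ) : HasFDerivAt C.shape (C.dshape x) x :=
  hasFDerivAt_pi.2 fun j => (C.hasDerivAt_coord j _).comp_hasFDerivAt x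
    (hasFDerivAt_apply (C.index j) x)

theorem dshape_surjective (x : Fin (n + 1) → ℝ) : Function.Surjective (C.dshape x) := by
  intro u
  refine ⟨fun i => u (C.index.symm i) / C.coord' (C.index.symm i) (x i), ?_⟩
  ext j
  have h : C.coord' j (x (C.index j)) ≠ 0 := fun h => by
    have := C.orient_mul_pos j (x (C.index j))
    rw [h, mul_zero] at this
    exact this.false
  rw [dshape_apply, Equiv.symm_apply_apply, mul_div_cancel₀ _ h]

/-- In the chart an edge holonomy is the exponential of `sgn` times a flow. At a solution the
exponential is `1`, so the differentials are proportional. -/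
theorem mem_tangentSpace_iff (s : ℤˣ) (hR : ∃ i, w i = .R) (hL : ∃ i, w i = .L)
    {x : Fin (n + 1) → ℝ} (hx : x ∈ B.solutions) (v : Fin (n + 1) → ℝ) :
    C.dshape x v ∈ (monodromyTriangulation w s).tangentSpace (C.shape x) ↔
      ∀ i, B.dflow i x v = 0 := by
  have key : ∀ i, fderiv ℝ (fun z' => (monodromyTriangulation w s).edgeHolonomy z'
      (topEdge w s (C.edge i))) (C.shape x) (C.dshape x v) = C.sgn * B.dflow i x v := by
    intro i
    have h1 := (differentiableAt_edgeHolonomy s hR hL (z := C.shape x)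
      (fun j => (C.coord_pos j _).ne') (fun j => C.coord_ne_one j _) (C.edge i)).hasFDerivAt.comp x
      (C.hasFDerivAt_shape x)
    have h2 : ((fun z' => (monodromyTriangulation w s).edgeHolonomy z'
        (topEdge w s (C.edge i))) ∘ C.shape) = fun y => Real.exp (C.sgn * B.flow i y) := by
      ext y
      rw [← C.logHol_eq]
      exact edgeHolonomy_eq_exp s hR hL (z := C.shape y) (fun j => C.coord_pos j _) (fun j => C.coord_ne_one j _) _
    rw [h2] at h1
    have h3 := ((B.hasFDerivAt_flow i x).const_mul C.sgn).exp
    have h4 := congrArg (fun φ : (Fin (n + 1) → ℝ) →L[ℝ] ℝ => φ v) (h1.unique h3)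
    simpa [hx i] using h4
  rw [IdealTriangulation.tangentSpace, Submodule.mem_iInf]
  constructor
  · intro h i
    have h1 : fderiv ℝ (fun z' => (monodromyTriangulation w s).edgeHolonomy z'
      (topEdge w s (C.edge i))) (C.shape x) (C.dshape x v) = 0 := h (topEdge w s (C.edge i))
    rw [key] at h1
    exact (mul_eq_zero.1 h1).resolve_left C.sgn_ne_zero
  · intro h E
    obtain ⟨k, rfl⟩ := topEdge_surjective s hR hL E
    obtain ⟨i, rfl⟩ := C.edge_surjective k
    change fderiv ℝ (fun z' => (monodromyTriangulation w s).edgeHolonomy z'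
      (topEdge w s (C.edge i))) (C.shape x) (C.dshape x v) = 0
    rw [key, h, mul_zero]

theorem exists_curve (s : ℤˣ) (h0 : w 0 = .R) (h1 : w (Fin.last n) = .L)
    (hne : B.solutions.Nonempty) :
    (∀ z ∈ C.shape '' B.solutions,
      ∃ v ∈ (monodromyTriangulation w s).tangentSpace z, ∀ k, 0 < v k) ∧
    ∃ γ : ℝ → Fin (n + 1) → ℝ,
      ContDiff ℝ ∞ γ ∧ Topology.IsEmbedding γ ∧ Set.range γ = C.shape '' B.solutions ∧
      (∀ t, deriv γ t ≠ 0) ∧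
      (∀ t, (monodromyTriangulation w s).tangentSpace (γ t) = Submodule.span ℝ {deriv γ t}) ∧
      ∀ t, Real.log (punctureLength w s (γ t)) = t := by
  obtain ⟨γ, γ', hγ, hγ', hrange, hheight, hpos, hker⟩ := B.exists_curve hne
  have hmem : ∀ t, γ t ∈ B.solutions := fun t => hrange ▸ Set.mem_range_self t
  have hR : ∃ i, w i = .R := ⟨_, h0⟩
  have hL : ∃ i, w i = .L := ⟨_, h1⟩
  have hsol : ∀ t, C.dshape (γ t) (γ' t) ∈
      (monodromyTriangulation w s).tangentSpace (C.shape (γ t)) := fun t =>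
    (C.mem_tangentSpace_iff s hR hL (hmem t) _).2 ((hker t _).2 ⟨1, (one_smul _ _).symm⟩)
  have hsign : ∀ t j, 0 < C.orient * C.dshape (γ t) (γ' t) j := by
    intro t j
    rw [dshape_apply, ← mul_assoc]
    exact mul_pos (C.orient_mul_pos j _) (hpos t _)
  refine ⟨?_, ?_⟩
  · rintro _ ⟨x, hx, rfl⟩
    obtain ⟨t, rfl⟩ : x ∈ Set.range γ := hrange ▸ hx
    exact ⟨C.orient • C.dshape (γ t) (γ' t), Submodule.smul_mem _ _ (hsol t), hsign t⟩
  -- The height is `scale * logPuncture`, while the signed length is `2 * logPuncture`; the signed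
  -- length `t` thus belongs to the height `scale / 2 * t`.
  · have hc : C.scale / 2 ≠ 0 := div_ne_zero C.scale_ne_zero two_ne_zero
    have hd : ∀ t, HasDerivAt (fun t => C.shape (γ (C.scale / 2 * t)))
        ((C.scale / 2) • C.dshape (γ (C.scale / 2 * t)) (γ' (C.scale / 2 * t))) t := by
      intro t
      have e1 : HasDerivAt (fun t : ℝ => C.scale / 2 * t) (C.scale / 2) t := by
        simpa using (hasDerivAt_id t).const_mul (C.scale / 2)
      have e2 := (C.hasFDerivAt_shape (γ (C.scale / 2 * t))).comp_hasDerivAt t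
        ((hγ' (C.scale / 2 * t)).scomp t e1)
      rw [map_smul] at e2
      exact e2
    refine ⟨fun t => C.shape (γ (C.scale / 2 * t)), ?_, ?_, ?_, ?_, ?_, ?_⟩
    · exact C.contDiff_shape.comp (hγ.comp (contDiff_const.mul contDiff_id))
    · refine isEmbedding_of_deriv_pos (ε := C.orient * (C.scale / 2)) 0 hd fun t => ?_
      have e := mul_pos (mul_self_pos.2 hc) (hsign (C.scale / 2 * t) 0)
      rw [Pi.smul_apply, smul_eq_mul]
      linarith
    · ext z
      constructor
      · rintro ⟨t, rfl⟩
        exact ⟨_, hmem _, rfl⟩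
      · rintro ⟨x, hx, rfl⟩
        obtain ⟨t, rfl⟩ : x ∈ Set.range γ := hrange ▸ hx
        exact ⟨t / (C.scale / 2), by simp only [mul_div_cancel₀ _ hc]⟩
    · intro t h
      rw [(hd t).deriv] at h
      have e := hsign (C.scale / 2 * t) 0
      rw [(smul_eq_zero.1 h).resolve_left hc, Pi.zero_apply, mul_zero] at e
      exact e.false
    · intro t
      rw [(hd t).deriv]
      ext u
      obtain ⟨v, rfl⟩ := C.dshape_surjective (γ (C.scale / 2 * t)) u
      rw [C.mem_tangentSpace_iff s hR hL (hmem _), hker, Submodule.mem_span_singleton]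
      constructor
      · rintro ⟨a, rfl⟩
        exact ⟨a / (C.scale / 2), by rw [smul_smul, div_mul_cancel₀ _ hc, map_smul]⟩
      · rintro ⟨a, ha⟩
        refine ⟨a * (C.scale / 2), ?_⟩
        ext i
        have h2 := congrFun ha (C.index.symm i)
        rw [Pi.smul_apply, Pi.smul_apply, dshape_apply, dshape_apply, Equiv.apply_symm_apply] at h2
        have h3 : C.coord' (C.index.symm i) (γ (C.scale / 2 * t) i) ≠ 0 := fun h => by
          have := C.orient_mul_pos (C.index.symm i) (γ (C.scale / 2 * t) i)
          rw [h, mul_zero] at this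
          exact this.false
        refine mul_left_cancel₀ h3 ?_
        rw [← h2]
        simp only [smul_eq_mul, Pi.smul_apply]
        ring
    · intro t
      rw [log_punctureLength s h0 h1 (z := C.shape (γ (C.scale / 2 * t))) (fun j => (C.coord_pos j _).ne')
        (fun j => C.coord_ne_one j _)]
      have e := C.height_eq _ (hmem (C.scale / 2 * t))
      rw [hheight] at e
      have e2 : C.scale * (t / 2) = C.scale *
          logPuncture (fun j => C.coord j (γ (C.scale / 2 * t) (C.index j))) := by
        rw [← e]; ring
      have e3 := mul_left_cancel₀ C.scale_ne_zero e2
      change 2 * logPuncture (fun j => C.coord j (γ (C.scale / 2 * t) (C.index j))) = t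
      rw [← e3]
      ring

end ShapeChart

/-! ### The two charts of a word -/

/-- The derivative of `Letter.param`. -/
def Letter.param' : Letter → ℝ → ℝ
  | .R, x => Real.exp x
  | .L, x => Real.exp (-x) / (1 + Real.exp (-x)) ^ 2

namespace Letter

variable (X : Letter)

theorem contDiff_param : ContDiff ℝ ∞ X.param := by
  cases X with
  | R => exact contDiff_const.add Real.contDiff_exp
  | L =>
    exact contDiff_const.div (contDiff_const.add (Real.contDiff_exp.comp contDiff_neg))
      fun x => (one_add_exp_pos (-x)).ne'

theorem hasDerivAt_param (x : ℝ) : HasDerivAt X.param (X.param' x) x := by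
  cases X with
  | R => exact (Real.hasDerivAt_exp x).const_add 1
  | L =>
    have h := (hasDerivAt_const x (1 : ℝ)).div
      (((Real.hasDerivAt_exp (-x)).comp x (hasDerivAt_neg x)).const_add 1) (one_add_exp_pos (-x)).ne'
    refine h.congr_deriv ?_
    simp [param']

theorem param'_pos (x : ℝ) : 0 < X.param' x := by
  cases X <;> simp only [param'] <;> positivity

theorem inRange_param (x : ℝ) : X.InRange (X.param x) := (X.inRange_iff _).2 ⟨x, rfl⟩

theorem other_param (x : ℝ) : X.other.param x = 1 / X.param (-x) := by
  cases X <;> simp [other, param]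

end Letter

section Charts

variable {n : ℕ} {w : Fin (n + 1) → Letter} (h0 : w 0 = .R) (h1 : w (Fin.last n) = .L)

/-- The chart for shape parameters which are greater than `1` behind the letters `R` and less than
`1` behind the letters `L`. -/
def plusChart : ShapeChart w (wordSystem w ⟨_, h0⟩ ⟨_, h1⟩) where
  coord j := (w (j - 1)).param
  coord' j := (w (j - 1)).param'
  index := 1
  orient := 1
  edge k := k - 1
  sgn := 1
  scale := -(n + 1)
  contDiff_coord j := Letter.contDiff_param _
  hasDerivAt_coord j := Letter.hasDerivAt_param _
  orient_mul_pos j x := by rw [one_mul]; exact Letter.param'_pos _ x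
  coord_pos j x := (Letter.inRange_param _ x).pos
  coord_ne_one j x := (Letter.inRange_param _ x).ne_one
  edge_surjective k := ⟨k + 1, by simp⟩
  sgn_ne_zero := one_ne_zero
  scale_ne_zero := neg_ne_zero.2 (by positivity)
  logHol_eq x k := by
    have h := logHol_wordParam (w := w) ⟨_, h0⟩ ⟨_, h1⟩ x (k - 1)
    rw [sub_add_cancel] at h
    rw [one_mul, ← h]
    rfl
  height_eq x hx := by
    rw [height_wordSystem _ _ h0 h1 hx, neg_mul]
    rfl

theorem rev_zero (h1 : w (Fin.last n) = .L) : rev w 0 = .R := by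
  have e : -(0 + 1 : Fin (n + 1)) = Fin.last n := by
    rw [zero_add, neg_eq_iff_add_eq_zero, add_comm (1 : Fin (n + 1)), Fin.last_add_one]
  rw [rev, e, h1]
  rfl

theorem rev_last (h0 : w 0 = .R) : rev w (Fin.last n) = .L := by
  rw [rev, Fin.last_add_one, neg_zero, h0]
  rfl

theorem wordParam_rev (x : Fin (n + 1) → ℝ) :
    wordParam (rev w) x = fun i => 1 / (w (-i)).param (-x (- -i)) := by
  ext i
  have e : rev w (i - 1) = (w (-i)).other := by simp [rev]
  rw [wordParam, e, Letter.other_param, neg_neg]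

/-- The chart for shape parameters which are greater than `1` before the letters `R` and less than
`1` before the letters `L`. -/
def minusChart : ShapeChart w (wordSystem (rev w) ⟨_, rev_zero h1⟩ ⟨_, rev_last h0⟩) where
  coord j x := (w j).param (-x)
  coord' j x := -(w j).param' (-x)
  index := Equiv.neg _
  orient := -1
  -- The edge with index `k - 1` in the reversed triangulation is the bottom edge of tetrahedron
  -- `-(k - 1)`.
  edge k := bot w (-(k - 1))
  sgn := -1
  scale := -(n + 1)
  contDiff_coord j := (Letter.contDiff_param _).comp contDiff_neg
  hasDerivAt_coord j x := by
    have h := ((w j).hasDerivAt_param (-x)).comp x (hasDerivAt_neg x)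
    rw [mul_neg_one] at h
    exact h
  orient_mul_pos j x := by rw [neg_mul_neg, one_mul]; exact Letter.param'_pos _ _
  coord_pos j x := (Letter.inRange_param _ _).pos
  coord_ne_one j x := (Letter.inRange_param _ _).ne_one
  edge_surjective k := by
    obtain ⟨j, rfl⟩ := (bot_bijective (w := w)).2 k
    exact ⟨-j + 1, by simp⟩
  sgn_ne_zero := by norm_num
  scale_ne_zero := neg_ne_zero.2 (by positivity)
  logHol_eq x k := by
    have h := logHol_wordParam (w := rev w) ⟨_, rev_zero h1⟩ ⟨_, rev_last h0⟩ x (k - 1)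
    have h2 := logHol_rev (w := w) ⟨_, h0⟩ ⟨_, h1⟩ (z := fun j => (w j).param (-x (-j)))
      (fun j => (Letter.inRange_param _ _).pos.ne') (fun j => (Letter.inRange_param _ _).ne_one)
      (k - 1)
    rw [sub_add_cancel] at h
    rw [← h, wordParam_rev, h2, neg_mul_neg, one_mul]
    rfl
  height_eq x hx := by
    have h2 := logPuncture_inv_neg (z := fun j => (w j).param (-x (-j)))
      (fun j => (Letter.inRange_param _ _).pos.ne') (fun j => (Letter.inRange_param _ _).ne_one)
    rw [height_wordSystem _ _ (rev_zero h1) (rev_last h0) hx, wordParam_rev, h2, neg_mul]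
    rfl

end Charts

/-! ### Sign patterns -/

section Patterns

variable {n : ℕ} {w : Fin (n + 1) → Letter}

theorem dihedralAngle_of_pos {p : ℝ} (h : 0 < p) : dihedralAngle p = 0 := if_neg h.not_gt

theorem dihedralAngle_of_neg {p : ℝ} (h : p < 0) : dihedralAngle p = Real.pi := if_pos h

theorem Letter.InRange.dihedralAngle_vert {X : Letter} {z : ℝ} (h : X.InRange z) :
    dihedralAngle (1 / (1 - z)) = if X = .R then Real.pi else 0 := by
  cases X
  · exact dihedralAngle_of_neg (div_neg_of_pos_of_neg one_pos (sub_neg.2 h))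
  · exact dihedralAngle_of_pos (div_pos one_pos (sub_pos.2 h.2))

theorem Letter.InRange.dihedralAngle_hor {X : Letter} {z : ℝ} (h : X.InRange z) :
    dihedralAngle ((z - 1) / z) = if X = .L then Real.pi else 0 := by
  cases X
  · exact dihedralAngle_of_pos (div_pos (sub_pos.2 h) h.pos)
  · exact dihedralAngle_of_neg (div_neg_of_neg_of_pos (sub_neg.2 h.2) h.1)

/-- A tetrahedron contributes only at the pair of sides with negative parameter. These two sides lie
in one edge, so it contributes `2π` there. -/
theorem totalAngle_eq_card (s : ℤˣ) (hR : ∃ i, w i = .R) (hL : ∃ i, w i = .L)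
    {z : Fin (n + 1) → ℝ} {σ : Fin (n + 1) → Letter} (hσ : ∀ j, (σ j).InRange (z j))
    (k : Fin (n + 1)) : (monodromyTriangulation w s).totalAngle z (topEdge w s k) =
      2 * Real.pi * (Finset.univ.filter fun j => last w (σ j) j = k).card := by
  rw [totalAngle_topEdge s hR hL, Finset.card_filter, Nat.cast_sum, Finset.mul_sum]
  refine Finset.sum_congr rfl fun j _ => ?_
  rw [(hσ j).dihedralAngle_vert, (hσ j).dihedralAngle_hor, dihedralAngle_of_pos (hσ j).pos]
  rcases σ j with _ | _ <;> simp

theorem mem_realDeformationVariety_iff (s : ℤˣ) (hR : ∃ i, w i = .R) (hL : ∃ i, w i = .L)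
    {z : Fin (n + 1) → ℝ} {σ : Fin (n + 1) → Letter} (hσ : ∀ j, (σ j).InRange (z j)) :
    z ∈ (monodromyTriangulation w s).realDeformationVariety ↔
      (∀ k, logHol w z k = 0) ∧ Function.Bijective fun j => last w (σ j) j := by
  have hangle : ∀ k, (monodromyTriangulation w s).totalAngle z (topEdge w s k) = 2 * Real.pi ↔
      ∃! j, last w (σ j) j = k := by
    intro k
    rw [totalAngle_eq_card s hR hL hσ, mul_eq_left₀ (by positivity), Nat.cast_eq_one,
      Finset.card_eq_one, Finset.singleton_iff_unique_mem]
    simp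
  have hhol : ∀ k, (monodromyTriangulation w s).edgeHolonomy z (topEdge w s k) = 1 ↔
      logHol w z k = 0 := by
    intro k
    rw [edgeHolonomy_eq_exp s hR hL (fun j => (hσ j).pos) (fun j => (hσ j).ne_one),
      Real.exp_eq_one_iff]
  rw [Function.bijective_iff_existsUnique]
  constructor
  · rintro ⟨-, h⟩
    exact ⟨fun k => (hhol k).1 (h _).1, fun k => (hangle k).1 (h _).2⟩
  · rintro ⟨h1, h2⟩
    refine ⟨fun j => ⟨(hσ j).pos.ne', (hσ j).ne_one⟩, fun E => ?_⟩
    obtain ⟨k, rfl⟩ := topEdge_surjective s hR hL E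
    exact ⟨(hhol k).2 (h1 k), (hangle k).2 (h2 k)⟩

/-- The first opportunity: the edge created on top of tetrahedron `j - 1` receives its angle in
tetrahedron `j`. -/
theorem bijective_last_pred : Function.Bijective fun j => last w (w (j - 1)) j := by
  have e : (fun j => last w (w (j - 1)) j) = Equiv.subRight (1 : Fin (n + 1)) := by
    ext1 j
    obtain ⟨i, rfl⟩ : ∃ i, j = i + 1 := ⟨j - 1, by simp⟩
    simp [last_succ_of_eq]
  rw [e]
  exact Equiv.bijective _

/-- The last opportunity: the edge about to become the bottom edge of tetrahedron `j + 1` receives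
its angle in tetrahedron `j`. -/
theorem bijective_last_self : Function.Bijective fun j => last w (w j) j := by
  have e : (fun j => last w (w j) j) = bot w ∘ Equiv.addRight (1 : Fin (n + 1)) := by
    ext1 j
    simp [bot_succ]
  rw [e]
  exact bot_bijective.comp (Equiv.bijective _)

/-- If every edge is the edge with angle `π` of exactly one tetrahedron, then this happens at the
first opportunity for all edges, or at the last one for all edges. -/
theorem pattern_cases (hR : ∃ i, w i = .R) (hL : ∃ i, w i = .L) {σ : Fin (n + 1) → Letter}
    (hσ : Function.Bijective fun j => last w (σ j) j) :
    (∀ j, σ j = w (j - 1)) ∨ ∀ j, σ j = w j := by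
  have hX : ∀ X, ∃ i, w i = X := by
    intro X
    cases X
    · exact hR
    · exact hL
  obtain ⟨u, hu1, hu2⟩ := Function.bijective_iff_has_inverse.1 hσ
  simp only [Function.LeftInverse, Function.RightInverse] at hu1 hu2
  -- The number of layers that the edge `E` waits for its angle.
  set T : Fin (n + 1) → ℕ := fun E => back w (σ (u E)) (u E) with hT
  have hwu : ∀ E, w E = σ (u E) := fun E => by
    conv_lhs => rw [← hu2 E]
    exact (back_mem (hX _) _).2
  have hadd : ∀ E, u E = E + T E • (1 : Fin (n + 1)) := fun E => by
    have h := hu2 E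
    rw [last, sub_eq_iff_eq_add] at h
    exact h
  have hT1 : ∀ E, 1 ≤ T E := fun E => (back_mem (hX _) _).1
  have hlast : ∀ X j, last w X j + back w X j • (1 : Fin (n + 1)) = j := fun X j => by simp [last]
  have hmin : ∀ E (d : ℕ), 1 ≤ d → d < T E → w (u E - d • (1 : Fin (n + 1))) ≠ w E := by
    intro E d hd hdT h
    rw [hwu E] at h
    exact absurd (back_le hd h) (not_le.2 hdT)
  have hiff : ∀ X j, σ j = X ↔ T (last w X j) = back w X j := by
    intro X j
    constructor
    · rintro rfl
      simp only [hT, hu1]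
    · intro h
      have h1 : u (last w X j) = j := by rw [hadd, h, hlast]
      rw [← (back_mem (hX X) j).2, hwu, h1]
  -- Above tetrahedron `j` this edge is no longer a side, so it must have received its angle by
  -- then.
  have hle : ∀ j, T (last w (w j) j) ≤ back w (w j) j := by
    intro j
    by_contra! h
    have hb := (back_mem (hX (w j)) j).1
    refine hmin (last w (w j) j) (T (last w (w j) j) - back w (w j) j) (by omega) (by omega) ?_
    rw [(back_mem (hX (w j)) j).2, hadd]
    congr 1
    obtain ⟨d, hd⟩ := Nat.exists_eq_add_of_lt h
    rw [hd]
    have : back w (w j) j + d + 1 - back w (w j) j = d + 1 := by omega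
    rw [this, add_assoc, add_nsmul, ← add_assoc, hlast, add_sub_cancel_right]
  -- Between equal letters an edge is a side of one tetrahedron only, which leaves no choice.
  have hsame : ∀ j, w (j + 1) = w j → σ (j + 1) = w j := by
    intro j hj
    rw [hiff]
    have h1 := hle (j + 1)
    rw [hj, back_succ_of_eq rfl] at h1
    rw [back_succ_of_eq rfl]
    exact le_antisymm h1 (hT1 _)
  -- `U j` says that the older of the two side edges of tetrahedron `j + 1` has received its angle
  -- before. This turns out not to depend on `j`, and separates the two patterns.
  set U : Fin (n + 1) → Prop := fun j => T (last w (w j).other (j + 1)) < back w (w j).other (j + 1)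
    with hU
  have hUU : ∀ j, U (j + 1) ↔ U j := by
    intro j
    by_cases hj : w (j + 1) = w j
    · simp only [hU]
      rw [hj, last_succ_of_ne (hX _) (hj ▸ Letter.ne_other _),
        back_succ_of_ne (hX _) (hj ▸ Letter.ne_other _)]
      have h1 : T (last w (w j).other (j + 1)) ≠ back w (w j).other (j + 1) := fun h => by
        rw [← hiff, hsame j hj] at h
        exact Letter.ne_other _ h
      omega
    · have hj' : w (j + 1) = (w j).other := Letter.eq_other_of_ne hj
      have h1 : U j ↔ σ (j + 1) ≠ (w j).other := by
        rw [Ne, hiff]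
        have := hle (j + 1)
        rw [hj'] at this
        simp only [hU]
        omega
      have h2 : U (j + 1) ↔ σ (j + 1) = w j := by
        simp only [hU]
        rw [hj', Letter.other_other, last_succ_of_ne (hX _) hj, back_succ_of_ne (hX _) hj,
          back_succ_of_eq rfl, hiff, back_succ_of_eq rfl]
        have := hT1 (last w (w j) (j + 1))
        omega
      rw [h1, h2]
      refine ⟨fun h => h ▸ Letter.ne_other _, fun h => ?_⟩
      rw [Letter.eq_other_of_ne h, Letter.other_other]
  by_cases h0 : U 0
  · left
    intro j
    obtain ⟨i, rfl⟩ : ∃ i, j = i + 1 := ⟨j - 1, by simp⟩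
    have hi : U i := cycle_induction h0 (fun j hj => (hUU j).1 hj) i
    have h1 : σ (i + 1) ≠ (w i).other := fun h => by
      rw [hiff] at h
      exact hi.ne h
    rw [add_sub_cancel_right, Letter.eq_other_of_ne h1, Letter.other_other]
  · right
    intro j
    obtain ⟨i, rfl⟩ : ∃ i, j = i + 1 := ⟨j - 1, by simp⟩
    have hi : ¬ U i := cycle_induction (P := fun i => ¬ U i) h0
      (fun j hj h => hj ((hUU j).2 h)) i
    by_cases hj : w (i + 1) = w i
    · rw [hj, hsame i hj]
    · have hj' : w (i + 1) = (w i).other := Letter.eq_other_of_ne hj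
      have h1 := hle (i + 1)
      rw [hj'] at h1
      rw [hj', hiff]
      exact le_antisymm h1 (not_lt.1 hi)

theorem exists_inRange {z : ℝ} (h0 : 0 < z) (h1 : z ≠ 1) : ∃ X : Letter, X.InRange z := by
  rcases lt_or_gt_of_ne h1 with h | h
  · exact ⟨.L, h0, h⟩
  · exact ⟨.R, h⟩

/-- The points of the real deformation variety with a given sign pattern. -/
def patternSet (w : Fin (n + 1) → Letter) (s : ℤˣ) (σ : Fin (n + 1) → Letter) :
    Set (Fin (n + 1) → ℝ) :=
  {z | z ∈ (monodromyTriangulation w s).realDeformationVariety ∧ ∀ j, (σ j).InRange (z j)}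

theorem patternSet_union (s : ℤˣ) (hR : ∃ i, w i = .R) (hL : ∃ i, w i = .L) :
    patternSet w s (fun j => w (j - 1)) ∪ patternSet w s w =
      {z | z ∈ (monodromyTriangulation w s).realDeformationVariety ∧ ∀ k, 0 < z k} := by
  ext z
  constructor
  · rintro (h | h)
    · exact ⟨h.1, fun k => (h.2 k).pos⟩
    · exact ⟨h.1, fun k => (h.2 k).pos⟩
  · rintro ⟨h, hpos⟩
    choose σ hσ using fun j => exists_inRange (hpos j) (h.1 j).2
    have hb := ((mem_realDeformationVariety_iff s hR hL hσ).1 h).2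
    rcases pattern_cases hR hL hb with h1 | h1
    · exact Or.inl ⟨h, fun j => (h1 j ▸ hσ j : (w (j - 1)).InRange (z j))⟩
    · exact Or.inr ⟨h, fun j => h1 j ▸ hσ j⟩

/-- The patterns disagree at tetrahedron `0`, which lies between the final `L` and the initial `R`.
-/
theorem patternSet_disjoint (s : ℤˣ) (h0 : w 0 = .R) (h1 : w (Fin.last n) = .L) :
    Disjoint (patternSet w s fun j => w (j - 1)) (patternSet w s w) := by
  rw [Set.disjoint_left]
  rintro z ⟨-, h⟩ ⟨-, h'⟩
  have e : (0 : Fin (n + 1)) - 1 = Fin.last n := by rw [sub_eq_iff_eq_add, Fin.last_add_one]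
  have h2 := h 0
  have h3 := h' 0
  simp only [e, h1] at h2
  rw [h0] at h3
  exact lt_asymm h2.2 h3

theorem isOpen_inRange (X : Letter) : IsOpen {z : ℝ | X.InRange z} := by
  cases X
  · exact isOpen_Ioi
  · exact isOpen_Ioo

/-- A connected set of all points with a given sign pattern is a component. -/
theorem connectedComponentIn_eq_patternSet (s : ℤˣ) {σ : Fin (n + 1) → Letter}
    (hc : IsPreconnected (patternSet w s σ)) {z : Fin (n + 1) → ℝ} (hz : z ∈ patternSet w s σ) :
    connectedComponentIn (monodromyTriangulation w s).realDeformationVariety z =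
      patternSet w s σ := by
  refine subset_antisymm ?_ (hc.subset_connectedComponentIn hz fun y hy => hy.1)
  have hsub := connectedComponentIn_subset
    (monodromyTriangulation w s).realDeformationVariety z
  suffices h : connectedComponentIn (monodromyTriangulation w s).realDeformationVariety z ⊆
      {y | ∀ j, (σ j).InRange (y j)} from fun y hy => ⟨hsub hy, h hy⟩
  -- Once `0` and `1` are excluded, failing to lie in the range of a letter is an open condition
  -- too.
  let O : Letter → Set ℝ
    | .R => Set.Iio 1
    | .L => Set.Iio 0 ∪ Set.Ioi 1
  have hO : ∀ X, IsOpen (O X) := by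
    intro X
    cases X
    · exact isOpen_Iio
    · exact isOpen_Iio.union isOpen_Ioi
  have hOd : ∀ X y, y ∈ O X → ¬ Letter.InRange X y := by
    intro X y hy h
    cases X
    · exact lt_asymm h hy
    · rcases hy with hy | hy
      · exact lt_asymm h.1 hy
      · exact lt_asymm h.2 hy
  have hOc : ∀ X y, y ≠ 0 → y ≠ 1 → ¬ Letter.InRange X y → y ∈ O X := by
    intro X y hy0 hy1 h
    cases X
    · exact lt_of_le_of_ne (not_lt.1 h) hy1
    · rcases lt_or_gt_of_ne hy0 with h0 | h0
      · exact Or.inl h0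
      · exact Or.inr (lt_of_le_of_ne (not_lt.1 fun h1 => h ⟨h0, h1⟩) hy1.symm)
  refine IsPreconnected.subset_left_of_subset_union (v := {y | ∃ j, y j ∈ O (σ j)}) ?_ ?_ ?_ ?_
    ⟨z, mem_connectedComponentIn hz.1, hz.2⟩ isPreconnected_connectedComponentIn
  · rw [Set.ofPred_forall]
    refine isOpen_iInter_of_finite fun j => ?_
    exact IsOpen.preimage (f := fun y : Fin (n + 1) → ℝ => y j) (continuous_apply j)
      (isOpen_inRange (σ j))
  · rw [Set.ofPred_exists]
    refine isOpen_iUnion fun j => ?_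
    exact IsOpen.preimage (f := fun y : Fin (n + 1) → ℝ => y j) (continuous_apply j) (hO (σ j))
  · rw [Set.disjoint_left]
    rintro y hy ⟨j, hj⟩
    exact hOd _ _ hj (hy j)
  · intro y hy
    by_cases h : ∀ j, (σ j).InRange (y j)
    · exact Or.inl h
    · push Not at h
      obtain ⟨j, hj⟩ := h
      have := (hsub hy).1 j
      exact Or.inr ⟨j, hOc _ _ this.1 this.2 hj⟩

/-- The points with the sign pattern of a chart are those with solutions as coordinates. -/
theorem ShapeChart.image_solutions {B : BalancedSystem n} (C : ShapeChart w B) (s : ℤˣ)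
    (hR : ∃ i, w i = .R) (hL : ∃ i, w i = .L) {σ : Fin (n + 1) → Letter}
    (hσ : Function.Bijective fun j => last w (σ j) j)
    (hC : ∀ j z, (σ j).InRange z ↔ ∃ x, C.coord j x = z) :
    C.shape '' B.solutions = patternSet w s σ := by
  have hin : ∀ x j, (σ j).InRange (C.shape x j) := fun x j => (hC j _).2 ⟨_, rfl⟩
  ext z
  constructor
  · rintro ⟨x, hx, rfl⟩
    refine ⟨(mem_realDeformationVariety_iff s hR hL (hin x)).2 ⟨fun k => ?_, hσ⟩, hin x⟩
    obtain ⟨i, rfl⟩ := C.edge_surjective k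
    have := C.logHol_eq x i
    rw [hx, mul_zero] at this
    exact this
  · rintro ⟨hz, hzσ⟩
    choose x hx using fun j => (hC j _).1 (hzσ j)
    have e : C.shape (fun i => x (C.index.symm i)) = z := by
      ext j
      simp [ShapeChart.shape, hx]
    refine ⟨_, fun i => ?_, e⟩
    have h1 := C.logHol_eq (fun i => x (C.index.symm i)) i
    have h2 : logHol w (C.shape fun i => x (C.index.symm i)) (C.edge i) = 0 := by
      rw [e]
      exact ((mem_realDeformationVariety_iff s hR hL hzσ).1 hz).1 _
    exact (mul_eq_zero.1 (h1.symm.trans h2)).resolve_left C.sgn_ne_zero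

theorem image_plusChart (s : ℤˣ) (h0 : w 0 = .R) (h1 : w (Fin.last n) = .L) :
    (plusChart h0 h1).shape '' (wordSystem w ⟨_, h0⟩ ⟨_, h1⟩).solutions =
      patternSet w s fun j => w (j - 1) :=
  (plusChart h0 h1).image_solutions s ⟨_, h0⟩ ⟨_, h1⟩ bijective_last_pred
    fun _ _ => Letter.inRange_iff _ _

theorem image_minusChart (s : ℤˣ) (h0 : w 0 = .R) (h1 : w (Fin.last n) = .L) :
    (minusChart h0 h1).shape '' (wordSystem (rev w) ⟨_, rev_zero h1⟩ ⟨_, rev_last h0⟩).solutions =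
      patternSet w s w :=
  (minusChart h0 h1).image_solutions s ⟨_, h0⟩ ⟨_, h1⟩ bijective_last_self fun j z => by
    rw [Letter.inRange_iff]
    exact ⟨fun ⟨x, hx⟩ => ⟨-x, by simpa [minusChart] using hx⟩, fun ⟨x, hx⟩ => ⟨-x, hx⟩⟩

end Patterns

/-! ### The projection shapes -/

section Projection

variable {n : ℕ} {w : Fin (n + 1) → Letter}

/-- The edge equations hold if the partial products of the parameters around the edges are given by
functions of the layers. -/
theorem logHol_eq_zero_of_layers (hR : ∃ i, w i = .R) (hL : ∃ i, w i = .L)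
    {z a b d : Fin (n + 1) → ℝ} (hd : ∀ j, Real.log (z j) = -d j)
    (h1 : ∀ j, w j = .R → a (j + 1) = Real.log (z j) ∧ b (j + 1) = b j + logHor (z j) ∧
      d (j + 1) = a j + logVert (z j))
    (h2 : ∀ j, w j = .L → b (j + 1) = Real.log (z j) ∧ a (j + 1) = a j + logVert (z j) ∧
      d (j + 1) = b j + logHor (z j)) (k : Fin (n + 1)) : logHol w z k = 0 := by
  -- The partial logarithmic product around edge `k` below tetrahedron `j`. Each tetrahedron
  -- contributes a difference of consecutive values, and such differences cancel around the cycle.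
  set f : Fin (n + 1) → ℝ := fun j => (if bot w j = k then d j else 0) +
    (if last w .R j = k then a j else 0) + (if last w .L j = k then b j else 0) with hf
  have e : ∀ j, ((if j = k then Real.log (z j) else 0) +
      (if bot w j = k then Real.log (z j) else 0) +
      (if last w .R j = k then logVert (z j) else 0) +
      (if last w .L j = k then logHor (z j) else 0)) = f (j + 1) - f j := by
    intro j
    simp only [hf, bot_succ]
    rcases hj : w j with _ | _
    · obtain ⟨e1, e2, e3⟩ := h1 j hj
      simp only [e1, e2, e3, last_succ_of_eq hj,
        last_succ_of_ne hL (j := j) (X := .L) (by simp [hj]), hd j]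
      split_ifs <;> ring
    · obtain ⟨e1, e2, e3⟩ := h2 j hj
      simp only [e1, e2, e3, last_succ_of_eq hj,
        last_succ_of_ne hR (j := j) (X := .R) (by simp [hj]), hd j]
      split_ifs <;> ring
  rw [logHol, Finset.sum_congr rfl fun j _ => e j, Finset.sum_sub_distrib,
    sub_eq_zero]
  exact Equiv.sum_comp (Equiv.addRight (1 : Fin (n + 1))) f

/-- Here `h`, `v` are the values of a form on the two sides of the parallelogram, and `v + h`, `v -
h` those on its diagonals. The factor `c` absorbs the eigenvalue at the seam; quotients do not see
it. All partial products are quotients of such squares. -/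
theorem logHol_sq_ratio (hR : ∃ i, w i = .R) (hL : ∃ i, w i = .L) {h v c : Fin (n + 1) → ℝ}
    (hh : ∀ j, h j ≠ 0) (hv : ∀ j, v j ≠ 0) (hs : ∀ j, v j + h j ≠ 0) (hd : ∀ j, v j - h j ≠ 0)
    (hc : ∀ j, c j ≠ 0)
    (h1 : ∀ j, w j = .R → h (j + 1) = c j * h j ∧ v (j + 1) = c j * (v j + h j))
    (h2 : ∀ j, w j = .L → h (j + 1) = c j * (v j + h j) ∧ v (j + 1) = c j * v j)
    (k : Fin (n + 1)) : logHol w (fun j => (v j / h j) ^ 2) k = 0 := by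
  have hZ : ∀ j, Real.log ((v j / h j) ^ 2) = 2 * Real.log (v j) - 2 * Real.log (h j) := by
    intro j
    rw [Real.log_pow, Real.log_div (hv j) (hh j)]
    push_cast; ring
  have h1z : ∀ j, Real.log (1 - (v j / h j) ^ 2) =
      Real.log (v j - h j) + Real.log (v j + h j) - 2 * Real.log (h j) := by
    intro j
    have e : 1 - (v j / h j) ^ 2 = -((v j - h j) * (v j + h j) / h j ^ 2) := by
      have := hh j
      field_simp
      ring
    rw [e, Real.log_neg_eq_log, Real.log_div (mul_ne_zero (hd j) (hs j)) (pow_ne_zero 2 (hh j)),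
      Real.log_mul (hd j) (hs j), Real.log_pow]
    push_cast; ring
  refine logHol_eq_zero_of_layers hR hL
    (a := fun j => 2 * Real.log (v j - h j) - 2 * Real.log (h j))
    (b := fun j => 2 * Real.log (v j) - 2 * Real.log (v j - h j))
    (d := fun j => 2 * Real.log (h j) - 2 * Real.log (v j)) ?_ ?_ ?_ k
  · intro j
    rw [hZ]; ring
  · intro j hj
    obtain ⟨e1, e2⟩ := h1 j hj
    have e3 : v (j + 1) - h (j + 1) = c j * v j := by rw [e1, e2]; ring
    simp only [logVert, logHor, hZ, h1z]
    rw [e3, e1, e2, Real.log_mul (hc j) (hh j), Real.log_mul (hc j) (hv j),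
      Real.log_mul (hc j) (hs j)]
    refine ⟨?_, ?_, ?_⟩ <;> ring
  · intro j hj
    obtain ⟨e1, e2⟩ := h2 j hj
    have e3 : v (j + 1) - h (j + 1) = -(c j * h j) := by rw [e1, e2]; ring
    simp only [logVert, logHor, hZ, h1z]
    rw [e3, e1, e2, Real.log_neg_eq_log, Real.log_mul (hc j) (hh j), Real.log_mul (hc j) (hv j),
      Real.log_mul (hc j) (hs j)]
    refine ⟨?_, ?_, ?_⟩ <;> ring

/-! ### Prefix matrices and eigenforms -/

theorem prefixMat_zero : prefixMat w 0 = 1 := by simp [prefixMat]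

theorem prefixMat_succ (k : Fin (n + 1)) :
    prefixMat w (k + 1) = prefixMat w k * (w k).mat := by
  have h : (k : ℕ) < (List.ofFn fun i => (w i).mat).length := by
    rw [List.length_ofFn]
    exact k.2
  rw [prefixMat, prefixMat, List.prod_take_succ _ _ h, List.getElem_ofFn]

/-- The prefix matrices are non-negative, with positive diagonal. -/
theorem prefixMat_nonneg (k : ℕ) (hk : k ≤ n + 1) : 1 ≤ prefixMat w k 0 0 ∧ 0 ≤ prefixMat w k 0 1 ∧
    0 ≤ prefixMat w k 1 0 ∧ 1 ≤ prefixMat w k 1 1 := by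
  induction k with
  | zero => simp [prefixMat_zero]
  | succ k ih =>
    obtain ⟨h1, h2, h3, h4⟩ := ih (by omega)
    have e := prefixMat_succ (w := w) ⟨k, by omega⟩
    simp only at e
    rw [e]
    rcases w ⟨k, by omega⟩ with _ | _ <;>
    · simp [Letter.mat, Matrix.mul_apply, Fin.sum_univ_two]
      omega

theorem one_le_prefixMat_zero_one (h0 : w 0 = .R) (k : ℕ) (hk : k + 1 ≤ n + 1) :
    1 ≤ prefixMat w (k + 1) 0 1 := by
  induction k with
  | zero =>
    have e := prefixMat_succ (w := w) 0
    simp only [Fin.val_zero] at e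
    rw [e, prefixMat_zero, h0]
    simp [Letter.mat]
  | succ k ih =>
    have h := ih (by omega)
    obtain ⟨h1, -, -, -⟩ := prefixMat_nonneg (w := w) (k + 1) (by omega)
    have e := prefixMat_succ (w := w) ⟨k + 1, by omega⟩
    simp only at e
    rw [e]
    rcases w ⟨k + 1, by omega⟩ with _ | _ <;>
    · simp [Letter.mat, Matrix.mul_apply, Fin.sum_univ_two]
      omega

theorem one_le_wordMat_one_zero (h1 : w (Fin.last n) = .L) : 1 ≤ wordMat w 1 0 := by
  obtain ⟨-, -, h3, h4⟩ := prefixMat_nonneg (w := w) n (by omega)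
  have e := prefixMat_succ (w := w) (Fin.last n)
  simp only [Fin.val_last] at e
  rw [wordMat, e, h1]
  simp [Letter.mat, Matrix.mul_apply, Fin.sum_univ_two]
  omega

theorem Letter.det_mat (X : Letter) : X.mat.det = 1 := by
  cases X <;> simp [Letter.mat, Matrix.det_fin_two]

theorem det_wordMat : (wordMat w).det = 1 := by
  suffices ∀ k ≤ n + 1, (prefixMat w k).det = 1 from this _ le_rfl
  intro k hk
  induction k with
  | zero => simp [prefixMat_zero]
  | succ k ih =>
    have e := prefixMat_succ (w := w) ⟨k, by omega⟩
    simp only at e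
    rw [e, Matrix.det_mul, ih (by omega), Letter.det_mat, one_mul]

variable (w) in
/-- The values of the linear form with coefficients `x` and `y` on the first column of the prefix
matrices. -/
def horValue (x y : ℝ) (k : ℕ) : ℝ := x * prefixMat w k 0 0 + y * prefixMat w k 1 0

variable (w) in
/-- The values of the linear form with coefficients `x` and `y` on the second column of the prefix
matrices. -/
def vertValue (x y : ℝ) (k : ℕ) : ℝ := x * prefixMat w k 0 1 + y * prefixMat w k 1 1

theorem values_succ_R (x y : ℝ) {k : Fin (n + 1)} (hk : w k = .R) :
    horValue w x y (k + 1) = horValue w x y k ∧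
      vertValue w x y (k + 1) = vertValue w x y k + horValue w x y k := by
  simp only [horValue, vertValue, prefixMat_succ, hk]
  constructor <;> simp [Letter.mat, Matrix.mul_apply, Fin.sum_univ_two]
  ring

theorem values_succ_L (x y : ℝ) {k : Fin (n + 1)} (hk : w k = .L) :
    horValue w x y (k + 1) = vertValue w x y k + horValue w x y k ∧
      vertValue w x y (k + 1) = vertValue w x y k := by
  simp only [horValue, vertValue, prefixMat_succ, hk]
  constructor <;> simp [Letter.mat, Matrix.mul_apply, Fin.sum_univ_two]
  ring

/-- The linear form with coefficients `x` and `y` is multiplied by `μ` by the word. -/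
def IsEigenform (w : Fin (n + 1) → Letter) (μ x y : ℝ) : Prop :=
  horValue w x y (n + 1) = μ * x ∧ vertValue w x y (n + 1) = μ * y

theorem values_zero (x y : ℝ) : horValue w x y 0 = x ∧ vertValue w x y 0 = y := by
  simp [horValue, vertValue, prefixMat_zero]

theorem isProjectionShape_sq_ratio {μ x y : ℝ} (hx : x ≠ 0) (h : IsEigenform w μ x y)
    (hh : ∀ k : Fin (n + 1), horValue w x y k ≠ 0) :
    IsProjectionShape w μ fun k => (vertValue w x y k / horValue w x y k) ^ 2 := by
  refine ⟨x • LinearMap.proj 0 + y • LinearMap.proj 1, fun h0 => hx ?_, fun v => ?_, fun k => ?_⟩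
  · have := congrArg (fun r : (Fin 2 → ℝ) →ₗ[ℝ] ℝ => r ![1, 0]) h0
    simpa using this
  · obtain ⟨h1, h2⟩ := h
    simp only [horValue, vertValue] at h1 h2
    simp [wordMat]
    linear_combination v 0 * h1 + v 1 * h2
  · have hk := hh k
    intro p
    have p0 : p 0 = 0 := by simp [p, corner, Matrix.mulVec, dotProduct, Fin.sum_univ_two]
    have p1 : p 1 = horValue w x y k + vertValue w x y k := by
      simp [p, corner, Matrix.mulVec, dotProduct, Fin.sum_univ_two, horValue, vertValue]
      ring
    have p2 : p 2 = vertValue w x y k := by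
      simp [p, corner, Matrix.mulVec, dotProduct, Fin.sum_univ_two, vertValue]
    have p3 : p 3 = horValue w x y k := by
      simp [p, corner, Matrix.mulVec, dotProduct, Fin.sum_univ_two, horValue]
    rw [p0, p1, p2, p3, crossRatio]
    have e1 : horValue w x y k - (horValue w x y k + vertValue w x y k) = -vertValue w x y k := by
      ring
    have e2 : vertValue w x y k - (horValue w x y k + vertValue w x y k) = -horValue w x y k := by
      ring
    rw [e1, e2]
    field_simp
    ring

/-- The values of an eigenform on consecutive frames, in cyclic order. -/
theorem values_cyclic {μ x y : ℝ} (hμ : 0 < μ) (h : IsEigenform w μ x y) :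
    ∃ c : Fin (n + 1) → ℝ, (∀ j, 0 < c j) ∧ ∀ j : Fin (n + 1),
      horValue w x y (j + 1 : Fin (n + 1)) = c j * horValue w x y ((j : ℕ) + 1) ∧
      vertValue w x y (j + 1 : Fin (n + 1)) = c j * vertValue w x y ((j : ℕ) + 1) := by
  refine ⟨fun j => if j = Fin.last n then μ⁻¹ else 1, fun j => ?_, fun j => ?_⟩
  · dsimp only
    split_ifs
    · exact inv_pos.2 hμ
    · exact one_pos
  · rw [Fin.val_add_one j]
    dsimp only
    by_cases hj : j = Fin.last n
    · rw [if_pos hj, if_pos hj, hj, Fin.val_last, h.1, h.2, (values_zero x y).1,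
        (values_zero x y).2]
      constructor <;> field_simp
    · rw [if_neg hj, if_neg hj, one_mul, one_mul]
      exact ⟨rfl, rfl⟩

/-- A form with positive coefficients stays positive on both sides of all later parallelograms. The
last letter decides which side value was increased by the other, hence whether the quotient exceeds
`1`. -/
theorem exists_plus_shape (s : ℤˣ) (h0 : w 0 = .R) (h1 : w (Fin.last n) = .L) {μ x y : ℝ}
    (hμ : 0 < μ) (hx : 0 < x) (hy : 0 < y) (h : IsEigenform w μ x y) :
    ∃ z ∈ patternSet w s fun j => w (j - 1), IsProjectionShape w μ z := by
  obtain ⟨c, hc, hcyc⟩ := values_cyclic hμ h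
  have hpos : ∀ k ≤ n + 1, 0 < horValue w x y k ∧ 0 < vertValue w x y k := by
    intro k hk
    induction k with
    | zero => rw [(values_zero x y).1, (values_zero x y).2]; exact ⟨hx, hy⟩
    | succ k ih =>
      obtain ⟨i1, i2⟩ := ih (by omega)
      rcases hw : w ⟨k, by omega⟩ with _ | _
      · have e := values_succ_R x y hw
        simp only at e
        rw [e.1, e.2]
        exact ⟨i1, add_pos i2 i1⟩
      · have e := values_succ_L x y hw
        simp only at e
        rw [e.1, e.2]
        exact ⟨add_pos i2 i1, i2⟩
  have hH : ∀ k : Fin (n + 1), 0 < horValue w x y k := fun k => (hpos k (by omega)).1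
  have hV : ∀ k : Fin (n + 1), 0 < vertValue w x y k := fun k => (hpos k (by omega)).2
  have hin : ∀ j : Fin (n + 1),
      (w (j - 1)).InRange ((vertValue w x y j / horValue w x y j) ^ 2) := by
    intro j
    obtain ⟨i, rfl⟩ : ∃ i, j = i + 1 := ⟨j - 1, by simp⟩
    have i1 := hH (i + 1)
    have i2 := hV (i + 1)
    rw [add_sub_cancel_right]
    rcases hw : w i with _ | _
    · have e := values_succ_R x y hw
      change 1 < _
      rw [one_lt_sq_iff₀ (div_pos i2 i1).le, one_lt_div i1, (hcyc i).1, (hcyc i).2, e.1, e.2]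
      exact mul_lt_mul_of_pos_left (by linarith [hV i]) (hc i)
    · have e := values_succ_L x y hw
      refine ⟨by positivity, ?_⟩
      rw [sq_lt_one_iff₀ (div_pos i2 i1).le, div_lt_one i1, (hcyc i).1, (hcyc i).2, e.1, e.2]
      exact mul_lt_mul_of_pos_left (by linarith [hH i]) (hc i)
  refine ⟨_, ⟨(mem_realDeformationVariety_iff s ⟨_, h0⟩ ⟨_, h1⟩ hin).2
    ⟨?_, bijective_last_pred⟩, hin⟩, isProjectionShape_sq_ratio hx.ne' h fun k => (hH k).ne'⟩
  refine logHol_sq_ratio (h := fun j => horValue w x y j) (v := fun j => vertValue w x y j)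
    ⟨_, h0⟩ ⟨_, h1⟩ (fun j => (hH j).ne') (fun j => (hV j).ne')
    (fun j => (add_pos (hV j) (hH j)).ne') (fun j hj => ?_) (fun j => (hc j).ne') ?_ ?_
  · refine (hin j).ne_one ?_
    rw [sub_eq_zero.1 hj, div_self (hH j).ne', one_pow]
  · intro j hj
    have e := values_succ_R x y hj
    exact ⟨by rw [(hcyc j).1, e.1], by rw [(hcyc j).2, e.2]⟩
  · intro j hj
    have e := values_succ_L x y hj
    exact ⟨by rw [(hcyc j).1, e.1], by rw [(hcyc j).2, e.2]⟩

/-- Opposite signs propagate downwards instead, so the induction starts from the full word, where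
the eigenform property supplies the signs. -/
theorem exists_minus_shape (s : ℤˣ) (h0 : w 0 = .R) (h1 : w (Fin.last n) = .L) {μ x y : ℝ}
    (hμ : 0 < μ) (hx : 0 < x) (hy : y < 0) (h : IsEigenform w μ x y) :
    ∃ z ∈ patternSet w s w, IsProjectionShape w μ z := by
  obtain ⟨c, hc, hcyc⟩ := values_cyclic hμ h
  have hsign : ∀ d ≤ n + 1,
      0 < horValue w x y (n + 1 - d) ∧ vertValue w x y (n + 1 - d) < 0 := by
    intro d hd
    induction d with
    | zero =>
      rw [Nat.sub_zero, h.1, h.2]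
      exact ⟨mul_pos hμ hx, mul_neg_of_pos_of_neg hμ hy⟩
    | succ d ih =>
      obtain ⟨i1, i2⟩ := ih (by omega)
      have ek : n + 1 - d = n - d + 1 := by omega
      have ek' : n + 1 - (d + 1) = n - d := by omega
      rw [ek] at i1 i2
      rw [ek']
      rcases hw : w ⟨n - d, by omega⟩ with _ | _
      · have e := values_succ_R x y hw
        simp only at e
        rw [e.1] at i1
        rw [e.2] at i2
        exact ⟨i1, by linarith⟩
      · have e := values_succ_L x y hw
        simp only at e
        rw [e.1] at i1
        rw [e.2] at i2
        exact ⟨by linarith, i2⟩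
  have hsign' : ∀ k : Fin (n + 1), 0 < horValue w x y k ∧ vertValue w x y k < 0 := by
    intro k
    have := hsign (n + 1 - k) (by omega)
    rwa [Nat.sub_sub_self (by omega)] at this
  have hH : ∀ k : Fin (n + 1), 0 < horValue w x y k := fun k => (hsign' k).1
  have hV : ∀ k : Fin (n + 1), vertValue w x y k < 0 := fun k => (hsign' k).2
  -- The next letter replaces one side by the diagonal; that signs persist in the next frame fixes
  -- the sign of the form on the diagonal.
  have hsum : ∀ k : Fin (n + 1), (w k = .R ∧ vertValue w x y k + horValue w x y k < 0) ∨
      (w k = .L ∧ 0 < vertValue w x y k + horValue w x y k) := by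
    intro k
    rcases hw : w k with _ | _
    · have e := (values_succ_R x y hw).2
      have i := hV (k + 1)
      rw [(hcyc k).2, e] at i
      exact Or.inl ⟨rfl, (pos_iff_neg_of_mul_neg i).1 (hc k)⟩
    · have e := (values_succ_L x y hw).1
      have i := hH (k + 1)
      rw [(hcyc k).1, e] at i
      exact Or.inr ⟨rfl, (mul_pos_iff_of_pos_left (hc k)).1 i⟩
  have hin : ∀ j : Fin (n + 1), (w j).InRange ((vertValue w x y j / horValue w x y j) ^ 2) := by
    intro j
    have i1 := hH j
    have i2 := hV j
    rcases hsum j with ⟨hw, i3⟩ | ⟨hw, i3⟩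
    · rw [hw]
      change 1 < _
      rw [div_pow, one_lt_div (by positivity)]
      nlinarith
    · rw [hw]
      have i4 := i2.ne
      refine ⟨by positivity, ?_⟩
      rw [div_pow, div_lt_one (by positivity)]
      nlinarith
  refine ⟨_, ⟨(mem_realDeformationVariety_iff s ⟨_, h0⟩ ⟨_, h1⟩ hin).2
    ⟨?_, bijective_last_self⟩, hin⟩, isProjectionShape_sq_ratio hx.ne' h fun k => (hH k).ne'⟩
  refine logHol_sq_ratio (h := fun j => horValue w x y j) (v := fun j => vertValue w x y j)
    ⟨_, h0⟩ ⟨_, h1⟩ (fun j => (hH j).ne') (fun j => (hV j).ne) (fun j => ?_)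
    (fun j => (sub_neg.2 ((hV j).trans (hH j))).ne) (fun j => (hc j).ne') ?_ ?_
  · rcases hsum j with ⟨-, i⟩ | ⟨-, i⟩
    · exact i.ne
    · exact i.ne'
  · intro j hj
    have e := values_succ_R x y hj
    exact ⟨by rw [(hcyc j).1, e.1], by rw [(hcyc j).2, e.2]⟩
  · intro j hj
    have e := values_succ_L x y hj
    exact ⟨by rw [(hcyc j).1, e.1], by rw [(hcyc j).2, e.2]⟩

/-- With entries `a`, `b`, `c`, `d` of the word matrix, the row vector `(c, μ - a)` is an eigenform.
As `b * c > 0`, the root `q` of the discriminant exceeds `|a - d|`, so `μ - a` has opposite signs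
for the two eigenvalues. -/
theorem exists_eigenforms (h0 : w 0 = .R) (h1 : w (Fin.last n) = .L) :
    (∃ μ x y : ℝ, 1 < μ ∧ 0 < x ∧ 0 < y ∧ IsEigenform w μ x y) ∧
      ∃ μ x y : ℝ, 0 < μ ∧ μ < 1 ∧ 0 < x ∧ y < 0 ∧ IsEigenform w μ x y := by
  obtain ⟨ha, -, -, hd⟩ := prefixMat_nonneg (w := w) (n + 1) le_rfl
  have hb := one_le_prefixMat_zero_one h0 n le_rfl
  have hc := one_le_wordMat_one_zero h1
  have hdet := det_wordMat (w := w)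
  rw [Matrix.det_fin_two] at hdet
  simp only [wordMat] at hdet hc
  simp only [IsEigenform, horValue, vertValue]
  generalize prefixMat w (n + 1) = M at *
  have ha' : (1 : ℝ) ≤ M 0 0 := by exact_mod_cast ha
  have hb' : (1 : ℝ) ≤ M 0 1 := by exact_mod_cast hb
  have hc' : (1 : ℝ) ≤ M 1 0 := by exact_mod_cast hc
  have hd' : (1 : ℝ) ≤ M 1 1 := by exact_mod_cast hd
  have hdet' : (M 0 0 : ℝ) * M 1 1 - M 0 1 * M 1 0 = 1 := by exact_mod_cast hdet
  generalize (M 0 0 : ℝ) = a at *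
  generalize (M 0 1 : ℝ) = b at *
  generalize (M 1 0 : ℝ) = c at *
  generalize (M 1 1 : ℝ) = d at *
  set q := Real.sqrt ((a + d) ^ 2 - 4) with hq
  have hbc : 1 ≤ b * c := by nlinarith
  have hD : (a + d) ^ 2 - 4 = (a - d) ^ 2 + 4 * (b * c) := by linear_combination 4 * hdet'
  have hDpos : 0 < (a + d) ^ 2 - 4 := by rw [hD]; positivity
  have hq2 : q ^ 2 = (a + d) ^ 2 - 4 := Real.sq_sqrt hDpos.le
  have hqpos : 0 < q := Real.sqrt_pos.2 hDpos
  have hq1 : |a - d| < q := by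
    refine abs_lt_of_sq_lt_sq ?_ hqpos.le
    rw [hq2, hD]
    linarith
  obtain ⟨hq3, hq4⟩ := abs_lt.1 hq1
  have hqlt : q < a + d := by nlinarith
  refine ⟨⟨(a + d + q) / 2, c, (a + d + q) / 2 - a, ?_, by linarith, by linarith, ?_, ?_⟩,
    ⟨(a + d - q) / 2, c, (a + d - q) / 2 - a, by linarith, ?_, by linarith, by linarith, ?_, ?_⟩⟩
  · nlinarith
  · ring
  · linear_combination -hdet' - hq2 / 4
  · nlinarith
  · ring
  · linear_combination -hdet' - hq2 / 4

end Projection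

/-! ### Conjugation of Anosov matrices to words -/

section Conjugation

open Matrix

/-- The transvection of a letter as an element of the special linear group. -/
def Letter.sl (X : Letter) : SpecialLinearGroup (Fin 2) ℤ := ⟨X.mat, X.det_mat⟩

theorem Letter.sl_R : Letter.R.sl 0 0 = 1 ∧ Letter.R.sl 0 1 = 1 ∧ Letter.R.sl 1 0 = 0 ∧
    Letter.R.sl 1 1 = 1 := by
  simp [Letter.sl, Letter.mat]

theorem Letter.sl_L : Letter.L.sl 0 0 = 1 ∧ Letter.L.sl 0 1 = 0 ∧ Letter.L.sl 1 0 = 1 ∧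
    Letter.L.sl 1 1 = 1 := by
  simp [Letter.sl, Letter.mat]

theorem mul_entry (A B : SpecialLinearGroup (Fin 2) ℤ) (i j : Fin 2) :
    (A * B) i j = A i 0 * B 0 j + A i 1 * B 1 j := by
  change (A.1 * B.1) i j = _
  rw [mul_apply, Fin.sum_univ_two]

theorem inv_entries (A : SpecialLinearGroup (Fin 2) ℤ) :
    A⁻¹ 0 0 = A 1 1 ∧ A⁻¹ 0 1 = -A 0 1 ∧ A⁻¹ 1 0 = -A 1 0 ∧ A⁻¹ 1 1 = A 0 0 := by
  simp [adjugate_fin_two]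

/-- The eigenvalues are distinct real roots of the characteristic polynomial, so its discriminant is
positive. -/
theorem sq_trace_of_isAnosov {φ : SpecialLinearGroup (Fin 2) ℤ} (hφ : IsAnosov φ) :
    4 < (φ 0 0 + φ 1 1) ^ 2 := by
  obtain ⟨a, b, hab, ha, hb⟩ := hφ
  have hdet : ((φ 0 0 : ℤ) : ℝ) * φ 1 1 - φ 0 1 * φ 1 0 = 1 := by
    have := φ.2
    rw [det_fin_two] at this
    exact_mod_cast this
  have key : ∀ c : ℝ, Module.End.HasEigenvalue (toLin' (φ.1.map (Int.cast : ℤ → ℝ))) c →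
      c ^ 2 - (φ 0 0 + φ 1 1 : ℝ) * c + 1 = 0 := by
    intro c hc
    obtain ⟨v, hv⟩ := hc.exists_hasEigenvector
    have h := hv.apply_eq_smul
    have e0 := congrFun h 0
    have e1 := congrFun h 1
    simp only [toLin'_apply, mulVec, dotProduct, Fin.sum_univ_two, map_apply, Pi.smul_apply,
      smul_eq_mul] at e0 e1
    by_contra hne
    refine hv.2 (funext fun i => ?_)
    have h0 : (c ^ 2 - (φ 0 0 + φ 1 1 : ℝ) * c + 1) * v 0 = 0 := by
      linear_combination (((φ 1 1 : ℤ) : ℝ) - c) * e0 - ((φ 0 1 : ℤ) : ℝ) * e1 - v 0 * hdet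
    have h1 : (c ^ 2 - (φ 0 0 + φ 1 1 : ℝ) * c + 1) * v 1 = 0 := by
      linear_combination (((φ 0 0 : ℤ) : ℝ) - c) * e1 - ((φ 1 0 : ℤ) : ℝ) * e0 - v 1 * hdet
    fin_cases i
    · exact (mul_eq_zero.1 h0).resolve_left hne
    · exact (mul_eq_zero.1 h1).resolve_left hne
  have ka := key a ha
  have kb := key b hb
  have hs : (φ 0 0 + φ 1 1 : ℝ) = a + b := by
    have := sub_ne_zero.2 hab
    refine mul_left_cancel₀ this ?_
    linear_combination kb - ka
  have : (4 : ℝ) < (φ 0 0 + φ 1 1 : ℝ) ^ 2 := by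
    have h2 : 0 < (a - b) ^ 2 := by
      have := sub_ne_zero.2 hab
      positivity
    rw [hs] at ka ⊢
    nlinarith
  exact_mod_cast this

theorem det_entries (φ : SpecialLinearGroup (Fin 2) ℤ) : φ 0 0 * φ 1 1 - φ 0 1 * φ 1 0 = 1 := by
  have := φ.2
  rwa [det_fin_two] at this

/-- Whichever of `b`, `c` has the smaller absolute value has square at most `-(b * c)`, so its
double is smaller than `|e|` in absolute value and can be added or subtracted to bring `e` closer to
zero. -/
theorem exists_abs_lt {e b c : ℤ} (hbc : b * c < 0) (h : 0 < e ^ 2 + 4 * (b * c)) :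
    |e + 2 * c| < |e| ∨ |e - 2 * c| < |e| ∨ |e - 2 * b| < |e| ∨ |e + 2 * b| < |e| := by
  have key : ∀ x : ℤ, x ≠ 0 → 4 * x ^ 2 < e ^ 2 → |e + 2 * x| < |e| ∨ |e - 2 * x| < |e| := by
    intro x hx hlt
    have h1 : |2 * x| < |e| := sq_lt_sq.1 (by linarith [mul_pow 2 x 2])
    rcases abs_cases (2 * x) with h2 | h2 <;> rcases abs_cases e with h3 | h3 <;>
    rcases abs_cases (e + 2 * x) with h4 | h4 <;> rcases abs_cases (e - 2 * x) with h5 | h5 <;>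
    omega
  have hb : b ≠ 0 := by rintro rfl; simp at hbc
  have hc : c ≠ 0 := by rintro rfl; simp at hbc
  by_cases hle : |b| ≤ |c|
  · have h1 : b ^ 2 ≤ -(b * c) := by
      rw [← abs_of_neg hbc, abs_mul, ← sq_abs, sq]
      exact mul_le_mul_of_nonneg_left hle (abs_nonneg b)
    rcases key b hb (by linarith) with h | h <;> simp [h]
  · have h1 : c ^ 2 ≤ -(b * c) := by
      rw [← abs_of_neg hbc, abs_mul, ← sq_abs, sq]
      exact mul_le_mul_of_nonneg_right (not_le.1 hle).le (abs_nonneg c)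
    rcases key c hc (by linarith) with h | h <;> simp [h]

/-- A matrix of trace at least three is conjugate to a non-negative one. -/
theorem exists_conj_nonneg (φ : SpecialLinearGroup (Fin 2) ℤ) (ht : 2 < φ 0 0 + φ 1 1) :
    ∃ A : SpecialLinearGroup (Fin 2) ℤ, ∀ i j, 0 ≤ (A * φ * A⁻¹) i j := by
  induction hm : (φ 0 0 - φ 1 1).natAbs using Nat.strong_induction_on generalizing φ with
  | _ m ih =>
    have hdet := det_entries φ
    have step : ∀ A : SpecialLinearGroup (Fin 2) ℤ,
        (A * φ * A⁻¹) 0 0 + (A * φ * A⁻¹) 1 1 = φ 0 0 + φ 1 1 →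
        |(A * φ * A⁻¹) 0 0 - (A * φ * A⁻¹) 1 1| < |φ 0 0 - φ 1 1| →
        ∃ A : SpecialLinearGroup (Fin 2) ℤ, ∀ i j, 0 ≤ (A * φ * A⁻¹) i j := by
      intro A h1 h2
      obtain ⟨B, hB⟩ := ih _ (by rw [← hm]; zify; exact h2) (A * φ * A⁻¹) (by omega) rfl
      refine ⟨B * A, ?_⟩
      have e : B * A * φ * (B * A)⁻¹ = B * (A * φ * A⁻¹) * B⁻¹ := by group
      rwa [e]
    by_cases hbc : φ 0 1 * φ 1 0 < 0
    -- The expression is the discriminant, the squared trace minus `4`. Conjugation by a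
    -- transvection or its inverse then decreases the difference of the diagonal entries.
    · have hd : 0 < (φ 0 0 - φ 1 1) ^ 2 + 4 * (φ 0 1 * φ 1 0) := by nlinarith
      rcases exists_abs_lt hbc hd with h | h | h | h
      · refine step Letter.R.sl ?_ (lt_of_eq_of_lt (congrArg _ ?_) h) <;>
        · simp only [mul_entry, inv_entries, Letter.sl_R]
          ring
      · refine step Letter.R.sl⁻¹ ?_ (lt_of_eq_of_lt (congrArg _ ?_) h) <;>
        · simp only [mul_entry, inv_entries, Letter.sl_R]
          ring
      · refine step Letter.L.sl ?_ (lt_of_eq_of_lt (congrArg _ ?_) h) <;>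
        · simp only [mul_entry, inv_entries, Letter.sl_L]
          ring
      · refine step Letter.L.sl⁻¹ ?_ (lt_of_eq_of_lt (congrArg _ ?_) h) <;>
        · simp only [mul_entry, inv_entries, Letter.sl_L]
          ring
    · have had : 0 < φ 0 0 * φ 1 1 := by linarith
      have hpos : 0 < φ 0 0 ∧ 0 < φ 1 1 := by
        rcases mul_pos_iff.1 had with h | h
        · exact h
        · omega
      rcases mul_nonneg_iff.1 (not_lt.1 hbc) with h | h
      · refine ⟨1, ?_⟩
        simp only [one_mul, inv_one, mul_one, Fin.forall_fin_two]
        exact ⟨⟨hpos.1.le, h.1⟩, h.2, hpos.2.le⟩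
      -- This product is the quarter turn; conjugation by it exchanges the diagonal entries, and the
      -- off-diagonal ones up to sign.
      · refine ⟨Letter.R.sl⁻¹ * Letter.L.sl * Letter.R.sl⁻¹, ?_⟩
        simp only [Fin.forall_fin_two, mul_entry, inv_entries, Letter.sl_R, Letter.sl_L]
        omega

/-- A non-negative matrix of determinant one is a product of transvections. -/
theorem exists_list_of_nonneg (φ : SpecialLinearGroup (Fin 2) ℤ) (hφ : ∀ i j, 0 ≤ φ i j) :
    ∃ l : List Letter, (l.map Letter.sl).prod = φ := by
  induction hm : (φ 0 0 + φ 0 1 + φ 1 0 + φ 1 1).toNat using Nat.strong_induction_on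
    generalizing φ with
  | _ m ih =>
    have hdet := det_entries φ
    have ha := hφ 0 0
    have hb := hφ 0 1
    have hc := hφ 1 0
    have hd := hφ 1 1
    have h1 : 0 < φ 0 0 + φ 0 1 := by
      by_contra h
      have e1 : φ 0 0 = 0 := by omega
      have e2 : φ 0 1 = 0 := by omega
      simp [e1, e2] at hdet
    have h2 : 0 < φ 1 0 + φ 1 1 := by
      by_contra h
      have e1 : φ 1 0 = 0 := by omega
      have e2 : φ 1 1 = 0 := by omega
      simp [e1, e2] at hdet
    have step : ∀ X : Letter, (∀ i j, 0 ≤ (X.sl⁻¹ * φ) i j) →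
        (X.sl⁻¹ * φ) 0 0 + (X.sl⁻¹ * φ) 0 1 + (X.sl⁻¹ * φ) 1 0 + (X.sl⁻¹ * φ) 1 1 <
          φ 0 0 + φ 0 1 + φ 1 0 + φ 1 1 → ∃ l : List Letter, (l.map Letter.sl).prod = φ := by
      intro X hX hlt
      obtain ⟨l, hl⟩ := ih _ (by rw [← hm]; omega) (X.sl⁻¹ * φ) hX rfl
      exact ⟨X :: l, by simp [hl]⟩
    rcases le_or_gt (φ 1 0) (φ 0 0) with h | h <;> rcases le_or_gt (φ 1 1) (φ 0 1) with h' | h'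
    · refine step .R ?_ ?_
      · simp only [Fin.forall_fin_two, mul_entry, inv_entries, Letter.sl_R]
        omega
      · simp only [mul_entry, inv_entries, Letter.sl_R]
        omega
    · rcases h.eq_or_lt with h | h
      · refine step .L ?_ ?_
        · simp only [Fin.forall_fin_two, mul_entry, inv_entries, Letter.sl_L]
          omega
        · simp only [mul_entry, inv_entries, Letter.sl_L]
          omega
      -- Neither row dominates the other. The diagonal is then too large for determinant `1`, unless
      -- the matrix is the identity.
      · have hle : (φ 1 0 + 1) * (φ 0 1 + 1) ≤ φ 0 0 * φ 1 1 :=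
          mul_le_mul (by omega) (by omega) (by omega) (by omega)
        have e1 : φ 1 0 = 0 := by nlinarith
        have e2 : φ 0 1 = 0 := by nlinarith
        rw [e1, mul_zero, sub_zero] at hdet
        have e3 := Int.eq_one_of_mul_eq_one_right ha hdet
        have e4 := Int.eq_one_of_mul_eq_one_left hd hdet
        refine ⟨[], ?_⟩
        ext i j
        fin_cases i <;> fin_cases j <;> simp [e1, e2, e3, e4]
    -- This case is vacuous: the two inequalities make the determinant non-positive.
    · refine step .L ?_ ?_
      · simp only [Fin.forall_fin_two, mul_entry, inv_entries, Letter.sl_L]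
        nlinarith
      · simp only [mul_entry, inv_entries, Letter.sl_L]
        omega
    · refine step .L ?_ ?_
      · simp only [Fin.forall_fin_two, mul_entry, inv_entries, Letter.sl_L]
        omega
      · simp only [mul_entry, inv_entries, Letter.sl_L]
        omega

theorem trace_prod_of_forall_eq {X : Letter} {l : List Letter} (h : ∀ Y ∈ l, Y = X) :
    (l.map Letter.sl).prod 0 0 = 1 ∧ (l.map Letter.sl).prod 1 1 = 1 ∧
      (l.map Letter.sl).prod (if X = .R then 1 else 0) (if X = .R then 0 else 1) = 0 := by
  induction l with
  | nil => cases X <;> simp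
  | cons Y l ih =>
    obtain ⟨h1, h2, h3⟩ := ih fun Y hY => h Y (List.mem_cons_of_mem _ hY)
    have hY := h Y List.mem_cons_self
    subst hY
    rw [List.map_cons, List.prod_cons]
    cases Y <;> simp_all [mul_entry, Letter.sl_R, Letter.sl_L]

/-- A word without one of the letters is a power of the other transvection and has trace `2`. -/
theorem mem_of_trace {l : List Letter}
    (ht : 2 < (l.map Letter.sl).prod 0 0 + (l.map Letter.sl).prod 1 1) (X : Letter) : X ∈ l := by
  by_contra hX
  obtain ⟨h1, h2, -⟩ := trace_prod_of_forall_eq (X := X.other) (l := l) fun Y hY => by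
    rcases X with _ | _ <;> rcases Y with _ | _ <;> first | rfl | exact absurd hY hX
  omega

/-- A cyclic word with both letters can be cut after an `L` and before an `R`. -/
theorem exists_rotation {l : List Letter} (hR : Letter.R ∈ l) (hL : Letter.L ∈ l) :
    ∃ p q t u : List Letter, l = p ++ q ∧ q ++ p = Letter.R :: t ∧ q ++ p = u ++ [Letter.L] := by
  obtain ⟨c, d, rfl⟩ := List.append_of_mem hR
  have hm : Letter.L ∈ Letter.R :: (d ++ c) := by
    simp only [List.mem_append, List.mem_cons] at hL ⊢
    tauto
  -- Reversing the list finds the last `L`; behind it there are only letters `R`, and these are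
  -- moved to the front.
  obtain ⟨a, b, hab, ha⟩ := List.eq_append_cons_of_mem (List.mem_reverse.2 hm)
  have e : Letter.R :: (d ++ c) = b.reverse ++ [Letter.L] ++ a.reverse := by
    rw [← List.reverse_reverse (Letter.R :: (d ++ c)), hab]
    simp
  obtain ⟨t, ht⟩ : ∃ t, a.reverse ++ (b.reverse ++ [Letter.L]) = Letter.R :: t := by
    rcases hc : a.reverse with _ | ⟨X, m⟩
    · rw [hc, List.append_nil] at e
      exact ⟨d ++ c, by rw [e, List.nil_append]⟩
    · rcases X with _ | _
      · exact ⟨_, rfl⟩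
      · refine absurd (List.mem_reverse.1 ?_) ha
        rw [hc]
        exact List.mem_cons_self
  have hrot : c ++ Letter.R :: d ~r a.reverse ++ (b.reverse ++ [Letter.L]) := by
    have h1 : c ++ Letter.R :: d ~r Letter.R :: d ++ c := List.isRotated_append
    rw [List.cons_append, e] at h1
    exact h1.trans List.isRotated_append
  obtain ⟨k, hk, hrot⟩ := List.isRotated_iff_mod.1 hrot
  rw [List.rotate_eq_drop_append_take hk] at hrot
  exact ⟨_, _, t, a.reverse ++ b.reverse, (List.take_append_drop k _).symm, hrot.trans ht,
    by rw [hrot, List.append_assoc]⟩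

theorem wordMat_get (X : Letter) (t : List Letter) :
    wordMat (n := t.length) (fun i => (X :: t).get i) = (((X :: t).map Letter.sl).prod).1 := by
  have h : ∀ l : List Letter, ((l.map Letter.sl).prod).1 = (l.map Letter.mat).prod := by
    intro l
    induction l with
    | nil => rfl
    | cons Y l ih =>
      rw [List.map_cons, List.prod_cons, List.map_cons, List.prod_cons, ← ih]
      rfl
  rw [h, wordMat, prefixMat, List.take_of_length_le (by simp)]
  congr 1
  exact List.map_ofFn.symm.trans (congrArg (List.map Letter.mat) (List.ofFn_get (X :: t)))

theorem exists_word_of_list {l t u : List Letter} (h0 : l = Letter.R :: t)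
    (h1 : l = u ++ [Letter.L]) :
    ∃ (n : ℕ) (w : Fin (n + 1) → Letter), w 0 = .R ∧ w (Fin.last n) = .L ∧
      wordMat w = ((l.map Letter.sl).prod).1 := by
  refine ⟨t.length, fun i => (Letter.R :: t).get i, rfl, ?_, ?_⟩
  · have h2 : (Letter.R :: t).getLast (List.cons_ne_nil _ _) = .L := by
      simp [← h0, h1]
    rw [List.getLast_eq_getElem] at h2
    exact h2
  · rw [h0, wordMat_get]

theorem exists_isMonodromyWord {φ : SpecialLinearGroup (Fin 2) ℤ} (hφ : IsAnosov φ) :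
    ∃ (n : ℕ) (w : Fin (n + 1) → Letter) (s : ℤˣ), IsMonodromyWord φ w s := by
  have key : ∀ ψ : SpecialLinearGroup (Fin 2) ℤ, 2 < ψ 0 0 + ψ 1 1 →
      ∃ (n : ℕ) (w : Fin (n + 1) → Letter), w 0 = .R ∧ w (Fin.last n) = .L ∧
        ∃ A : SpecialLinearGroup (Fin 2) ℤ, (A * ψ * A⁻¹).1 = wordMat w := by
    intro ψ ht
    obtain ⟨A, hA⟩ := exists_conj_nonneg ψ ht
    obtain ⟨l, hl⟩ := exists_list_of_nonneg _ hA
    have ht' : 2 < (l.map Letter.sl).prod 0 0 + (l.map Letter.sl).prod 1 1 := by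
      rw [hl]
      have hdet := det_entries A
      have e : (A * ψ * A⁻¹) 0 0 + (A * ψ * A⁻¹) 1 1 = ψ 0 0 + ψ 1 1 := by
        simp only [mul_entry, inv_entries]
        linear_combination (ψ 0 0 + ψ 1 1) * hdet
      rwa [e]
    obtain ⟨p, q, t, u, rfl, h0, h1⟩ := exists_rotation (mem_of_trace ht' .R) (mem_of_trace ht' .L)
    obtain ⟨n, w, w0, w1, hw⟩ := exists_word_of_list h0 h1
    refine ⟨n, w, w0, w1, (q.map Letter.sl).prod * A, ?_⟩
    have e : (q.map Letter.sl).prod * A * ψ * ((q.map Letter.sl).prod * A)⁻¹ =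
        ((q ++ p).map Letter.sl).prod := by
      rw [List.map_append, List.prod_append] at hl ⊢
      rw [mul_assoc _ A ψ, mul_inv_eq_iff_eq_mul.1 hl.symm]
      group
    rw [hw, e]
  have h4 := sq_trace_of_isAnosov hφ
  have h5 : 2 < φ 0 0 + φ 1 1 ∨ 2 < -φ 0 0 + -φ 1 1 := by
    by_contra! h
    nlinarith
  rcases h5 with h | h
  · obtain ⟨n, w, w0, w1, A, hA⟩ := key φ h
    exact ⟨n, w, 1, w0, w1, A, by simpa using hA⟩
  · obtain ⟨n, w, w0, w1, A, hA⟩ := key (-φ) (by simpa using h)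
    refine ⟨n, w, -1, w0, w1, A, ?_⟩
    rw [← hA, mul_neg, neg_mul]
    simp

end Conjugation

/-! ### The components with positive parameters -/

section Components

variable {n : ℕ} {w : Fin (n + 1) → Letter}

theorem punctureLength_pos_of_mem (s : ℤˣ) (h0 : w 0 = .R) (h1 : w (Fin.last n) = .L)
    {σ : Fin (n + 1) → Letter} {z : Fin (n + 1) → ℝ} (hz : z ∈ patternSet w s σ) :
    0 < punctureLength w s z :=
  punctureLength_pos s h0 h1 (fun j => (hz.2 j).pos.ne') fun j => (hz.2 j).ne_one

end Components

end PuncturedTorus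

end

open PuncturedTorus in
theorem theorem1 (φ : Matrix.SpecialLinearGroup (Fin 2) ℤ) (hφ : IsAnosov φ) :
    (∃ (n : ℕ) (w : Fin (n + 1) → Letter) (s : ℤˣ), IsMonodromyWord φ w s) ∧
    ∀ (n : ℕ) (w : Fin (n + 1) → Letter) (s : ℤˣ), IsMonodromyWord φ w s →
      ∃ zp zm : Fin (n + 1) → ℝ,
        (∃ μ : ℝ, 1 < μ ∧ IsProjectionShape w μ zp) ∧
        (∃ μ : ℝ, 0 < μ ∧ μ < 1 ∧ IsProjectionShape w μ zm) ∧
        zp ∈ (monodromyTriangulation w s).realDeformationVariety ∧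
        zm ∈ (monodromyTriangulation w s).realDeformationVariety ∧
        Disjoint (connectedComponentIn (monodromyTriangulation w s).realDeformationVariety zp)
          (connectedComponentIn (monodromyTriangulation w s).realDeformationVariety zm) ∧
        connectedComponentIn (monodromyTriangulation w s).realDeformationVariety zp ∪
            connectedComponentIn (monodromyTriangulation w s).realDeformationVariety zm =
          {z | z ∈ (monodromyTriangulation w s).realDeformationVariety ∧ ∀ k, 0 < z k} ∧
        ∀ V : Set (Fin (n + 1) → ℝ),
          V = connectedComponentIn (monodromyTriangulation w s).realDeformationVariety zp ∨
            V = connectedComponentIn (monodromyTriangulation w s).realDeformationVariety zm →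
          (∀ z ∈ V, 0 < punctureLength w s z) ∧
          (∀ z ∈ V, ∃ v ∈ (monodromyTriangulation w s).tangentSpace z, ∀ k, 0 < v k) ∧
          ∃ γ : ℝ → Fin (n + 1) → ℝ,
            ContDiff ℝ ∞ γ ∧ Topology.IsEmbedding γ ∧ Set.range γ = V ∧
            (∀ t, deriv γ t ≠ 0) ∧
            (∀ t, (monodromyTriangulation w s).tangentSpace (γ t) =
              Submodule.span ℝ {deriv γ t}) ∧
            ∀ t, Real.log (punctureLength w s (γ t)) = t := by
  refine ⟨exists_isMonodromyWord hφ, fun n w s hw => ?_⟩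
  obtain ⟨h0, h1, -⟩ := hw
  obtain ⟨⟨μ, x, y, hμ, hx, hy, h⟩, ν, x', y', hν, hν', hx', hy', h'⟩ := exists_eigenforms h0 h1
  obtain ⟨zp, hzp, hp⟩ := exists_plus_shape s h0 h1 (one_pos.trans hμ) hx hy h
  obtain ⟨zm, hzm, hm⟩ := exists_minus_shape s h0 h1 hν hx' hy' h'
  -- The canonical shapes show that both systems have solutions; the resulting curves then make the
  -- pattern sets connected.
  have curve_plus := (plusChart h0 h1).exists_curve s h0 h1
    (Set.image_nonempty.1 (by rw [image_plusChart s h0 h1]; exact ⟨zp, hzp⟩))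
  have curve_minus := (minusChart h0 h1).exists_curve s h0 h1
    (Set.image_nonempty.1 (by rw [image_minusChart s h0 h1]; exact ⟨zm, hzm⟩))
  rw [image_plusChart s h0 h1] at curve_plus
  rw [image_minusChart s h0 h1] at curve_minus
  have comp_plus : connectedComponentIn (monodromyTriangulation w s).realDeformationVariety zp =
      patternSet w s fun j => w (j - 1) := by
    obtain ⟨-, γ, hγ, -, hr, -⟩ := curve_plus
    exact connectedComponentIn_eq_patternSet s (hr ▸ isPreconnected_range hγ.continuous) hzp
  have comp_minus : connectedComponentIn (monodromyTriangulation w s).realDeformationVariety zm =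
      patternSet w s w := by
    obtain ⟨-, γ, hγ, -, hr, -⟩ := curve_minus
    exact connectedComponentIn_eq_patternSet s (hr ▸ isPreconnected_range hγ.continuous) hzm
  refine ⟨zp, zm, ⟨μ, hμ, hp⟩, ⟨ν, hν, hν', hm⟩, hzp.1, hzm.1, ?_⟩
  rw [comp_plus, comp_minus]
  refine ⟨patternSet_disjoint s h0 h1, patternSet_union s ⟨_, h0⟩ ⟨_, h1⟩, fun V hV => ?_⟩
  rcases hV with rfl | rfl
  · exact ⟨fun z hz => punctureLength_pos_of_mem s h0 h1 hz, curve_plus⟩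
  · exact ⟨fun z hz => punctureLength_pos_of_mem s h0 h1 hz, curve_minus⟩
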